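/- Let $k$ be an algebraically closed field, $X$ a separated scheme of finite type over $k$, and $G$ an algebraic group (a group scheme of finite type) over $k$ acting on $X$ with finitely many orbits on $k$-points. Let $X^{\mathrm{top}}\subseteq X$ be the set of generic points of (irreducible components of) $G$-invariant closed subschemes of $X$. For $x\in X^{\mathrm{top}}$ write $\overline x$ for the closure of $\{x\}$ and $\dim x=\dim\overline x$. A *perversity* is a function $p\colon\{0,\dots,\dim X\}\to\mathbb Z$; it is *monotone* if it is (weakly) decreasing; write $p(x)=p(\dim x)$. For a closed subset $Z\subseteq X$ let $\Gamma_Z$ be the functor sending an $\mathcal O_X$-module to its subsheaf of sections supported in $Z$, and $R\Gamma_Z$ its right derived functor. A *$p$-measuring subvariety* is a closed subset $Z\subseteq X$ such that for every $x\in X^{\mathrm{top}}$ with $\overline x\cap Z\neq\emptyset$ one has $\dim(\overline x\cap Z)=p(x)+\dim x$, and $\overline x\cap Z$ is, up to radical, locally defined in $\overline x$ by exactly $-p(x)$ functions. A *$p$-measuring family* is a collection $\mathfrak M$ of $p$-measuring subvarieties of $X$ such that every $x\in X^{\mathrm{top}}$ satisfies $Z\cap\overline x\neq\emptyset$ for some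 $Z\in\mathfrak M$. Let $F$ be a $G$-equivariant coherent sheaf on $X$, $p$ a monotone perversity, $n$ an integer and $\mathfrak M$ a $p$-measuring family of subvarieties of $X$. Then the following are equivalent: 1. $p(\dim\operatorname{supp}F)\ge n$ (a condition that is understood to hold if $F=0$); 2. $H^i(R\Gamma_Z F)=0$ for all $i\ge -n+1$ and all $Z\in\mathfrak M$. -/

import Mathlib

open CategoryTheory Limits MonoidalCategory CartesianMonoidalCategory MonObj AlgebraicGeometry
open TopologicalSpace

universe u

attribute [local instance] CategoryTheory.Over.cartesianMonoidalCategory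

namespace PerverseCoherent

/-! ### Sheaves of modules on a scheme form a Grothendieck abelian category -/

instance presheafOfModules_hasExactColimits {C : Type u} [SmallCategory C]
    (R : Cᵒᵖ ⥤ RingCat.{u}) (K : Type u) [SmallCategory K] [IsFiltered K] :
    HasExactColimitsOfShape K (PresheafOfModules.{u} R) :=
  have : ReflectsFiniteLimits (PresheafOfModules.toPresheaf.{u} R) :=
    ⟨fun _ _ _ => reflectsLimitsOfShape_of_reflectsIsomorphisms⟩
  HasExactColimitsOfShape.domain_of_functor K (PresheafOfModules.toPresheaf.{u} R)

instance sheafOfModules_isGrothendieckAbelian {C : Type u} [SmallCategory C]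
    {J : GrothendieckTopology C} (R : Sheaf J RingCat.{u})
    [HasSheafify J AddCommGrpCat.{u}] [J.WEqualsLocallyBijective AddCommGrpCat.{u}] :
    IsGrothendieckAbelian.{u} (SheafOfModules.{u} R) := by
  let adj := PresheafOfModules.sheafificationAdjunction.{u} (𝟙 R.obj)
  have hcolim : HasColimits (SheafOfModules.{u} R) := inferInstance
  have hab5 : AB5OfSize.{u, u} (SheafOfModules.{u} R) :=
    ⟨fun K _ _ => adj.hasExactColimitsOfShape K⟩
  have hsep : HasSeparator (SheafOfModules.{u} R) := by
    let f : C → SheafOfModules.{u} R := fun U =>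
      (PresheafOfModules.sheafification.{u} (𝟙 R.obj)).obj
        ((PresheafOfModules.free R.obj).obj (yoneda.obj U))
    have hf : ObjectProperty.IsSeparating (.ofObj f) := by
      intro M N g₁ g₂ h
      refine (SheafOfModules.forget.{u} R ⋙
        PresheafOfModules.restrictScalars (𝟙 R.obj)).map_injective
          (PresheafOfModules.freeYoneda.isSeparating R.obj _ _ ?_)
      rintro _ ⟨U⟩ a
      apply (adj.homEquiv _ _).symm.injective
      exact (adj.homEquiv_naturality_right_symm a g₁).trans
        ((h _ (ObjectProperty.ofObj_apply f U) ((adj.homEquiv _ _).symm a)).trans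
          (adj.homEquiv_naturality_right_symm a g₂).symm)
    exact ⟨_, hf.isSeparator_coproduct⟩
  exact {}

instance modules_isGrothendieckAbelian (X : Scheme.{u}) :
    IsGrothendieckAbelian.{u} X.Modules :=
  inferInstanceAs (IsGrothendieckAbelian.{u} (SheafOfModules.{u} X.ringCatSheaf))

instance modules_enoughInjectives (X : Scheme.{u}) : EnoughInjectives X.Modules :=
  IsGrothendieckAbelian.enoughInjectives.{u}

/-! ### Local cohomology sheaves -/

/-- The open complement of a closed subset. -/
def openCompl {X : Scheme.{u}} (Z : Closeds X) : X.Opens := Z.compl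

/-- The functor `Γ_Z`, sending an `𝒪_X`-module to its submodule of sections supported in the
closed subset `Z`, i.e. the kernel of `M ⟶ j_* (M|_{X ∖ Z})` where `j : X ∖ Z ⟶ X` is the
inclusion: over an open `U` it consists of the sections of `M` over `U` that restrict to zero on
`U ∖ Z`. -/
noncomputable def sectionsSupportedIn {X : Scheme.{u}} (Z : Closeds X) :
    X.Modules ⥤ X.Modules where
  obj M := kernel ((Scheme.Modules.restrictAdjunction (openCompl Z).ι).unit.app M)
  map f := kernel.map _ _ f
    ((Scheme.Modules.restrictFunctor (openCompl Z).ι ⋙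
      Scheme.Modules.pushforward (openCompl Z).ι).map f)
    ((Scheme.Modules.restrictAdjunction (openCompl Z).ι).unit.naturality f).symm
  map_id M := by
    apply (cancel_mono (kernel.ι _)).mp
    simp
  map_comp f g := by
    apply (cancel_mono (kernel.ι _)).mp
    simp

instance {X : Scheme.{u}} (Z : Closeds X) : (sectionsSupportedIn Z).Additive where
  map_add {M N f g} := by
    apply (cancel_mono (kernel.ι _)).mp
    refine Eq.trans ?_ (Preadditive.add_comp _ _ _ _ _ _).symm
    simp [sectionsSupportedIn]
    rfl

/-- The `i`-th local cohomology sheaf `H^i(RΓ_Z -)`, the `i`-th right derived functor of `Γ_Z`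
on `𝒪_X`-modules. -/
noncomputable def localCohomologySheaf {X : Scheme.{u}} (Z : Closeds X) (i : ℕ) :
    X.Modules ⥤ X.Modules :=
  (sectionsSupportedIn Z).rightDerived i

/-! ### Coherent sheaves and their support -/

/-- Coherent sheaves on a (locally) Noetherian scheme: quasi-coherent modules of finite type. -/
structure IsCoherent {X : Scheme.{u}} (M : X.Modules) : Prop where
  isQuasicoherent : SheafOfModules.IsQuasicoherent.{u} (R := X.ringCatSheaf) M
  isFiniteType : SheafOfModules.IsFiniteType.{u} (R := X.ringCatSheaf) M

/-- The support of an `𝒪_X`-module: the set of points with non-zero stalk. -/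
def support {X : Scheme.{u}} (M : X.Modules) : Set X :=
  {x | Nontrivial (TopCat.Presheaf.stalk (C := Ab.{u}) M.presheaf x)}

/-! ### Equivariant coherent sheaves -/

/-- The pullback along `f` of a morphism `q₁^* F ⟶ q₂^* F`, seen as a morphism
`(q₁ ∘ f)^* F ⟶ (q₂ ∘ f)^* F`. -/
noncomputable def pullHom {A B X : Scheme.{u}} (f : A ⟶ B) {q₁ q₂ : B ⟶ X} {F : X.Modules}
    (φ : (Scheme.Modules.pullback q₁).obj F ⟶ (Scheme.Modules.pullback q₂).obj F) :
    (Scheme.Modules.pullback (f ≫ q₁)).obj F ⟶ (Scheme.Modules.pullback (f ≫ q₂)).obj F :=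
  (Scheme.Modules.pullbackComp f q₁).inv.app F ≫ (Scheme.Modules.pullback f).map φ ≫
    (Scheme.Modules.pullbackComp f q₂).hom.app F

section Action

variable {S : Scheme.{u}} (G X : Over S) [GrpObj G] [ModObj G X]

/-- The action `G × X ⟶ X`, `(g, x) ↦ g x`, as a morphism of schemes. -/
noncomputable abbrev act : (G ⊗ X).left ⟶ X.left := (ModObj.smul (M := G) (X := X)).left

/-- The projection `G × X ⟶ X`, `(g, x) ↦ x`. -/
noncomputable abbrev pr : (G ⊗ X).left ⟶ X.left := (snd G X).left

/-- `G × (G × X) ⟶ G × X`, `(g, h, x) ↦ (g h, x)`. -/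
noncomputable abbrev mulMap : (G ⊗ (G ⊗ X)).left ⟶ (G ⊗ X).left :=
  ((α_ G G X).inv ≫ μ[G] ▷ X).left

/-- `G × (G × X) ⟶ G × X`, `(g, h, x) ↦ (g, h x)`. -/
noncomputable abbrev actMap : (G ⊗ (G ⊗ X)).left ⟶ (G ⊗ X).left :=
  (G ◁ ModObj.smul (M := G) (X := X)).left

/-- `G × (G × X) ⟶ G × X`, `(g, h, x) ↦ (h, x)`. -/
noncomputable abbrev prMap : (G ⊗ (G ⊗ X)).left ⟶ (G ⊗ X).left := (snd G (G ⊗ X)).left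

lemma mulMap_act : mulMap G X ≫ act G X = actMap G X ≫ act G X := by
  rw [← Over.comp_left, ← Over.comp_left]
  congr 1
  have := ModObj.mul_smul (M := G) X
  simp only [Category.assoc]
  rw [Iso.inv_comp_eq]
  exact this

lemma actMap_pr : actMap G X ≫ pr G X = prMap G X ≫ act G X := by
  rw [← Over.comp_left, ← Over.comp_left]
  congr 1
  exact whiskerLeft_snd _ _

set_option linter.unusedSectionVars false in
lemma prMap_pr : prMap G X ≫ pr G X = mulMap G X ≫ pr G X := by
  rw [← Over.comp_left, ← Over.comp_left]
  congr 1
  simp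

/-- A `G`-equivariant coherent sheaf on `X`: a coherent sheaf `F` with an isomorphism
`act^* F ≅ pr^* F` on `G × X` that satisfies the cocycle condition on `G × G × X`. On fibres
the isomorphism is `φ(g, x) : F(g x) ≅ F(x)`, and the condition says
`φ(g h, x) = φ(h, x) ∘ φ(g, h x)`. -/
structure EquivariantCoherentSheaf where
  sheaf : X.left.Modules
  isCoherent : IsCoherent sheaf
  iso : (Scheme.Modules.pullback (act G X)).obj sheaf ≅ (Scheme.Modules.pullback (pr G X)).obj sheaf
  cocycle : pullHom (mulMap G X) iso.hom =
    (Scheme.Modules.pullbackCongr (mulMap_act G X)).hom.app sheaf ≫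
      pullHom (actMap G X) iso.hom ≫
      (Scheme.Modules.pullbackCongr (actMap_pr G X)).hom.app sheaf ≫
      pullHom (prMap G X) iso.hom ≫
      (Scheme.Modules.pullbackCongr (prMap_pr G X)).hom.app sheaf

/-! ### Invariant subsets and orbits -/

/-- A closed subset `Y` of `X` is `G`-invariant if its preimages under the action and under the
projection `G × X ⟶ X` agree. -/
def IsInvariant (Y : Closeds X.left) : Prop :=
  act G X ⁻¹' (Y : Set X.left) = pr G X ⁻¹' (Y : Set X.left)

/-- The set `X^top` of generic points of (irreducible components of) `G`-invariant closed
subschemes of `X`. -/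
def topPoints : Set X.left :=
  {x | ∃ Y : Closeds X.left, IsInvariant G X Y ∧ x ∈ Y ∧ ∀ y ∈ Y, y ⤳ x → y = x}

/-- The action of the group of `S`-points of `G` on the set of `S`-points of `X` has finitely many
orbits. -/
def HasFinitelyManyOrbits : Prop :=
  Finite (MulAction.orbitRel.Quotient (𝟙_ (Over S) ⟶ G) (𝟙_ (Over S) ⟶ X))

end Action

/-! ### Perversities and measuring families -/

/-- A perversity on `X`: a function `{0, …, dim X} → ℤ`. -/
abbrev Perversity (X : Scheme.{u}) : Type :=
  {d : ℕ // (d : WithBot ℕ∞) ≤ topologicalKrullDim X} → ℤ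

/-- Near every point of `x̄`, the subset `x̄ ∩ Z` of `x̄` is the set of common zeros of `m`
functions. (Functions on the closed subscheme `x̄` lift locally to functions on `X`.) -/
def IsLocallyCutOutBy {X : Scheme.{u}} (x : X) (Z : Closeds X) (m : ℕ) : Prop :=
  ∀ z ∈ closure {x}, ∃ (U : X.Opens) (_ : z ∈ U) (f : Fin m → Γ(X, U)),
    ∀ y ∈ U, y ∈ closure {x} → (y ∈ Z ↔ ∀ j, y ∉ X.basicOpen (f j))

section Measuring

variable {S : Scheme.{u}} (G X : Over S) [GrpObj G] [ModObj G X]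

/-- `Z` is a `p`-measuring subvariety of `X`: for each `x ∈ X^top` with `x̄ ∩ Z ≠ ∅` one has
`dim (x̄ ∩ Z) = p(dim x̄) + dim x̄`, and `x̄ ∩ Z` is locally defined in `x̄`, up to radical, by
exactly `-p(dim x̄)` functions. -/
def IsMeasuring (p : Perversity X.left) (Z : Closeds X.left) : Prop :=
  ∀ x ∈ topPoints G X, (closure {x} ∩ (Z : Set X.left)).Nonempty →
    ∃ d, topologicalKrullDim (closure {x} : Set X.left) = (d.1 : WithBot ℕ∞) ∧
      (∃ e : ℕ, topologicalKrullDim (closure {x} ∩ Z : Set X.left) = (e : WithBot ℕ∞) ∧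
        (e : ℤ) = p d + d.1) ∧
      ∃ m : ℕ, (m : ℤ) = -p d ∧ IsLocallyCutOutBy x Z m

/-- `M` is a `p`-measuring family of subvarieties of `X`. -/
structure IsMeasuringFamily (p : Perversity X.left) (M : Set (Closeds X.left)) : Prop where
  isMeasuring : ∀ Z ∈ M, IsMeasuring G X p Z
  meets : ∀ x ∈ topPoints G X, ∃ Z ∈ M, ((Z : Set X.left) ∩ closure {x}).Nonempty

end Measuring

end PerverseCoherent

/-!
The support `S` of an equivariant coherent sheaf `F` is invariant, because the fibres of `F` at
`g x` and at `x` are isomorphic (`EquivariantCoherentSheaf.isInvariant_support`). The generic points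
of its components therefore belong to `X^top`, so that the measuring condition controls `Z ∩ x̄`
for each component `x̄` of `S`. What remains is a statement about the local cohomology of a coherent
sheaf with supports in `Z`, when `Z` is cut out by `-p(dim x̄)` equations in each component `x̄` and has
dimension `p(dim x̄) + dim x̄` there.

*Vanishing.* Let `Z` be cut out by fewer than `i` equations in each component of `S` that it
meets. Local cohomology can be computed on affine charts (`derivedVanish_of_restrict`) and there
from an injective resolution of modules (`derivedVanish_tilde_iff`), since the sheaf associated
with an injective module over a noetherian ring is flasque. A finitely generated module is a
successive extension of quotients `R ⧸ q`, each of them killed by the ideal `P` of a component. An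
injective resolution of `R ⧸ q` can be chosen to be supported in `V(P)`, where it does not see the
difference between `Z` and `Z ∩ V(P)`, the zero set in `V(P)` of fewer than `i` functions
(`derivedVanish_tilde_of_forall_prime`). As `p` is decreasing, `-p(dim x̄) ≤ -p(dim S)` for all
components, and `n ≤ p(dim S)` gives the vanishing in all degrees `i ≥ -n + 1`.

*Non-vanishing.* Let `x̄` be a component of maximal dimension `d`, let `Z` be a member of the
family that meets it, and put `m = -p(d)`. It suffices that the local cohomology of `F` does not
vanish in all degrees at least `m`. On a chart around a closed point `w` of `Z ∩ x̄`, the module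
of `F` maps onto a non-zero ideal `𝔞` of the coordinate ring of `x̄`. No component needs more than
`m` equations, so that the kernel has no local cohomology above degree `m` by the first part, and
`𝔞` would have none from degree `m` on. As `Z ∩ x̄` has dimension `d - m`, the point `w` is
isolated in the intersection of `Z ∩ x̄` with at most `d - m` further hypersurfaces; each of these
moves the vanishing range by one, and the local cohomology of `𝔞` with supports in that
intersection would vanish from degree `d` on. This contradicts the non-vanishing of top local
cohomology (`ModuleChain.not_vanish_of_isolated_point`): with a Noether normalization
`k[t₁, …, t_D]` whose variables vanish at `w`, the classes of the fractions `v / (t₁ ⋯ t_D) ^ M`, for a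
fixed `v ≠ 0` in `𝔞` and all `M`, would be zero near `w`; linear functionals to the polynomial
ring, where the monomial can be cancelled, show that a fixed non-zero multiple of `v` lies in all
powers of the maximal ideal at `w`, against Krull's intersection theorem. That `D ≥ d` follows
from the invariance of the transcendence degree of the function field of `x̄`
(`le_of_trdeg_quotient_eq`).

The vanishing of derived functors is handled without long exact sequences: `DerivedVanish` is
propagated along short exact sequences by dimension shifting along syzygies (`SyzygyChain`).
-/

namespace PerverseCoherent

/-! ### Syzygies and right derived functors -/

section Derived

set_option linter.unusedSectionVars false

universe v₁ v₂ u₁ u₂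
variable {C : Type u₁} [Category.{v₁} C] [Abelian C] {D : Type u₂} [Category.{v₂} D] [Abelian D]

/-- A resolution cut into short exact sequences `0 ⟶ Fₙ ⟶ Jₙ ⟶ Fₙ₊₁ ⟶ 0`. -/
structure SyzygyChain (C : Type u₁) [Category.{v₁} C] [Abelian C] where
  /-- The `n`-th short exact sequence. -/
  S : ℕ → ShortComplex C
  shortExact : ∀ n, (S n).ShortExact
  /-- The identification of the quotient of each sequence with the subobject of the next. -/
  e : ∀ n, (S n).X₃ ≅ (S (n + 1)).X₁

namespace SyzygyChain

variable (c : SyzygyChain C)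

/-- The differential of the resolution that is cut into the pieces of `c`. -/
def d (n : ℕ) : (c.S n).X₂ ⟶ (c.S (n + 1)).X₂ := (c.S n).g ≫ (c.e n).hom ≫ (c.S (n + 1)).f

@[simp]
lemma d_comp_d (n : ℕ) : c.d n ≫ c.d (n + 1) = 0 := by
  simp [d]

lemma exact_f_d (n : ℕ) : (ShortComplex.mk (c.S n).f (c.d n) (by simp [d])).Exact := by
  have := (c.shortExact (n + 1)).mono_f
  let α : c.S n ⟶ ShortComplex.mk (c.S n).f (c.d n) (by simp [d]) :=
    { τ₁ := 𝟙 _, τ₂ := 𝟙 _, τ₃ := (c.e n).hom ≫ (c.S (n + 1)).f, comm₂₃ := by simp [d] }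
  have : Mono α.τ₃ := mono_comp _ _
  rw [← ShortComplex.exact_iff_of_epi_of_isIso_of_mono α]
  exact (c.shortExact n).exact

lemma exact_d_d (n : ℕ) : (ShortComplex.mk (c.d n) (c.d (n + 1)) (by simp)).Exact := by
  have := (c.shortExact n).epi_g
  let α : ShortComplex.mk (c.d n) (c.d (n + 1)) (by simp) ⟶
      ShortComplex.mk (c.S (n + 1)).f (c.d (n + 1)) (by simp [d]) :=
    { τ₁ := (c.S n).g ≫ (c.e n).hom, τ₂ := 𝟙 _, τ₃ := 𝟙 _, comm₁₂ := by simp [d] }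
  have : Epi α.τ₁ := epi_comp _ _
  rw [ShortComplex.exact_iff_of_epi_of_isIso_of_mono α]
  exact c.exact_f_d (n + 1)

/-- The complex formed by the middle terms of the pieces. -/
noncomputable def complex : CochainComplex C ℕ :=
  CochainComplex.of (fun n => (c.S n).X₂) c.d (fun n => c.d_comp_d n)

lemma complex_d (n : ℕ) : c.complex.d n (n + 1) = c.d n := by
  exact CochainComplex.of_d (fun n => (c.S n).X₂) c.d n

lemma complex_exactAt_succ (n : ℕ) : c.complex.ExactAt (n + 1) := by
  rw [HomologicalComplex.exactAt_iff' _ n (n + 1) (n + 1 + 1) (by simp) (by simp)]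
  refine (ShortComplex.exact_iff_of_iso ?_).2 (c.exact_d_d n)
  exact ShortComplex.isoMk (Iso.refl _) (Iso.refl _) (Iso.refl _)
    ((Category.id_comp _).trans ((c.complex_d n).symm.trans (Category.comp_id _).symm))
    ((Category.id_comp _).trans ((c.complex_d (n + 1)).symm.trans (Category.comp_id _).symm))

/-- A chain with injective middle terms is an injective resolution of its first term. -/
noncomputable def injectiveResolution (h : ∀ n, Injective (c.S n).X₂) :
    InjectiveResolution (c.S 0).X₁ :=
  .mk c.complex h
    ((CochainComplex.fromSingle₀Equiv _ _).symm ⟨(c.S 0).f, by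
      exact (congrArg ((c.S 0).f ≫ ·) (c.complex_d 0)).trans
        (ShortComplex.mk (c.S 0).f (c.d 0) (by simp [d])).zero⟩)
    ⟨fun n => by
      cases n with
      | zero =>
        rw [CochainComplex.quasiIsoAt₀_iff, ShortComplex.quasiIso_iff_of_zeros]
        · have := (c.shortExact 0).mono_f
          refine (ShortComplex.exact_and_mono_f_iff_of_iso ?_).2
            ⟨c.exact_f_d 0, by dsimp; infer_instance⟩
          exact ShortComplex.isoMk (Iso.refl _) (Iso.refl _) (Iso.refl _)
            ((Category.id_comp _).trans ((CochainComplex.fromSingle₀Equiv_symm_apply_f_zero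
              (C := c.complex) (c.S 0).f _).symm.trans (Category.comp_id _).symm))
            ((Category.id_comp _).trans ((c.complex_d 0).symm.trans (Category.comp_id _).symm))
        all_goals rfl
      | succ n =>
        rw [quasiIsoAt_iff_exactAt]
        · exact c.complex_exactAt_succ n
        · apply CochainComplex.exactAt_succ_single_obj⟩

/-- Dropping the first piece. -/
def tail : SyzygyChain C where
  S n := c.S (n + 1)
  shortExact n := c.shortExact (n + 1)
  e n := c.e (n + 1)

/-- Prepending a piece. -/
def cons (S : ShortComplex C) (hS : S.ShortExact) (e : S.X₃ ≅ (c.S 0).X₁) : SyzygyChain C where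
  S n := n.casesOn S c.S
  shortExact n := by cases n; exacts [hS, c.shortExact _]
  e n := by cases n; exacts [e, c.e _]

/-- The image of a chain under an exact functor. -/
@[simps]
def map (G : C ⥤ D) [G.Additive] [PreservesFiniteLimits G] [PreservesFiniteColimits G] :
    SyzygyChain D where
  S n := (c.S n).map G
  shortExact n := by
    have := (c.shortExact n).mono_f
    have := (c.shortExact n).epi_g
    exact (c.shortExact n).map G
  e n := G.mapIso (c.e n)

/-- The iterated cokernels of embeddings into injective objects. -/
noncomputable def iteratedCokernel [EnoughInjectives C] (A : C) : ℕ → C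
  | 0 => A
  | n + 1 => cokernel (Injective.ι (iteratedCokernel A n))

/-- A chain starting at `A` whose middle terms are injective. -/
noncomputable def ofEnoughInjectives [EnoughInjectives C] (A : C) : SyzygyChain C where
  S n := ShortComplex.mk (Injective.ι (iteratedCokernel A n)) (cokernel.π _) (cokernel.condition _)
  shortExact _ := { exact := ShortComplex.exact_cokernel _ }
  e _ := Iso.refl _

instance [EnoughInjectives C] (A : C) (n : ℕ) : Injective ((ofEnoughInjectives A).S n).X₂ := by
  dsimp [ofEnoughInjectives]; infer_instance

end SyzygyChain

variable [EnoughInjectives C] (Φ : C ⥤ D) [Φ.Additive]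

/-- The vanishing of the `n`-th right derived functor on an object. -/
def DerivedVanish (n : ℕ) (A : C) : Prop := IsZero ((Φ.rightDerived n).obj A)

variable {Φ}

lemma DerivedVanish.of_iso {n : ℕ} {A B : C} (h : DerivedVanish Φ n A) (e : A ≅ B) :
    DerivedVanish Φ n B :=
  IsZero.of_iso h ((Φ.rightDerived n).mapIso e.symm)

lemma DerivedVanish.injective (n : ℕ) (A : C) [Injective A] : DerivedVanish Φ (n + 1) A :=
  Φ.isZero_rightDerived_obj_injective_succ n A

variable [PreservesFiniteLimits Φ]

lemma derivedVanish_zero_iff {A : C} : DerivedVanish Φ 0 A ↔ IsZero (Φ.obj A) :=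
  ⟨fun h => IsZero.of_iso h (Φ.rightDerivedZeroIsoSelf.app A).symm,
   fun h => IsZero.of_iso h (Φ.rightDerivedZeroIsoSelf.app A)⟩

/-- The cokernel of `Φ Jₙ ⟶ Φ Fₙ₊₁` is the derived functor `R^{n+1}Φ` of `F₀`. -/
lemma SyzygyChain.derivedVanish_succ_iff (c : SyzygyChain C) (h : ∀ n, Injective (c.S n).X₂)
    (n : ℕ) : DerivedVanish Φ (n + 1) (c.S 0).X₁ ↔ Epi (Φ.map (c.S n).g) := by
  rw [DerivedVanish, Iso.isZero_iff ((c.injectiveResolution h).isoRightDerivedObj Φ (n + 1)),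
    HomologicalComplex.homologyFunctor_obj, ← HomologicalComplex.exactAt_iff_isZero_homology,
    HomologicalComplex.exactAt_iff' _ n (n + 1) (n + 1 + 1) (by simp) (by simp)]
  have h1 : (ShortComplex.mk (Φ.map (c.d n)) (Φ.map (c.d (n + 1)))
      (by rw [← Φ.map_comp]; simp)).Exact ↔ Epi (Φ.map (c.S n).g) := by
    have hm := (c.shortExact (n + 1)).mono_f
    have hk : (ShortComplex.mk (c.S (n + 1)).f (c.d (n + 1)) (by simp [d])).Exact :=
      c.exact_f_d (n + 1)
    have hk' : (ShortComplex.mk (Φ.map (c.S (n + 1)).f) (Φ.map (c.d (n + 1)))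
      (by rw [← Φ.map_comp]; simp [d])).Exact :=
      hk.map_of_mono_of_preservesKernel Φ hm inferInstance
    constructor
    · intro hex
      rw [epi_iff_surjective_up_to_refinements]
      intro T y
      obtain ⟨T', π, hπ, x, hx⟩ := hex.exact_up_to_refinements
        (y ≫ Φ.map (c.e n).hom ≫ Φ.map (c.S (n + 1)).f) (by
          simp only [Category.assoc, ← Φ.map_comp]; simp [d])
      refine ⟨T', π, hπ, x, ?_⟩
      have : Mono (Φ.map ((c.e n).hom ≫ (c.S (n + 1)).f)) := by
        have : Mono ((c.e n).hom ≫ (c.S (n + 1)).f) := mono_comp _ _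
        infer_instance
      rw [← cancel_mono (Φ.map ((c.e n).hom ≫ (c.S (n + 1)).f))]
      simpa [d] using hx
    · intro hepi
      rw [ShortComplex.exact_iff_exact_up_to_refinements]
      intro T y hy
      obtain ⟨T', π, hπ, x, hx⟩ := hk'.exact_up_to_refinements y hy
      have : Epi (Φ.map (c.S n).g ≫ Φ.map (c.e n).hom) := epi_comp _ _
      obtain ⟨T'', π', hπ', z, hz⟩ := surjective_up_to_refinements_of_epi
        (Φ.map (c.S n).g ≫ Φ.map (c.e n).hom) x
      refine ⟨T'', π' ≫ π, epi_comp _ _, z, ?_⟩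
      dsimp at hx ⊢
      rw [Category.assoc, hx, reassoc_of% hz]
      simp [d]
  rw [← h1]
  refine ShortComplex.exact_iff_of_iso ?_
  exact ShortComplex.isoMk (Iso.refl _) (Iso.refl _) (Iso.refl _)
    ((Category.id_comp _).trans ((congrArg Φ.map (c.complex_d n).symm).trans
      (Category.comp_id _).symm))
    ((Category.id_comp _).trans ((congrArg Φ.map (c.complex_d (n + 1)).symm).trans
      (Category.comp_id _).symm))

lemma exists_cons_ofEnoughInjectives {S : ShortComplex C} (hS : S.ShortExact) [Injective S.X₂] :
    ∃ c c' : SyzygyChain C, (c.S 0) = S ∧ (c'.S 0).X₁ = S.X₃ ∧ (∀ n, c.S (n + 1) = c'.S n) ∧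
      (∀ n, Injective (c.S n).X₂) ∧ (∀ n, Injective (c'.S n).X₂) := by
  refine ⟨(SyzygyChain.ofEnoughInjectives S.X₃).cons S hS (Iso.refl S.X₃),
    SyzygyChain.ofEnoughInjectives S.X₃, rfl, rfl, fun _ => rfl, fun n => ?_,
    fun _ => inferInstance⟩
  cases n
  · assumption
  · dsimp [SyzygyChain.cons]; infer_instance

lemma derivedVanish_one_iff_of_injective {S : ShortComplex C} (hS : S.ShortExact)
    [Injective S.X₂] : DerivedVanish Φ 1 S.X₁ ↔ Epi (Φ.map S.g) := by
  obtain ⟨c, c', rfl, -, -, h, -⟩ := exists_cons_ofEnoughInjectives hS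
  exact c.derivedVanish_succ_iff h 0

lemma derivedVanish_shift_of_injective {S : ShortComplex C} (hS : S.ShortExact)
    [Injective S.X₂] (n : ℕ) : DerivedVanish Φ (n + 2) S.X₁ ↔ DerivedVanish Φ (n + 1) S.X₃ := by
  obtain ⟨c, c', rfl, h₁, h₂, h, h'⟩ := exists_cons_ofEnoughInjectives hS
  rw [c.derivedVanish_succ_iff h (n + 1), h₂ n, ← h₁, c'.derivedVanish_succ_iff h' n]

/-- A short exact sequence `0 ⟶ A ⟶ B ⟶ C ⟶ 0` and an embedding `B ⟶ I` into an injective object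
give the short exact sequence `0 ⟶ C ⟶ I/A ⟶ I/B ⟶ 0`. -/
lemma exists_rotation {S : ShortComplex C} (hS : S.ShortExact) :
    ∃ SA SB R : ShortComplex C, SA.ShortExact ∧ SB.ShortExact ∧ R.ShortExact ∧
      Injective SA.X₂ ∧ Injective SB.X₂ ∧
      ∃ (_ : SA.X₁ ≅ S.X₁) (eB : SB.X₁ ≅ S.X₂) (e : SA.X₂ ≅ SB.X₂) (eC : R.X₁ ≅ S.X₃)
        (eQ : R.X₂ ≅ SA.X₃) (eQ' : R.X₃ ≅ SB.X₃),
        SA.g ≫ eQ.inv ≫ R.g ≫ eQ'.hom = e.hom ≫ SB.g ∧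
        SB.f ≫ e.inv ≫ SA.g = eB.hom ≫ S.g ≫ eC.inv ≫ R.f ≫ eQ.hom := by
  have := hS.mono_f
  have := hS.epi_g
  let j := Injective.ι S.X₂
  have hw : S.f ≫ j ≫ cokernel.π (S.f ≫ j) = 0 := by
    rw [← Category.assoc, cokernel.condition]
  let r : S.X₃ ⟶ cokernel (S.f ≫ j) :=
    hS.exact.desc (j ≫ cokernel.π (S.f ≫ j)) hw
  have hr : S.g ≫ r = j ≫ cokernel.π (S.f ≫ j) := hS.exact.g_desc _ _
  let s : cokernel (S.f ≫ j) ⟶ cokernel j := cokernel.desc _ (cokernel.π j) (by simp)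
  have hs : cokernel.π (S.f ≫ j) ≫ s = cokernel.π j := cokernel.π_desc _ _ _
  have hrs : r ≫ s = 0 := by
    rw [← cancel_epi S.g, reassoc_of% hr, hs, cokernel.condition, comp_zero]
  have hA : (ShortComplex.mk (S.f ≫ j) (cokernel.π _) (cokernel.condition _)).ShortExact :=
    { exact := ShortComplex.exact_cokernel _ }
  have hB : (ShortComplex.mk j (cokernel.π _) (cokernel.condition _)).ShortExact :=
    { exact := ShortComplex.exact_cokernel _ }
  have hR : (ShortComplex.mk r s hrs).ShortExact := by
    refine { exact := ?_, mono_f := ?_, epi_g := ?_ }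
    · rw [ShortComplex.exact_iff_exact_up_to_refinements]
      intro T x hx
      obtain ⟨T₁, π₁, _, i, hi⟩ :=
        surjective_up_to_refinements_of_epi (cokernel.π (S.f ≫ j)) x
      obtain ⟨T₂, π₂, _, b, hb⟩ := hB.exact.exact_up_to_refinements i (by
        have h : i ≫ cokernel.π (S.f ≫ j) ≫ s = 0 := by
          rw [← reassoc_of% hi]; dsimp at hx; rw [hx, comp_zero]
        rwa [hs] at h)
      refine ⟨T₂, π₂ ≫ π₁, epi_comp _ _, b ≫ S.g, ?_⟩
      dsimp at hb ⊢
      rw [Category.assoc, hi, Category.assoc, hr, reassoc_of% hb]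
    · refine Preadditive.mono_of_cancel_zero _ fun {T} t ht => ?_
      obtain ⟨T₁, π₁, _, b, hb⟩ := surjective_up_to_refinements_of_epi S.g t
      obtain ⟨T₂, π₂, _, a, ha⟩ := hA.exact.exact_up_to_refinements (b ≫ j) (by
        dsimp at ht ⊢
        rw [Category.assoc, ← hr, ← reassoc_of% hb, ht, comp_zero])
      have h : π₂ ≫ b = a ≫ S.f := by
        rw [← cancel_mono j, Category.assoc, Category.assoc]; exact ha
      rw [← cancel_epi π₁, hb, ← cancel_epi π₂, reassoc_of% h]
      simp
    · have : Epi (cokernel.π (S.f ≫ j) ≫ s) := by rw [hs]; infer_instance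
      exact epi_of_epi (cokernel.π (S.f ≫ j)) s
  refine ⟨_, _, _, hA, hB, hR, ?_, ?_, Iso.refl _, Iso.refl _, Iso.refl _, Iso.refl _, Iso.refl _,
    Iso.refl _, ?_, ?_⟩
  · dsimp; infer_instance
  · dsimp; infer_instance
  · simpa using hs
  · simpa using hr.symm

lemma mono_map_f {S : ShortComplex C} (hS : S.ShortExact) : Mono (Φ.map S.f) := by
  have := hS.mono_f
  infer_instance

lemma exact_map {S : ShortComplex C} (hS : S.ShortExact) : (S.map Φ).Exact :=
  hS.exact.map_of_mono_of_preservesKernel Φ hS.mono_f inferInstance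

lemma exists_lift_map {S : ShortComplex C} (hS : S.ShortExact) {T : D} (x : T ⟶ Φ.obj S.X₂)
    (hx : x ≫ Φ.map S.g = 0) : ∃ (T' : D) (π : T' ⟶ T) (_ : Epi π) (y : T' ⟶ Φ.obj S.X₁),
      π ≫ x = y ≫ Φ.map S.f :=
  (exact_map hS).exact_up_to_refinements x hx

lemma DerivedVanish.epi_map {S : ShortComplex C} (hS : S.ShortExact)
    (h : DerivedVanish Φ 1 S.X₁) : Epi (Φ.map S.g) := by
  obtain ⟨SA, SB, R, hA, hB, hR, _, _, eA, eB, e, eC, eQ, eQ', h₁, h₂⟩ := exists_rotation hS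
  have hepi : Epi (Φ.map SA.g) :=
    (derivedVanish_one_iff_of_injective hA).1 (h.of_iso eA.symm)
  have := mono_map_f (Φ := Φ) hR
  rw [epi_iff_surjective_up_to_refinements]
  intro T t
  obtain ⟨T₁, π₁, _, y, hy⟩ := surjective_up_to_refinements_of_epi (Φ.map SA.g)
    (t ≫ Φ.map (eC.inv ≫ R.f ≫ eQ.hom))
  obtain ⟨T₂, π₂, _, b, hb⟩ := exists_lift_map (Φ := Φ) hB
    (y ≫ Φ.map e.hom) (by
      rw [Category.assoc, ← Φ.map_comp, ← h₁, Φ.map_comp, ← reassoc_of% hy, ← Φ.map_comp]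
      simp)
  refine ⟨T₂, π₂ ≫ π₁, epi_comp _ _, b ≫ Φ.map eB.hom, ?_⟩
  have hm : Mono (Φ.map (eC.inv ≫ R.f ≫ eQ.hom)) := by
    have := hR.mono_f
    have : Mono (eC.inv ≫ R.f ≫ eQ.hom) := inferInstance
    infer_instance
  rw [← cancel_mono (Φ.map (eC.inv ≫ R.f ≫ eQ.hom))]
  have h₃ : Φ.map SB.f ≫ Φ.map e.inv ≫ Φ.map SA.g =
      Φ.map eB.hom ≫ Φ.map S.g ≫ Φ.map (eC.inv ≫ R.f ≫ eQ.hom) := by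
    simp only [← Φ.map_comp, h₂]
  simp only [Category.assoc]
  rw [hy, ← h₃, ← reassoc_of% hb, ← Φ.map_comp_assoc e.hom]
  simp

lemma derivedVanish_one_of_epi {S : ShortComplex C} (hS : S.ShortExact)
    (h : DerivedVanish Φ 1 S.X₂) (hg : Epi (Φ.map S.g)) : DerivedVanish Φ 1 S.X₁ := by
  obtain ⟨SA, SB, R, hA, hB, hR, _, _, eA, eB, e, eC, eQ, eQ', h₁, h₂⟩ := exists_rotation hS
  refine DerivedVanish.of_iso ((derivedVanish_one_iff_of_injective hA).2 ?_) eA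
  have hepi : Epi (Φ.map SB.g) :=
    (derivedVanish_one_iff_of_injective hB).1 (h.of_iso eB.symm)
  rw [epi_iff_surjective_up_to_refinements]
  intro T t
  obtain ⟨T₁, π₁, _, y, hy⟩ := surjective_up_to_refinements_of_epi (Φ.map SB.g)
    (t ≫ Φ.map (eQ.inv ≫ R.g ≫ eQ'.hom))
  obtain ⟨T₂, π₂, _, c, hc⟩ := exists_lift_map (Φ := Φ) hR
    ((π₁ ≫ t - y ≫ Φ.map (e.inv ≫ SA.g)) ≫ Φ.map eQ.inv) (by
      rw [← cancel_mono (Φ.map eQ'.hom)]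
      simp only [Category.assoc, ← Φ.map_comp, Preadditive.sub_comp, h₁, zero_comp]
      simp only [Functor.map_comp] at hy ⊢
      rw [hy, ← Φ.map_comp_assoc e.inv]
      simp)
  obtain ⟨T₃, π₃, _, b, hb⟩ := surjective_up_to_refinements_of_epi (Φ.map S.g) (c ≫ Φ.map eC.hom)
  have h₃ : Φ.map SB.f ≫ Φ.map e.inv ≫ Φ.map SA.g =
      Φ.map eB.hom ≫ Φ.map S.g ≫ Φ.map (eC.inv ≫ R.f ≫ eQ.hom) := by
    simp only [← Φ.map_comp, h₂]
  refine ⟨T₃, π₃ ≫ π₂ ≫ π₁, epi_comp _ _,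
    (π₃ ≫ π₂ ≫ y + b ≫ Φ.map (eB.inv ≫ SB.f)) ≫ Φ.map e.inv, ?_⟩
  have h₄ : π₂ ≫ π₁ ≫ t = π₂ ≫ y ≫ Φ.map (e.inv ≫ SA.g) + c ≫ Φ.map (R.f ≫ eQ.hom) := by
    rw [Φ.map_comp R.f, ← reassoc_of% hc, ← Φ.map_comp]
    simp
  have h₅ : b ≫ Φ.map eB.inv ≫ Φ.map SB.f ≫ Φ.map e.inv ≫ Φ.map SA.g =
      π₃ ≫ c ≫ Φ.map (R.f ≫ eQ.hom) := by
    rw [h₃, ← Φ.map_comp_assoc eB.inv, eB.inv_hom_id, Φ.map_id, Category.id_comp, ← reassoc_of% hb,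
      ← Φ.map_comp, eC.hom_inv_id_assoc]
  simp only [Category.assoc, h₄, Preadditive.comp_add, Preadditive.add_comp, Functor.map_comp]
    at h₅ ⊢
  rw [h₅]

/-- The three consequences of the long exact sequence of right derived functors that concern
vanishing, for all short exact sequences and in one degree. Rotating the sequence with
`exists_rotation` and shifting along the injective middle terms lowers the degree. -/
lemma derivedVanish_longExact (n : ℕ) : ∀ {S : ShortComplex C}, S.ShortExact →
    (DerivedVanish Φ n S.X₁ → DerivedVanish Φ n S.X₃ → DerivedVanish Φ n S.X₂) ∧
    (DerivedVanish Φ n S.X₂ → DerivedVanish Φ (n + 1) S.X₁ → DerivedVanish Φ n S.X₃) ∧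
    (DerivedVanish Φ n S.X₃ → DerivedVanish Φ (n + 1) S.X₂ → DerivedVanish Φ (n + 1) S.X₁) := by
  induction n with
  | zero =>
    intro S hS
    simp only [derivedVanish_zero_iff]
    refine ⟨fun h₁ h₃ => ?_, fun h₂ h₁ => ?_, fun h₃ h₂ => ?_⟩
    · exact (exact_map hS).isZero_X₂ (h₁.eq_of_src _ _) (h₃.eq_of_tgt _ _)
    · have := h₁.epi_map hS
      exact IsZero.of_epi (Φ.map S.g) h₂
    · exact derivedVanish_one_of_epi hS h₂
        ⟨fun _ _ _ => h₃.eq_of_src _ _⟩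
  | succ n ih =>
    have h2 : ∀ {S : ShortComplex C}, S.ShortExact → DerivedVanish Φ (n + 1) S.X₁ →
        DerivedVanish Φ (n + 1) S.X₃ → DerivedVanish Φ (n + 1) S.X₂ := by
      intro S hS h₁ h₃
      obtain ⟨SA, SB, R, hA, hB, hR, _, _, eA, eB, e, eC, eQ, eQ', hg, -⟩ := exists_rotation hS
      cases n with
      | zero =>
        refine DerivedVanish.of_iso ((derivedVanish_one_iff_of_injective hB).2 ?_) eB
        have := (derivedVanish_one_iff_of_injective hA).1 (h₁.of_iso eA.symm)
        have := (h₃.of_iso eC.symm).epi_map hR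
        have : Epi (Φ.map e.hom ≫ Φ.map SB.g) := by
          rw [← Φ.map_comp, ← hg]
          simp only [Functor.map_comp]
          infer_instance
        exact epi_of_epi (Φ.map e.hom) _
      | succ n =>
        refine DerivedVanish.of_iso ((derivedVanish_shift_of_injective hB n).2 ?_) eB
        exact ((ih hR).2.1 (((derivedVanish_shift_of_injective hA n).1
          (h₁.of_iso eA.symm)).of_iso eQ.symm) (h₃.of_iso eC.symm)).of_iso eQ'
    intro S hS
    obtain ⟨SA, SB, R, hA, hB, hR, _, _, eA, eB, e, eC, eQ, eQ', hg, -⟩ := exists_rotation hS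
    refine ⟨h2 hS, fun h₂ h₁ => ?_, fun h₃ h₂ => ?_⟩
    · replace h₁ := ((derivedVanish_shift_of_injective hA n).1 (h₁.of_iso eA.symm)).of_iso eQ.symm
      replace h₂ := h₂.of_iso eB.symm
      cases n with
      | zero =>
        refine (derivedVanish_one_of_epi hR h₁ ?_).of_iso eC
        have := (derivedVanish_one_iff_of_injective hB).1 h₂
        have hg' : Φ.map SA.g ≫ Φ.map eQ.inv ≫ Φ.map R.g ≫ Φ.map eQ'.hom =
            Φ.map e.hom ≫ Φ.map SB.g := by
          simp only [← Φ.map_comp, hg]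
        have h' : Epi (Φ.map SA.g ≫ Φ.map eQ.inv ≫ Φ.map R.g ≫ Φ.map eQ'.hom) := by
          rw [hg']
          infer_instance
        have : Epi ((Φ.map SA.g ≫ Φ.map eQ.inv ≫ Φ.map R.g ≫ Φ.map eQ'.hom) ≫ Φ.map eQ'.inv) :=
          epi_comp _ _
        have : Epi ((Φ.map SA.g ≫ Φ.map eQ.inv) ≫ Φ.map R.g) := by
          simpa only [Category.assoc, ← Φ.map_comp, eQ'.hom_inv_id, Category.comp_id] using this
        exact epi_of_epi (Φ.map SA.g ≫ Φ.map eQ.inv) _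
      | succ n =>
        exact ((ih hR).2.2 (((derivedVanish_shift_of_injective hB n).1 h₂).of_iso eQ'.symm)
          h₁).of_iso eC
    · refine DerivedVanish.of_iso ((derivedVanish_shift_of_injective hA n).2 ?_) eA
      exact (h2 hR (h₃.of_iso eC.symm) (((derivedVanish_shift_of_injective hB n).1
        (h₂.of_iso eB.symm)).of_iso eQ'.symm)).of_iso eQ

lemma DerivedVanish.of_shortExact {n : ℕ} {S : ShortComplex C} (hS : S.ShortExact)
    (h₁ : DerivedVanish Φ n S.X₁) (h₃ : DerivedVanish Φ n S.X₃) : DerivedVanish Φ n S.X₂ :=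
  (derivedVanish_longExact n hS).1 h₁ h₃

lemma DerivedVanish.quotient {n : ℕ} {S : ShortComplex C} (hS : S.ShortExact)
    (h₂ : DerivedVanish Φ n S.X₂) (h₁ : DerivedVanish Φ (n + 1) S.X₁) : DerivedVanish Φ n S.X₃ :=
  (derivedVanish_longExact n hS).2.1 h₂ h₁

lemma DerivedVanish.subobject {n : ℕ} {S : ShortComplex C} (hS : S.ShortExact)
    (h₃ : DerivedVanish Φ n S.X₃) (h₂ : DerivedVanish Φ (n + 1) S.X₂) :
    DerivedVanish Φ (n + 1) S.X₁ :=
  (derivedVanish_longExact n hS).2.2 h₃ h₂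

/-- A class of objects that behaves like flasque sheaves consists of acyclic objects. -/
lemma DerivedVanish.of_acyclicClass (P : C → Prop) (hinj : ∀ A, Injective A → P A)
    (hepi : ∀ S : ShortComplex C, S.ShortExact → P S.X₁ → Epi (Φ.map S.g))
    (hquot : ∀ S : ShortComplex C, S.ShortExact → P S.X₁ → P S.X₂ → P S.X₃)
    (n : ℕ) : ∀ {A : C}, P A → DerivedVanish Φ (n + 1) A := by
  induction n with
  | zero =>
    intro A hA
    let S := ShortComplex.mk (Injective.ι A) (cokernel.π _) (cokernel.condition _)
    have hS : S.ShortExact := { exact := ShortComplex.exact_cokernel _ }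
    have : Injective S.X₂ := by dsimp [S]; infer_instance
    exact (derivedVanish_one_iff_of_injective hS).2 (hepi S hS hA)
  | succ n ih =>
    intro A hA
    let S := ShortComplex.mk (Injective.ι A) (cokernel.π _) (cokernel.condition _)
    have hS : S.ShortExact := { exact := ShortComplex.exact_cokernel _ }
    have : Injective S.X₂ := by dsimp [S]; infer_instance
    exact (derivedVanish_shift_of_injective hS n).2 (ih (hquot S hS hA (hinj _ this)))

/-- Right derived functors can be computed from a resolution by acyclic objects. -/
lemma SyzygyChain.derivedVanish_succ_iff_of_acyclic (n : ℕ) : ∀ (c : SyzygyChain C),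
    (∀ n i, DerivedVanish Φ (i + 1) (c.S n).X₂) →
    (DerivedVanish Φ (n + 1) (c.S 0).X₁ ↔ Epi (Φ.map (c.S n).g)) := by
  induction n with
  | zero =>
    intro c hc
    exact ⟨fun h => h.epi_map (c.shortExact 0),
      fun h => derivedVanish_one_of_epi (c.shortExact 0) (hc 0 0) h⟩
  | succ n ih =>
    intro c hc
    refine Iff.trans ?_ (ih c.tail fun n => hc (n + 1))
    refine ⟨fun h => ?_, fun h => ?_⟩
    · exact ((hc 0 n).quotient (c.shortExact 0) h).of_iso (c.e 0)
    · exact DerivedVanish.subobject (c.shortExact 0) (h.of_iso (c.e 0).symm) (hc 0 (n + 1))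

end Derived

/-! ### Torsion submodules and injective modules -/

section Torsion

variable {A : Type u} [CommRing A]

/-- The submodule of elements supported in the closed subset `V(I)`: those elements that are
annihilated by some power of each element of `I`. -/
def torsionSections (I : Ideal A) (N : Type*) [AddCommGroup N] [Module A N] : Submodule A N where
  carrier := {x | I ≤ (Ideal.torsionOf A N x).radical}
  zero_mem' a _ := ⟨1, by simp⟩
  add_mem' {x y} hx hy a ha := by
    obtain ⟨m, hm⟩ := hx ha
    obtain ⟨n, hn⟩ := hy ha
    refine ⟨m + n, ?_⟩
    simp only [Ideal.mem_torsionOf_iff] at *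
    rw [smul_add, pow_add, mul_comm, mul_smul, hm, mul_comm, mul_smul, hn]
    simp
  smul_mem' b x hx a ha := by
    obtain ⟨m, hm⟩ := hx ha
    refine ⟨m, ?_⟩
    simp only [Ideal.mem_torsionOf_iff] at *
    rw [smul_comm, hm, smul_zero]

section

variable {N N' : Type*} [AddCommGroup N] [Module A N] [AddCommGroup N'] [Module A N']
variable {I J : Ideal A}

lemma mem_torsionSections {x : N} :
    x ∈ torsionSections I N ↔ ∀ a ∈ I, ∃ n, a ^ n • x = 0 := Iff.rfl

lemma mem_torsionSections_span {s : Set A} {x : N} :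
    x ∈ torsionSections (Ideal.span s) N ↔ ∀ a ∈ s, ∃ n, a ^ n • x = 0 :=
  Ideal.span_le

lemma mem_torsionSections_sup {x : N} :
    x ∈ torsionSections (I ⊔ J) N ↔ x ∈ torsionSections I N ∧ x ∈ torsionSections J N :=
  sup_le_iff (a := I) (b := J) (c := (Ideal.torsionOf A N x).radical)

lemma mem_torsionSections_span_singleton {a : A} {x : N} :
    x ∈ torsionSections (Ideal.span {a}) N ↔ ∃ n, a ^ n • x = 0 := by
  simp [mem_torsionSections_span]

lemma torsionSections_anti (h : I ≤ J.radical) : torsionSections J N ≤ torsionSections I N := by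
  intro x hx a ha
  have : J.radical ≤ (Ideal.torsionOf A N x).radical := by
    rw [← Ideal.radical_idem (Ideal.torsionOf A N x)]
    exact Ideal.radical_mono hx
  exact this (h ha)

lemma map_mem_torsionSections (f : N →ₗ[A] N') {x : N} (hx : x ∈ torsionSections I N) :
    f x ∈ torsionSections I N' := fun a ha => by
  obtain ⟨n, hn⟩ := hx ha
  refine ⟨n, ?_⟩
  simp only [Ideal.mem_torsionOf_iff] at *
  rw [← map_smul, hn, map_zero]

lemma mem_torsionSections_of_map (f : N →ₗ[A] N') (hf : Function.Injective f) {x : N}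
    (hx : f x ∈ torsionSections I N') : x ∈ torsionSections I N := fun a ha => by
  obtain ⟨n, hn⟩ := hx ha
  refine ⟨n, (Ideal.mem_torsionOf_iff _ _).2 (hf ?_)⟩
  rw [map_smul, map_zero]
  exact hn

lemma exists_pow_le_torsionOf (hI : I.FG) {x : N} (hx : x ∈ torsionSections I N) :
    ∃ n, I ^ n ≤ Ideal.torsionOf A N x :=
  Ideal.exists_pow_le_of_le_radical_of_fg hx hI

/-- If `b K ^ r ⊆ J`, then some power of `b` moves the elements supported in
`V(J)` to elements supported in `V(K)`. -/
lemma exists_pow_smul_mem_torsionSections (hJ : J.FG) {K : Ideal A} {b : A} {r : ℕ}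
    (hb : ∀ a ∈ K ^ r, b * a ∈ J) {x : N} (hx : x ∈ torsionSections J N) :
    ∃ l, b ^ l • x ∈ torsionSections K N := by
  obtain ⟨n, hn⟩ := exists_pow_le_torsionOf hJ hx
  refine ⟨n, fun a ha => ⟨r * n, ?_⟩⟩
  have h : (b * a ^ r) ^ n ∈ J ^ n := Ideal.pow_mem_pow (hb _ (Ideal.pow_mem_pow ha r)) n
  have := hn h
  simp only [Ideal.mem_torsionOf_iff] at *
  rw [smul_smul, pow_mul, ← mul_pow, mul_comm, this]

end

variable [IsNoetherianRing A]

omit [IsNoetherianRing A] in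
lemma exists_extension_of_ker_le {E X Y : Type u} [AddCommGroup E] [Module A E] [AddCommGroup X]
    [Module A X] [AddCommGroup Y] [Module A Y] [Module.Injective A E] (q : X →ₗ[A] Y)
    (g : X →ₗ[A] E) (h : LinearMap.ker q ≤ LinearMap.ker g) :
    ∃ f : Y →ₗ[A] E, ∀ x, f (q x) = g x := by
  obtain ⟨f, hf⟩ := Module.Injective.out (Q := E)
    ((LinearMap.ker q).liftQ q le_rfl) (by
      rw [← LinearMap.ker_eq_bot, Submodule.ker_liftQ_eq_bot']
      rfl) ((LinearMap.ker q).liftQ g h)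
  exact ⟨f, fun x => hf (Submodule.Quotient.mk x)⟩

/-- A linear map from an ideal `J` to a module of elements supported in `V(I)` vanishes on
`J ∩ I ^ m` for large `m`: this is the Artin–Rees lemma. -/
lemma exists_pow_inf_le_ker (I J : Ideal A) {N : Type*} [AddCommGroup N] [Module A N]
    (g : J →ₗ[A] N) (hg : ∀ x, g x ∈ torsionSections I N) :
    ∃ m, ∀ x : J, (x : A) ∈ I ^ m → g x = 0 := by
  have hIfg : I.FG := IsNoetherian.noetherian I
  have hJfg : J.FG := IsNoetherian.noetherian J
  obtain ⟨n, hn⟩ : ∃ n, ∀ x : J, ∀ a ∈ I ^ n, a • g x = 0 := by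
    obtain ⟨s, hs⟩ := (Module.Finite.iff_fg.2 hJfg).fg_top
    choose m hm using fun x => exists_pow_le_torsionOf hIfg (hg x)
    refine ⟨s.sup m, fun x a ha => ?_⟩
    have hx : x ∈ Submodule.span A (s : Set J) := hs ▸ Submodule.mem_top
    induction hx using Submodule.span_induction with
    | mem y hy =>
      exact (Ideal.mem_torsionOf_iff _ _).1 (hm y (Ideal.pow_le_pow_right (Finset.le_sup hy) ha))
    | zero => rw [map_zero, smul_zero]
    | add y z _ _ hy hz => rw [map_add, smul_add, hy, hz, add_zero]
    | smul b y _ hy => rw [map_smul, smul_comm, hy, smul_zero]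
  obtain ⟨k, hk⟩ := Ideal.exists_pow_inf_eq_pow_smul (M := A) I J
  refine ⟨n + k, fun x hx => ?_⟩
  have hx2 : (x : A) ∈ I ^ n * J := by
    have h := hk (n + k) (by omega)
    rw [Nat.add_sub_cancel] at h
    have h3 : (x : A) ∈ I ^ (n + k) • (⊤ : Submodule A A) ⊓ J := ⟨by simpa using hx, x.2⟩
    rw [h] at h3
    exact Submodule.smul_mono le_rfl inf_le_right h3
  have h4 : ∀ y (_ : y ∈ I ^ n * J) (hy' : y ∈ J), g ⟨y, hy'⟩ = 0 := by
    intro y hy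
    induction hy using Submodule.mul_induction_on' with
    | mem_mul_mem a ha b hb =>
      intro hy'
      have : (⟨a * b, hy'⟩ : J) = a • ⟨b, hb⟩ := rfl
      rw [this, map_smul, hn _ _ ha]
    | add y hy z hz h1 h2 =>
      intro hy'
      have hyJ : y ∈ J := Ideal.mul_le_right (I := I ^ n) (J := J) hy
      have hzJ : z ∈ J := Ideal.mul_le_right (I := I ^ n) (J := J) hz
      exact (map_add g ⟨y, hyJ⟩ ⟨z, hzJ⟩).trans (by rw [h1 hyJ, h2 hzJ, add_zero])
  exact h4 x hx2 x.2

/-- Over a noetherian ring, the elements of an injective module that are supported in a closed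
subset form an injective module. -/
lemma injective_torsionSections (I : Ideal A) (E : Type u) [AddCommGroup E] [Module A E]
    [Module.Injective A E] : Module.Injective A (torsionSections I E) := by
  rw [← Module.Baer.iff_injective]
  intro J g
  obtain ⟨m, hm⟩ := exists_pow_inf_le_ker I J ((torsionSections I E).subtype ∘ₗ g)
    fun x => (g x).2
  let p : A →ₗ[A] A ⧸ I ^ m := (I ^ m).mkQ
  have hp : ∀ a, p a = 0 ↔ a ∈ I ^ m := fun a => Submodule.Quotient.mk_eq_zero (I ^ m)
  obtain ⟨h, hh⟩ := exists_extension_of_ker_le (p ∘ₗ J.subtype)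
    ((torsionSections I E).subtype ∘ₗ g) (fun x hx => hm x ((hp _).1 hx))
  refine ⟨LinearMap.codRestrict _ (h ∘ₗ p) fun c a ha => ⟨m, ?_⟩, fun x hx => ?_⟩
  · rw [Ideal.mem_torsionOf_iff, ← map_smul, LinearMap.comp_apply, smul_eq_mul,
      (hp _).2 (Ideal.mul_mem_right c _ (Ideal.pow_mem_pow ha m)), map_zero]
  · ext
    exact hh ⟨x, hx⟩

/-- Over a noetherian ring an injective module surjects onto its localizations. -/
lemma exists_pow_smul_eq (E : Type u) [AddCommGroup E] [Module A E] [Module.Injective A E]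
    (f : A) (n : ℕ) (e : E) : ∃ (y : E) (r : ℕ), f ^ (n + r) • y = f ^ r • e := by
  let K : ℕ →o Ideal A := ⟨fun r => Ideal.torsionOf A A (f ^ r), fun r s h a ha => by
    obtain ⟨t, rfl⟩ := Nat.exists_eq_add_of_le h
    simp only [Ideal.mem_torsionOf_iff, smul_eq_mul] at *
    rw [pow_add, ← _root_.mul_assoc, ha, zero_mul]⟩
  obtain ⟨r, hr⟩ := monotone_stabilizes_iff_noetherian.2 (inferInstanceAs (IsNoetherian A A)) K
  let q : A →ₗ[A] A := LinearMap.toSpanSingleton A A (f ^ (n + r))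
  have hq : LinearMap.ker q ≤ LinearMap.ker (LinearMap.toSpanSingleton A E (f ^ r • e)) := by
    intro a ha
    have h : a ∈ K (n + r) := ha
    rw [← hr (n + r) (by omega)] at h
    have h' : a * f ^ r = 0 := h
    simp only [LinearMap.mem_ker, LinearMap.toSpanSingleton_apply]
    rw [smul_smul, h', zero_smul]
  obtain ⟨h, hh⟩ := exists_extension_of_ker_le q _ hq
  refine ⟨h 1, r, ?_⟩
  have := hh 1
  simp only [q, LinearMap.toSpanSingleton_apply, one_smul] at this
  rw [← this, ← map_smul, smul_eq_mul, _root_.mul_one]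

lemma exists_pow_smul_eq_torsionSections (I : Ideal A) (E : Type u) [AddCommGroup E] [Module A E]
    [Module.Injective A E] (f : A) (n : ℕ) {e : E} (he : e ∈ torsionSections I E) :
    ∃ y ∈ torsionSections I E, ∃ r : ℕ, f ^ (n + r) • y = f ^ r • e := by
  have := injective_torsionSections I E
  obtain ⟨y, r, h⟩ := exists_pow_smul_eq (torsionSections I E) f n ⟨e, he⟩
  exact ⟨y, y.2, r, congrArg Subtype.val h⟩

end Torsion

/-! ### Local cohomology of modules -/

/-- An injective resolution of the module `N 0`, cut into short exact sequences
`0 ⟶ N n ⟶ E n ⟶ N (n + 1) ⟶ 0`. -/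
structure ModuleChain (A : Type u) [CommRing A] where
  /-- The syzygies. -/
  N : ℕ → ModuleCat.{u} A
  /-- The injective modules. -/
  E : ℕ → ModuleCat.{u} A
  /-- The embedding of a syzygy. -/
  inc (n : ℕ) : N n →ₗ[A] E n
  /-- The projection to the next syzygy. -/
  proj (n : ℕ) : E n →ₗ[A] N (n + 1)
  inc_injective (n : ℕ) : Function.Injective (inc n)
  proj_surjective (n : ℕ) : Function.Surjective (proj n)
  exact (n : ℕ) : Function.Exact (inc n) (proj n)
  injective (n : ℕ) : Module.Injective A (E n)

namespace ModuleChain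

variable {A : Type u} [CommRing A] (c : ModuleChain A)

lemma proj_inc (n : ℕ) (x : c.N n) : c.proj n (c.inc n x) = 0 := (c.exact n).apply_apply_eq_zero x

/-- The elements of the `n`-th syzygy whose class in the `n`-th local cohomology module is zero. -/
def IsBoundary (I : Ideal A) : ∀ n, c.N n → Prop
  | 0, x => x = 0
  | n + 1, x => ∃ y ∈ torsionSections I (c.E n), c.proj n y = x

/-- The vanishing of the `n`-th local cohomology module `H^n_I(N 0)`. -/
def Vanish (I : Ideal A) (n : ℕ) : Prop :=
  ∀ x ∈ torsionSections I (c.N n), c.IsBoundary I n x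

variable {c}

lemma isBoundary_zero (I : Ideal A) (n : ℕ) : c.IsBoundary I n 0 := by
  cases n
  · rfl
  · exact ⟨0, zero_mem _, map_zero _⟩

lemma Vanish.of_radical_eq {I J : Ideal A} (h : I.radical = J.radical) {n : ℕ}
    (hI : c.Vanish I n) : c.Vanish J n := by
  have h1 : I ≤ J.radical := h ▸ Ideal.le_radical
  have h2 : J ≤ I.radical := h ▸ Ideal.le_radical
  intro x hx
  have := hI x (torsionSections_anti h1 hx)
  cases n
  · exact this
  · obtain ⟨y, hy, rfl⟩ := this
    exact ⟨y, torsionSections_anti h2 hy, rfl⟩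

variable [IsNoetherianRing A]

/-- Passing from `V(I)` to its intersection with a hypersurface `V(f)`. -/
lemma Vanish.sup_span_singleton {I : Ideal A} {n : ℕ} (h : c.Vanish I n)
    (h' : c.Vanish I (n + 1)) (f : A) : c.Vanish (I ⊔ Ideal.span {f}) (n + 1) := by
  intro x hx
  rw [mem_torsionSections_sup, mem_torsionSections_span_singleton] at hx
  obtain ⟨hx, k, hk⟩ := hx
  obtain ⟨y, hy, rfl⟩ := h' x hx
  obtain ⟨z, hz⟩ := (c.exact n (f ^ k • y)).1 (by rw [map_smul, hk])
  have hzI : z ∈ torsionSections I (c.N n) := by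
    refine mem_torsionSections_of_map (c.inc n) (c.inc_injective n) ?_
    rw [hz]
    exact Submodule.smul_mem _ _ hy
  have hzb := h z hzI
  cases n with
  | zero =>
    have hz0 : z = 0 := hzb
    refine ⟨y, ?_, rfl⟩
    rw [mem_torsionSections_sup, mem_torsionSections_span_singleton]
    exact ⟨hy, k, by rw [← hz, hz0, map_zero]⟩
  | succ n =>
    obtain ⟨z', hz', rfl⟩ := hzb
    have := c.injective n
    obtain ⟨w, hw, r, hr⟩ := exists_pow_smul_eq_torsionSections I (c.E n) f k hz'
    refine ⟨y - c.inc (n + 1) (c.proj n w), ?_, by rw [map_sub, c.proj_inc, sub_zero]⟩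
    rw [mem_torsionSections_sup, mem_torsionSections_span_singleton]
    refine ⟨sub_mem hy (map_mem_torsionSections _ (map_mem_torsionSections _ hw)), k + r, ?_⟩
    rw [smul_sub, ← map_smul, ← map_smul, hr, add_comm k r, pow_add, mul_smul, ← hz, map_smul,
      map_smul, sub_self]

/-- Intersecting with `e` hypersurfaces moves the vanishing range by at most `e`. -/
lemma Vanish.sup_span_finset {I : Ideal A} {m : ℕ} (h : ∀ n ≥ m, c.Vanish I n) (s : Finset A) :
    ∀ n ≥ m + s.card, c.Vanish (I ⊔ Ideal.span s) n := by
  classical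
  induction s using Finset.induction_on with
  | empty => simpa using h
  | insert a s ha ih =>
    intro n hn
    rw [Finset.card_insert_of_notMem ha] at hn
    obtain ⟨n, rfl⟩ : ∃ n', n = n' + 1 := ⟨n - 1, by omega⟩
    have := (ih n (by omega)).sup_span_singleton (ih (n + 1) (by omega)) a
    rwa [sup_assoc, ← Ideal.span_union, Set.union_comm, ← Set.insert_eq,
      ← Finset.coe_insert] at this

end ModuleChain

namespace ModuleChain

/-! ### Top local cohomology classes as fractions -/

section Fractions

variable {A : Type u} [CommRing A] (c : ModuleChain A) (f : ℕ → A)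

/-- The ideal generated by the first `j` terms of a sequence. -/
def initialIdeal (j : ℕ) : Ideal A := Ideal.span (f '' Set.Iio j)

lemma mem_torsionSections_initialIdeal {N : Type*} [AddCommGroup N] [Module A N] {j : ℕ} {x : N} :
    x ∈ torsionSections (initialIdeal f j) N ↔ ∀ i < j, ∃ n, f i ^ n • x = 0 := by
  simp [initialIdeal, mem_torsionSections_span]

lemma mem_torsionSections_initialIdeal_succ {N : Type*} [AddCommGroup N] [Module A N] {j : ℕ}
    {x : N} : x ∈ torsionSections (initialIdeal f (j + 1)) N ↔
      x ∈ torsionSections (initialIdeal f j) N ∧ ∃ n, f j ^ n • x = 0 := by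
  simp only [mem_torsionSections_initialIdeal, Nat.lt_succ_iff_lt_or_eq]
  constructor
  · exact fun h => ⟨fun i hi => h i (Or.inl hi), h j (Or.inr rfl)⟩
  · rintro ⟨h, h'⟩ i (hi | rfl)
    exacts [h i hi, h']

/-- `c.Represents f M j v x` means that the class of `x ∈ N j` in the local cohomology module
`H^j` with supports in `V(f 0, …, f (j - 1))` is the class of the fraction
`v / (f 0 ⋯ f (j - 1)) ^ M`, where `v ∈ N 0`. In the inductive step, `y` is the quotient of `x'`
by `(f j) ^ M` in the localization of `E j`. -/
def Represents (M : ℕ) : ∀ j, c.N 0 → c.N j → Prop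
  | 0, v, x => x = v
  | j + 1, v, x => ∃ x', Represents M j v x' ∧ ∃ y ∈ torsionSections (initialIdeal f j) (c.E j),
      (∃ r, f j ^ (M + r) • y = f j ^ r • c.inc j x') ∧ c.proj j y = x

variable {c f}

lemma Represents.mem_torsionSections {M : ℕ} : ∀ {j : ℕ} {v : c.N 0} {x : c.N j},
    c.Represents f M j v x → x ∈ torsionSections (initialIdeal f j) (c.N j)
  | 0, _, _, _ => (mem_torsionSections_initialIdeal f).2 fun i hi => absurd hi (by omega)
  | j + 1, v, x, h => by
    obtain ⟨x', -, y, hy, ⟨r, hr⟩, rfl⟩ := h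
    refine (mem_torsionSections_initialIdeal_succ f).2 ⟨map_mem_torsionSections _ hy, M + r, ?_⟩
    rw [← map_smul, hr, map_smul, c.proj_inc, smul_zero]

lemma Represents.smul (a : A) {M : ℕ} : ∀ {j : ℕ} {v : c.N 0} {x : c.N j},
    c.Represents f M j v x → c.Represents f M j (a • v) (a • x)
  | 0, _, _, h => congrArg (a • ·) h
  | j + 1, v, x, h => by
    obtain ⟨x', hx', y, hy, ⟨r, hr⟩, rfl⟩ := h
    refine ⟨a • x', hx'.smul a, a • y, Submodule.smul_mem _ _ hy, ⟨r, ?_⟩, map_smul _ _ _⟩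
    rw [smul_comm, hr, map_smul, smul_comm]

lemma Represents.sub {M : ℕ} : ∀ {j : ℕ} {v₁ v₂ : c.N 0} {x₁ x₂ : c.N j},
    c.Represents f M j v₁ x₁ → c.Represents f M j v₂ x₂ →
      c.Represents f M j (v₁ - v₂) (x₁ - x₂)
  | 0, _, _, _, _, h₁, h₂ => congrArg₂ (· - ·) h₁ h₂
  | j + 1, v₁, v₂, x₁, x₂, h₁, h₂ => by
    obtain ⟨x₁', hx₁', y₁, hy₁, ⟨r₁, hr₁⟩, rfl⟩ := h₁
    obtain ⟨x₂', hx₂', y₂, hy₂, ⟨r₂, hr₂⟩, rfl⟩ := h₂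
    refine ⟨x₁' - x₂', hx₁'.sub hx₂', y₁ - y₂, sub_mem hy₁ hy₂, ⟨r₁ + r₂, ?_⟩, map_sub _ _ _⟩
    have e₁ : f j ^ (M + (r₁ + r₂)) = f j ^ r₂ * f j ^ (M + r₁) := by ring
    have e₂ : f j ^ (M + (r₁ + r₂)) = f j ^ r₁ * f j ^ (M + r₂) := by ring
    rw [smul_sub, e₁, mul_smul, hr₁, ← e₁, e₂, mul_smul, hr₂, smul_smul, smul_smul, ← pow_add,
      ← pow_add, map_sub, smul_sub, add_comm r₂ r₁]

/-- Enlarging the exponent of the denominator. -/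
lemma Represents.expand (s : ℕ) {M : ℕ} : ∀ {j : ℕ} {v : c.N 0} {x : c.N j},
    c.Represents f M j v x →
      c.Represents f (M + s) j ((∏ i ∈ Finset.range j, f i) ^ s • v) x
  | 0, v, x, h => by
    have h' : x = v := h
    simp [Represents, h']
  | j + 1, v, x, h => by
    obtain ⟨x', hx', y, hy, ⟨r, hr⟩, rfl⟩ := h
    refine ⟨f j ^ s • x', ?_, y, hy, ⟨r, ?_⟩, rfl⟩
    · have := (hx'.expand s).smul (f j ^ s)
      rwa [smul_smul, mul_comm (f j ^ s), ← mul_pow, ← Finset.prod_range_succ] at this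
    · rw [show M + s + r = s + (M + r) by ring, pow_add, mul_smul, hr, map_smul, smul_comm]

variable [IsNoetherianRing A]

lemma exists_represents (M : ℕ) (v : c.N 0) : ∀ j, ∃ x, c.Represents f M j v x
  | 0 => ⟨v, rfl⟩
  | j + 1 => by
    obtain ⟨x', hx'⟩ := exists_represents M v j
    have := c.injective j
    obtain ⟨y, hy, r, hr⟩ := exists_pow_smul_eq_torsionSections (initialIdeal f j) (c.E j) (f j) M
      (map_mem_torsionSections (c.inc j) hx'.mem_torsionSections)
    exact ⟨_, x', hx', y, hy, ⟨r, hr⟩, rfl⟩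

/-- There is no local cohomology above the number of equations. -/
lemma vanish_initialIdeal (j : ℕ) : ∀ n > j, c.Vanish (initialIdeal f j) n := by
  induction j with
  | zero =>
    intro n hn x _
    obtain ⟨n, rfl⟩ : ∃ n', n = n' + 1 := ⟨n - 1, by omega⟩
    obtain ⟨y, rfl⟩ := c.proj_surjective n x
    exact ⟨y, (mem_torsionSections_initialIdeal f).2 fun i hi => absurd hi (by omega), rfl⟩
  | succ j ih =>
    intro n hn
    obtain ⟨n, rfl⟩ : ∃ n', n = n' + 1 := ⟨n - 1, by omega⟩
    have h := (ih n (by omega)).sup_span_singleton (ih (n + 1) (by omega)) (f j)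
    have e : initialIdeal f j ⊔ Ideal.span {f j} = initialIdeal f (j + 1) := by
      rw [initialIdeal, initialIdeal, ← Ideal.span_union]
      congr 1
      ext a
      simp only [Set.mem_union, Set.mem_image, Set.mem_Iio, Set.mem_singleton_iff,
        Nat.lt_succ_iff_lt_or_eq, or_and_right, exists_or, exists_eq_left, eq_comm (a := a)]
    rwa [e] at h

/-- Every top local cohomology class is the class of a fraction. -/
lemma exists_represents_of_mem : ∀ {j : ℕ} {x : c.N j},
    x ∈ torsionSections (initialIdeal f j) (c.N j) → ∃ M v, c.Represents f M j v x
  | 0, x, _ => ⟨0, x, rfl⟩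
  | j + 1, x, hx => by
    rw [mem_torsionSections_initialIdeal_succ] at hx
    obtain ⟨hx, K, hK⟩ := hx
    obtain ⟨y, hy, rfl⟩ := vanish_initialIdeal (c := c) (f := f) j (j + 1) (by omega) x hx
    obtain ⟨z, hz⟩ := (c.exact j (f j ^ K • y)).1 (by rw [map_smul, hK])
    have hzI : z ∈ torsionSections (initialIdeal f j) (c.N j) := by
      refine mem_torsionSections_of_map (c.inc j) (c.inc_injective j) ?_
      rw [hz]
      exact Submodule.smul_mem _ _ hy
    obtain ⟨M, v, hv⟩ := exists_represents_of_mem hzI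
    refine ⟨M + K, _, f j ^ M • z, (hv.expand K).smul (f j ^ M), y, hy, ⟨0, ?_⟩, rfl⟩
    rw [add_zero, pow_add, mul_smul, ← hz, pow_zero, one_smul, map_smul]

/-- If the class of the fraction `v / (f 0 ⋯ f (j - 1)) ^ M` is zero, then a multiple of `v` by a
power of `f 0 ⋯ f (j - 1)` lies in the expected submodule. -/
lemma Represents.exists_mem_of_isBoundary {M : ℕ} : ∀ {j : ℕ} {v : c.N 0} {x : c.N j},
    c.Represents f M j v x → c.IsBoundary (initialIdeal f j) j x →
      ∃ s, (∏ i ∈ Finset.range j, f i) ^ s • v ∈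
        Ideal.span ((fun i => f i ^ (s + M)) '' Set.Iio j) • (⊤ : Submodule A (c.N 0))
  | 0, v, x, h, h' => ⟨0, by
      have h₁ : x = v := h
      have h₂ : x = 0 := h'
      rw [← h₁, h₂, smul_zero]
      exact zero_mem _⟩
  | j + 1, v, x, h, h' => by
    obtain ⟨x', hx', y, hy, ⟨r, hr⟩, rfl⟩ := h
    obtain ⟨y₁, hy₁, hyy⟩ := h'
    rw [mem_torsionSections_initialIdeal_succ] at hy₁
    obtain ⟨hy₁, q, hq⟩ := hy₁
    obtain ⟨z, hz⟩ := (c.exact j (y - y₁)).1 (by rw [map_sub, hyy, sub_self])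
    have hzI : z ∈ torsionSections (initialIdeal f j) (c.N j) := by
      refine mem_torsionSections_of_map (c.inc j) (c.inc_injective j) ?_
      rw [hz]
      exact sub_mem hy hy₁
    obtain ⟨M', v', hv'⟩ := exists_represents_of_mem hzI
    have h0 : f j ^ (r + q) • (x' - f j ^ M • z) = 0 := by
      apply c.inc_injective j
      rw [map_smul, map_sub, map_smul, hz, map_zero, smul_sub, smul_smul, ← pow_add, smul_sub,
        show r + q + M = (M + r) + q by ring, pow_add _ (M + r) q,
        mul_smul (f j ^ (M + r)) (f j ^ q) y₁,
        hq, smul_zero, sub_zero, mul_comm, mul_smul, hr, add_comm r q, pow_add, mul_smul, sub_self]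
    set F := ∏ i ∈ Finset.range j, f i with hF
    have hrep := ((hx'.expand M').sub
      (add_comm M' M ▸ (hv'.expand M).smul (f j ^ M))).smul (f j ^ (r + q))
    obtain ⟨s, hs⟩ := hrep.exists_mem_of_isBoundary (by rw [h0]; exact isBoundary_zero _ _)
    rw [← hF] at hs
    refine ⟨s + M' + (r + q), ?_⟩
    rw [Finset.prod_range_succ, ← hF]
    set T := Ideal.span ((fun i => f i ^ (s + M' + (r + q) + M)) '' Set.Iio (j + 1)) •
      (⊤ : Submodule A (c.N 0)) with hT
    have hmem : ∀ i ≤ j, ∀ (a b : A) (w : c.N 0), a = f i ^ (s + M' + (r + q) + M) * b →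
        a • w ∈ T := by
      rintro i hi a b w rfl
      refine Submodule.smul_mem_smul (Ideal.mul_mem_right _ _ (Ideal.subset_span ?_)) trivial
      exact ⟨i, Nat.lt_succ_of_le hi, rfl⟩
    have h₁ : (F ^ (r + q) * f j ^ (s + M')) • F ^ s • f j ^ (r + q) •
        (F ^ M' • v - f j ^ M • F ^ M • v') ∈ T := by
      have h2 : ∀ w ∈ Ideal.span ((fun i => f i ^ (s + (M + M'))) '' Set.Iio j) •
          (⊤ : Submodule A (c.N 0)), (F ^ (r + q) * f j ^ (s + M')) • w ∈ T := by
        intro w hw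
        refine Submodule.smul_induction_on hw (fun a ha w _ => ?_) fun w w' hw hw' => by
          rw [smul_add]; exact add_mem hw hw'
        induction ha using Submodule.span_induction with
        | mem a ha =>
          obtain ⟨i, hi, rfl⟩ := ha
          obtain ⟨b, hb⟩ : f i ∣ F := Finset.dvd_prod_of_mem f (Finset.mem_range.2 hi)
          rw [smul_smul]
          refine hmem i (le_of_lt hi) _ (b ^ (r + q) * f j ^ (s + M')) w ?_
          rw [hb]
          ring
        | zero => rw [zero_smul, smul_zero]; exact zero_mem _
        | add a b _ _ ha hb => rw [add_smul, smul_add]; exact add_mem ha hb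
        | smul b a _ ha => rw [smul_assoc, smul_comm]; exact Submodule.smul_mem _ _ ha
      exact h2 _ hs
    have h₃ : (F * f j) ^ (s + M' + (r + q)) • v =
        (F ^ (r + q) * f j ^ (s + M')) • F ^ s • f j ^ (r + q) •
          (F ^ M' • v - f j ^ M • F ^ M • v') +
        (F ^ (r + q + s + M) * f j ^ (s + M' + (r + q) + M)) • v' := by
      module
    rw [h₃]
    exact add_mem h₁ (hmem j le_rfl _ (F ^ (r + q + s + M)) v' (mul_comm _ _))

end Fractions

/-! ### Resolutions by torsion modules -/

section

variable {A : Type u} [CommRing A] [IsNoetherianRing A]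

/-- Over a noetherian ring, a module all of whose elements are supported in `V(I)` has a
resolution by injective modules of the same kind. -/
lemma exists_torsion (I : Ideal A) (N : ModuleCat.{u} A) (hN : ∀ x : N, x ∈ torsionSections I N) :
    ∃ c : ModuleChain A, c.N 0 = N ∧ ∀ n (x : c.E n), x ∈ torsionSections I (c.E n) := by
  let T : Type _ := {N : ModuleCat.{u} A // ∀ x : N, x ∈ torsionSections I N}
  let U : T → ModuleCat.{u} A := fun N => Injective.under N.1
  let k : ∀ N : T, N.1 →ₗ[A] U N := fun N => (Injective.ι N.1).hom
  have hk : ∀ N, Function.Injective (k N) := fun N =>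
    (ModuleCat.mono_iff_injective (Injective.ι N.1)).1 inferInstance
  let E : T → ModuleCat.{u} A := fun N => ModuleCat.of A (torsionSections I (U N))
  let i : ∀ N : T, N.1 →ₗ[A] E N := fun N => LinearMap.codRestrict _ (k N)
    fun x => map_mem_torsionSections _ (N.2 x)
  have hi : ∀ N, Function.Injective (i N) := fun N x y h => hk N (congrArg Subtype.val h)
  have hE : ∀ N (x : E N), x ∈ torsionSections I (E N) := fun N x =>
    mem_torsionSections_of_map (Submodule.subtype _) Subtype.val_injective x.2
  have hinj : ∀ N, Module.Injective A (E N) := fun N => by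
    have : Injective (U N) := inferInstanceAs (Injective (Injective.under N.1))
    have : Module.Injective A (U N) :=
      Module.injective_module_of_injective_object A _
    exact injective_torsionSections I _
  let next : T → T := fun N => ⟨ModuleCat.of A (E N ⧸ LinearMap.range (i N)), fun x => by
    obtain ⟨y, rfl⟩ := Submodule.mkQ_surjective _ x
    exact map_mem_torsionSections _ (hE N y)⟩
  let Q : ℕ → T := fun n => next^[n] ⟨N, hN⟩
  have hQ : ∀ n, Q (n + 1) = next (Q n) := fun n => Function.iterate_succ_apply' next n _
  have hp : ∀ n, ∃ p : E (Q n) →ₗ[A] (Q (n + 1)).1, Function.Surjective p ∧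
      Function.Exact (i (Q n)) p := by
    intro n
    rw [hQ]
    exact ⟨Submodule.mkQ _, Submodule.mkQ_surjective _, LinearMap.exact_map_mkQ_range _⟩
  choose p hp₁ hp₂ using hp
  exact ⟨⟨fun n => (Q n).1, fun n => E (Q n), fun n => i (Q n), p, fun n => hi _, hp₁, hp₂,
    fun n => hinj _⟩, rfl, fun n => hE (Q n)⟩

/-- If `N 0` is supported in `V(P)`, its local cohomology with supports in the zero set of `m`
equations in `V(P)` vanishes above degree `m`. -/
lemma vanish_sup_span_of_torsion {c : ModuleChain A} {P : Ideal A}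
    (hc : ∀ n (x : c.E n), x ∈ torsionSections P (c.E n)) (s : Finset A) (n : ℕ) (hn : s.card < n) :
    c.Vanish (P ⊔ Ideal.span s) n := by
  refine Vanish.sup_span_finset (m := 1) (fun n hn x _ => ?_) s n (by omega)
  obtain ⟨n, rfl⟩ : ∃ n', n = n' + 1 := ⟨n - 1, by omega⟩
  obtain ⟨y, rfl⟩ := c.proj_surjective n x
  exact ⟨y, hc n y, rfl⟩

end

end ModuleChain

/-! ### Fractions over a Noether normalization -/

section Monomial

/-- A finite module over a noetherian domain is, up to multiplication by a fixed non-zero `h`, a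
finite free module. -/
lemma exists_linearMap_sum_smul_eq (S : Type u) [CommRing S] [IsDomain S] (B : Type u)
    [AddCommGroup B] [Module S B] [Module.Finite S B] :
    ∃ (κ : Type u) (_ : Fintype κ) (θ : κ → B →ₗ[S] S) (e : κ → B) (h : S), h ≠ 0 ∧
      ∀ x, ∑ i, θ i x • e i = h • x := by
  obtain ⟨s, hs, hli⟩ := exists_set_linearIndependent S B
  have : Fintype s := hli.setFinite.fintype
  let F := Submodule.span S (Set.range (Subtype.val : s → B))
  let b : Module.Basis s S F := Module.Basis.span hli
  have hF : Module.rank S F = Module.rank S B := by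
    rw [← hs, rank_eq_card_basis b, Cardinal.mk_fintype]
  have hrank : Module.rank S (B ⧸ F) = 0 := by
    have h1 := F.rank_quotient_add_rank
    have h2 : Module.rank S B < Cardinal.aleph0 := Module.rank_lt_aleph0 S B
    rw [hF] at h1
    exact (Cardinal.add_right_inj_of_lt_aleph0 h2).1
      (h1.trans (zero_add _).symm)
  have htors : Module.IsTorsion S (B ⧸ F) := fun x => by
    obtain ⟨a, ha, hax⟩ := rank_eq_zero_iff.1 hrank x
    exact ⟨⟨a, mem_nonZeroDivisors_of_ne_zero ha⟩, hax⟩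
  obtain ⟨h, hann, hh⟩ := Submodule.annihilator_top_inter_nonZeroDivisors htors
  have hmem : ∀ x : B, h • x ∈ F := fun x => by
    rw [← Submodule.Quotient.mk_eq_zero, Submodule.Quotient.mk_smul]
    exact (Submodule.mem_annihilator.1 hann) _ trivial
  let q : B →ₗ[S] F := LinearMap.codRestrict F (h • LinearMap.id) hmem
  refine ⟨s, inferInstance, fun i => b.coord i ∘ₗ q, fun i => i, h, nonZeroDivisors.ne_zero hh,
    fun x => ?_⟩
  have h1 := congrArg Subtype.val (b.sum_repr (q x))
  rw [AddSubmonoidClass.coe_finsetSum] at h1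
  refine Eq.trans (Finset.sum_congr rfl fun i _ => ?_) h1
  rw [Submodule.coe_smul, Module.Basis.span_apply]
  rfl

open MvPolynomial in
/-- In a polynomial ring, `(t₁ ⋯ t_D)^s` can be cancelled in memberships in the ideals generated by
powers of the variables. -/
lemma mem_span_pow_of_prod_pow_mul_mem {k : Type u} [Field k] {D : ℕ} (s M : ℕ)
    (f : MvPolynomial (Fin D) k)
    (hf : (∏ i, X i) ^ s * f ∈ Ideal.span (Set.range fun i : Fin D =>
      (X i ^ (s + M) : MvPolynomial (Fin D) k))) :
    f ∈ Ideal.span (Set.range fun i : Fin D => (X i ^ M : MvPolynomial (Fin D) k)) := by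
  have key : ∀ N : ℕ, (Set.range fun i : Fin D => (X i ^ N : MvPolynomial (Fin D) k)) =
      (fun s => monomial s (1 : k)) '' Set.range fun i => Finsupp.single i N := by
    intro N
    rw [← Set.range_comp]
    congr 1
    ext1 i
    exact X_pow_eq_monomial
  rw [key, mem_ideal_span_monomial_image] at hf ⊢
  intro m hm
  have hprod : ((∏ i, X i) ^ s : MvPolynomial (Fin D) k) =
      monomial (∑ i, Finsupp.single i s) 1 := by
    rw [← Finset.prod_pow, monomial_sum_one]
    exact Finset.prod_congr rfl fun i _ => X_pow_eq_monomial
  obtain ⟨_, ⟨i, rfl⟩, hi⟩ := hf ((∑ i, Finsupp.single i s) + m) (by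
    rw [hprod, mem_support_iff, coeff_monomial_mul, _root_.one_mul]
    exact mem_support_iff.1 hm)
  refine ⟨_, ⟨i, rfl⟩, ?_⟩
  have h1 := hi i
  rw [Finsupp.single_le_iff]
  simp only [Finsupp.single_eq_same, Finsupp.add_apply, Finsupp.finsetSum_apply] at h1
  rw [Finset.sum_eq_single i (fun j _ hj => Finsupp.single_eq_of_ne hj.symm) (by simp),
    Finsupp.single_eq_same] at h1
  omega

open MvPolynomial in
/-- In a domain that is finite over a polynomial ring, at a prime containing the variables, the
fractions `g / (t₁ ⋯ t_D)^M` with `g ≠ 0` fixed cannot all be zero in top local cohomology. -/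
lemma not_forall_exists_mul_mem_span_pow {k : Type u} [Field k] {D : ℕ} (B : Type u) [CommRing B]
    [IsDomain B] [Algebra (MvPolynomial (Fin D) k) B] [Module.Finite (MvPolynomial (Fin D) k) B]
    (hinj : Function.Injective (algebraMap (MvPolynomial (Fin D) k) B)) (w : Ideal B) [w.IsPrime]
    (hw : ∀ i, algebraMap (MvPolynomial (Fin D) k) B (X i) ∈ w) (g : MvPolynomial (Fin D) k)
    (hg : g ≠ 0)
    (h : ∀ M, ∃ s, ∃ b ∉ w, b * algebraMap (MvPolynomial (Fin D) k) B ((∏ i, X i) ^ s * g) ∈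
      Ideal.span (Set.range fun i => algebraMap (MvPolynomial (Fin D) k) B (X i) ^ (s + M))) :
    False := by
  have : IsNoetherianRing B := IsNoetherianRing.of_finite (MvPolynomial (Fin D) k) B
  obtain ⟨κ, _, θ, e, r, hr, hθ⟩ := exists_linearMap_sum_smul_eq (MvPolynomial (Fin D) k) B
  have hmem : ∀ M, ∃ b ∉ w, b * algebraMap (MvPolynomial (Fin D) k) B (r * g) ∈ w ^ M := by
    intro M
    obtain ⟨s, b, hb, hs⟩ := h M
    refine ⟨b, hb, ?_⟩
    -- The functionals `θ i` reduce the cancellation of the monomial to the polynomial ring.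
    have h1 : ∀ i, θ i (b * algebraMap (MvPolynomial (Fin D) k) B g) ∈
        Ideal.span (Set.range fun i : Fin D => (X i ^ M : MvPolynomial (Fin D) k)) := by
      intro i
      apply mem_span_pow_of_prod_pow_mul_mem s M
      rw [← smul_eq_mul, ← map_smul, Algebra.smul_def, ← mul_left_comm, ← map_mul]
      generalize b * algebraMap (MvPolynomial (Fin D) k) B ((∏ i, X i) ^ s * g) = x at hs
      induction hs using Submodule.span_induction with
      | mem x hx =>
        obtain ⟨j, rfl⟩ := hx
        dsimp only
        rw [← map_pow, ← _root_.mul_one (algebraMap _ B _), ← Algebra.smul_def, map_smul]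
        exact Ideal.mul_mem_right _ _ (Ideal.subset_span ⟨j, rfl⟩)
      | zero => rw [map_zero]; exact zero_mem _
      | add x y _ _ hx hy => rw [map_add]; exact add_mem hx hy
      | smul a x hx _ =>
        obtain ⟨c, rfl⟩ := (Ideal.mem_span_range_iff_exists_fun).1 hx
        rw [smul_eq_mul, Finset.mul_sum, map_sum]
        refine sum_mem fun j _ => ?_
        rw [← _root_.mul_assoc, mul_comm, ← map_pow, ← Algebra.smul_def, map_smul]
        exact Ideal.mul_mem_right _ _ (Ideal.subset_span ⟨j, rfl⟩)
    rw [map_mul, mul_left_comm, ← Algebra.smul_def, ← hθ]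
    refine sum_mem fun i _ => ?_
    rw [Algebra.smul_def]
    refine Ideal.mul_mem_right _ _ ?_
    have h2 := Ideal.mem_map_of_mem (algebraMap (MvPolynomial (Fin D) k) B) (h1 i)
    refine (Ideal.map_le_iff_le_comap.2 (Ideal.span_le.2 ?_)) h2
    rintro _ ⟨j, rfl⟩
    simpa using Ideal.pow_mem_pow (hw j) M
  -- Krull's intersection theorem in the localization at `w`.
  have hne : algebraMap (MvPolynomial (Fin D) k) B (r * g) ≠ 0 := by
    rw [Ne, map_eq_zero_iff _ hinj]
    exact mul_ne_zero hr hg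
  generalize algebraMap (MvPolynomial (Fin D) k) B (r * g) = x at hmem hne
  let L := Localization.AtPrime w
  have hL : algebraMap B L x ∈ (⨅ i : ℕ, IsLocalRing.maximalIdeal L ^ i) := by
    rw [Submodule.mem_iInf]
    intro M
    obtain ⟨b, hb, hbx⟩ := hmem M
    have h1 := Ideal.mem_map_of_mem (algebraMap B L) hbx
    rw [Ideal.map_pow, Localization.AtPrime.map_eq_maximalIdeal, map_mul] at h1
    have hu : IsUnit (algebraMap B L b) := IsLocalization.map_units L (⟨b, hb⟩ : w.primeCompl)
    exact (Ideal.unit_mul_mem_iff_mem _ hu).1 h1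
  rw [Ideal.iInf_pow_eq_bot_of_isLocalRing _ (IsLocalRing.maximalIdeal.isMaximal L).ne_top] at hL
  exact hne ((map_eq_zero_iff _ (IsLocalization.injective L w.primeCompl_le_nonZeroDivisors)).1 hL)

end Monomial

/-! ### Dimension and transcendence degree -/

section Dimension

variable (k : Type u) [Field k] (B : Type u) [CommRing B] [IsDomain B] [Algebra k B]

lemma trdeg_eq_of_finite_injective {s : ℕ} (g : MvPolynomial (Fin s) k →ₐ[k] B)
    (hg : Function.Injective g) (hfin : g.Finite) : Algebra.trdeg k B = s := by
  let := g.toRingHom.toAlgebra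
  have : IsScalarTower k (MvPolynomial (Fin s) k) B :=
    IsScalarTower.of_algebraMap_eq' g.comp_algebraMap.symm
  have : Module.Finite (MvPolynomial (Fin s) k) B := hfin
  have : FaithfulSMul (MvPolynomial (Fin s) k) B := (faithfulSMul_iff_algebraMap_injective _ _).2 hg
  have h := _root_.trdeg_add_eq k (MvPolynomial (Fin s) k) (A := B)
  rw [_root_.trdeg_eq_zero (R := MvPolynomial (Fin s) k) (A := B), add_zero,
    MvPolynomial.trdeg_of_isDomain] at h
  simpa using h.symm

/-- The dimension of a finitely generated domain is at most its transcendence degree. -/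
lemma ringKrullDim_le_of_trdeg_eq [Algebra.FiniteType k B] (d : ℕ) (hd : Algebra.trdeg k B = d) :
    ringKrullDim B ≤ d := by
  obtain ⟨s, g, hg, hfin⟩ := exists_finite_inj_algHom_of_fg k B
  have hs := trdeg_eq_of_finite_injective k B g hg hfin
  obtain rfl : d = s := by exact_mod_cast hd.symm.trans hs
  let := g.toRingHom.toAlgebra
  have : Module.Finite (MvPolynomial (Fin d) k) B := hfin
  have h1 : ringKrullDim B ≤ ringKrullDim (MvPolynomial (Fin d) k) :=
    Order.krullDim_le_of_strictMono
      (fun p => PrimeSpectrum.comap (algebraMap (MvPolynomial (Fin d) k) B) p)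
      fun p q hpq => Ideal.IsIntegral.comap_lt_comap (R := MvPolynomial (Fin d) k) hpq
  refine h1.trans ?_
  rw [MvPolynomial.ringKrullDim_of_isNoetherianRing, ringKrullDim_eq_zero_of_field]
  simp

lemma exists_trdeg_eq [Algebra.FiniteType k B] : ∃ d : ℕ, Algebra.trdeg k B = d := by
  obtain ⟨s, g, hg, hfin⟩ := exists_finite_inj_algHom_of_fg k B
  exact ⟨s, trdeg_eq_of_finite_injective k B g hg hfin⟩

/-- At a closed point of an affine variety over an algebraically closed field, the variables of a
Noether normalization can be chosen to vanish. -/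
lemma exists_noether_normalization_at [IsAlgClosed k] [Algebra.FiniteType k B] (w : Ideal B)
    [w.IsMaximal] : ∃ (s : ℕ) (g : MvPolynomial (Fin s) k →ₐ[k] B), Function.Injective g ∧
      g.Finite ∧ ∀ i, g (MvPolynomial.X i) ∈ w := by
  obtain ⟨s, g, hg, hfin⟩ := exists_finite_inj_algHom_of_fg k B
  let := Ideal.Quotient.field w
  have : Module.Finite k (B ⧸ w) := finite_of_finite_type_of_isJacobsonRing k (B ⧸ w)
  choose c hc using fun i : Fin s => (IsAlgClosed.algebraMap_bijective_of_isIntegral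
    (k := k) (K := B ⧸ w)).2 (Ideal.Quotient.mk w (g (MvPolynomial.X i)))
  let e : MvPolynomial (Fin s) k ≃ₐ[k] MvPolynomial (Fin s) k :=
    AlgEquiv.ofAlgHom (MvPolynomial.aeval fun i => MvPolynomial.X i - MvPolynomial.C (c i))
      (MvPolynomial.aeval fun i => MvPolynomial.X i + MvPolynomial.C (c i))
      (by ext i; simp [MvPolynomial.algebraMap_eq]) (by ext i; simp [MvPolynomial.algebraMap_eq])
  refine ⟨s, g.comp e.toAlgHom, hg.comp e.injective, ?_, fun i => ?_⟩
  · exact AlgHom.Finite.comp hfin (AlgHom.Finite.of_surjective _ e.surjective)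
  · rw [← Ideal.Quotient.eq_zero_iff_mem]
    have h1 : e.toAlgHom (MvPolynomial.X i) = MvPolynomial.X i - algebraMap k _ (c i) := by
      simp [e, MvPolynomial.algebraMap_eq]
    rw [AlgHom.comp_apply, h1, map_sub, map_sub, AlgHom.commutes, ← hc i]
    exact sub_self _

end Dimension

/-! ### Non-vanishing of top local cohomology -/

section NonVanishing

variable {A : Type u} [CommRing A]

/-- Near an isolated point of its zero set, an ideal contains a power of the ideal of the point. -/
lemma exists_notMem_mul_pow_mem [IsNoetherianRing A] {J w : Ideal A} (hw : w ∈ J.minimalPrimes) :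
    ∃ b ∉ w, ∃ r, ∀ a ∈ w ^ r, b * a ∈ J := by
  have hprime : w.IsPrime := hw.1.1
  obtain ⟨s, hs⟩ : w.FG := IsNoetherian.noetherian w
  have h1 : ∀ x : A, ∃ y ∉ w, x ∈ w → y * x ∈ J.radical := by
    intro x
    by_cases hx : x ∈ w
    · have h := IsLocalization.AtPrime.radical_map_of_mem_minimalPrimes (Localization.AtPrime w)
        w J hw
      have hx' := Ideal.mem_map_of_mem (algebraMap A (Localization.AtPrime w)) hx
      rw [← h] at hx'
      obtain ⟨n, hn⟩ := hx'
      rw [← map_pow, IsLocalization.algebraMap_mem_map_algebraMap_iff w.primeCompl] at hn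
      obtain ⟨y, hy, hyx⟩ := hn
      refine ⟨y, hy, fun _ => ⟨n + 1, ?_⟩⟩
      have : (y * x) ^ (n + 1) = y ^ n * x * (y * x ^ n) := by ring
      rw [this]
      exact Ideal.mul_mem_left _ _ hyx
    · exact ⟨1, hprime.one_notMem, fun h => absurd h hx⟩
  choose y hy hyx using h1
  have hb : ∏ x ∈ s, y x ∉ w := by
    rw [hprime.prod_mem_iff]
    rintro ⟨i, _, hi⟩
    exact hy i hi
  have hle : Ideal.span {∏ x ∈ s, y x} * w ≤ J.radical := by
    rw [← hs, Ideal.span_mul_span', Ideal.span_le]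
    rintro _ ⟨a, rfl, x, hx, rfl⟩
    obtain ⟨c, hc⟩ := Finset.dvd_prod_of_mem y hx
    dsimp only
    rw [hc, mul_right_comm]
    exact Ideal.mul_mem_right _ _ (hyx x (hs ▸ Ideal.subset_span hx))
  obtain ⟨r, hr⟩ := Ideal.exists_pow_le_of_le_radical_of_fg hle (IsNoetherian.noetherian _)
  refine ⟨_, fun h => hb (hprime.mem_of_pow_mem r h), r, fun a ha => hr ?_⟩
  rw [mul_pow, Ideal.span_singleton_pow]
  exact Ideal.mul_mem_mul (Ideal.mem_span_singleton_self _) ha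

/-- Near an isolated point `w` of `V(J)`, a local cohomology class that vanishes with supports in
`V(J)` also vanishes with supports in any `V(K)` that contains `w`. -/
lemma ModuleChain.IsBoundary.exists_smul [IsNoetherianRing A] {c : ModuleChain A}
    {J K w : Ideal A} (hw : w ∈ J.minimalPrimes) (hK : K ≤ w) {n : ℕ} {x : c.N n}
    (h : c.IsBoundary J n x) : ∃ b ∉ w, c.IsBoundary K n (b • x) := by
  have hprime : w.IsPrime := hw.1.1
  cases n with
  | zero =>
    have h' : x = 0 := h
    exact ⟨1, hprime.one_notMem, by rw [h']; exact smul_zero _⟩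
  | succ n =>
    obtain ⟨y, hy, rfl⟩ := h
    obtain ⟨b, hb, r, hr⟩ := exists_notMem_mul_pow_mem hw
    obtain ⟨l, hl⟩ := exists_pow_smul_mem_torsionSections (IsNoetherian.noetherian J) hr hy
    exact ⟨b ^ l, fun h => hb (hprime.mem_of_pow_mem l h), b ^ l • y,
      torsionSections_anti (hK.trans Ideal.le_radical) hl, map_smul _ _ _⟩

/-- A prime ideal of a finite extension of `k[t₁, …, t_D]` that contains the variables lies over
the origin. -/
lemma comap_eq_of_variables_mem {k : Type u} [Field k] {D : ℕ} {B : Type u} [CommRing B]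
    [Algebra (MvPolynomial (Fin D) k) B] (q w : Ideal B) [hq : q.IsPrime] [hw : w.IsPrime]
    (hqX : ∀ i, algebraMap (MvPolynomial (Fin D) k) B (MvPolynomial.X i) ∈ q)
    (hwX : ∀ i, algebraMap (MvPolynomial (Fin D) k) B (MvPolynomial.X i) ∈ w) :
    q.comap (algebraMap (MvPolynomial (Fin D) k) B) =
      w.comap (algebraMap (MvPolynomial (Fin D) k) B) := by
  have key : ∀ (q : Ideal B) (_ : q.IsPrime)
      (_ : ∀ i, algebraMap (MvPolynomial (Fin D) k) B (MvPolynomial.X i) ∈ q)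
      (f : MvPolynomial (Fin D) k), algebraMap _ B f ∈ q ↔ MvPolynomial.constantCoeff f = 0 := by
    intro q hq hqX f
    have hle : MvPolynomial.idealOfVars (Fin D) k ≤ q.comap (algebraMap _ B) := by
      rw [MvPolynomial.idealOfVars, Ideal.span_le]
      rintro _ ⟨i, rfl⟩
      exact hqX i
    have hf : f - MvPolynomial.C (MvPolynomial.constantCoeff f) ∈
        MvPolynomial.idealOfVars (Fin D) k := by
      rw [← pow_one (MvPolynomial.idealOfVars (Fin D) k), MvPolynomial.mem_pow_idealOfVars_iff']
      intro x hx
      obtain rfl : x = 0 := by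
        rw [← Finsupp.degree_eq_zero_iff]
        omega
      simp [MvPolynomial.constantCoeff_eq]
    have h1 := hle hf
    rw [Ideal.mem_comap, map_sub] at h1
    have h2 : algebraMap (MvPolynomial (Fin D) k) B f ∈ q ↔ algebraMap (MvPolynomial (Fin D) k) B
        (MvPolynomial.C (MvPolynomial.constantCoeff f)) ∈ q :=
      ⟨fun h => (Submodule.sub_mem_iff_right q h).1 h1,
        fun h => (Submodule.sub_mem_iff_left q h).1 h1⟩
    rw [h2]
    refine ⟨fun h => ?_, fun h => by rw [h, map_zero, map_zero]; exact zero_mem _⟩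
    by_contra hne
    exact hq.ne_top (Ideal.eq_top_of_isUnit_mem _ h
      (((isUnit_iff_ne_zero.2 hne).map MvPolynomial.C).map _))
  ext f
  rw [Ideal.mem_comap, Ideal.mem_comap, key q hq hqX, key w hw hwX]

/-- The local cohomology of a non-zero ideal of an affine variety of dimension `D` over an
algebraically closed field, with supports in a closed subset that has an isolated point, does not
vanish in degree `D`. The variables of a Noether normalization cut out the same point; the vanishing
would make all fractions `v / (t₁ ⋯ t_D) ^ M`, for a fixed `v ≠ 0`, zero in local cohomology near
that point. -/
theorem ModuleChain.not_vanish_of_isolated_point (k : Type u) [Field k] [IsAlgClosed k]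
    [Algebra k A] [Algebra.FiniteType k A] (P w J : Ideal A) [P.IsPrime] [w.IsMaximal]
    (hPw : P ≤ w) (hJ : w ∈ J.minimalPrimes) (D : ℕ) (hD : Algebra.trdeg k (A ⧸ P) = D)
    (c : ModuleChain A) (hcP : ∀ n (x : c.E n), x ∈ torsionSections P (c.E n))
    (j : c.N 0 →ₗ[A] A ⧸ P) (hj : j ≠ 0) : ¬ c.Vanish J D := by
  intro hvan
  have hnoeth : IsNoetherianRing A := Algebra.FiniteType.isNoetherianRing k A
  let w' : Ideal (A ⧸ P) := w.map (Ideal.Quotient.mk P)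
  have hw' : w'.comap (Ideal.Quotient.mk P) = w := by
    rw [Ideal.comap_map_of_surjective _ Ideal.Quotient.mk_surjective]
    simpa [← RingHom.ker_eq_comap_bot] using hPw
  have hmax : w'.IsMaximal := by
    refine (Ideal.map_eq_top_or_isMaximal_of_surjective _ Ideal.Quotient.mk_surjective
      inferInstance).resolve_left fun h => ?_
    have h2 : w'.comap (Ideal.Quotient.mk P) = ⊤ := by rw [show w' = ⊤ from h, Ideal.comap_top]
    exact (inferInstance : w.IsMaximal).ne_top (hw' ▸ h2)
  obtain ⟨s, g, hg, hfin, hgw⟩ := exists_noether_normalization_at k (A ⧸ P) w'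
  obtain rfl : D = s := by
    exact_mod_cast hD.symm.trans (trdeg_eq_of_finite_injective k (A ⧸ P) g hg hfin)
  let := g.toRingHom.toAlgebra
  have hfin' : Module.Finite (MvPolynomial (Fin D) k) (A ⧸ P) := hfin
  -- Lifts of the variables to `A`.
  choose T₀ hT₀ using fun i => Ideal.Quotient.mk_surjective (I := P) (g (MvPolynomial.X i))
  let T : ℕ → A := fun n => if h : n < D then T₀ ⟨n, h⟩ else 0
  have hT : ∀ i : Fin D, T i = T₀ i := fun i => by simp [T]
  have hTw : initialIdeal T D ≤ w := by
    rw [initialIdeal, Ideal.span_le]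
    rintro _ ⟨i, hi, rfl⟩
    rw [hT ⟨i, hi⟩, SetLike.mem_coe, ← hw', Ideal.mem_comap, hT₀]
    exact hgw _
  have hmin : w ∈ (initialIdeal T D ⊔ P).minimalPrimes := by
    refine ⟨⟨inferInstance, sup_le hTw hPw⟩, fun q ⟨hq, hle⟩ hqw => ?_⟩
    let q' : Ideal (A ⧸ P) := q.map (Ideal.Quotient.mk P)
    have hq' : q'.comap (Ideal.Quotient.mk P) = q := by
      rw [Ideal.comap_map_of_surjective _ Ideal.Quotient.mk_surjective]
      simpa [← RingHom.ker_eq_comap_bot] using le_sup_right.trans hle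
    have hprime : q'.IsPrime := Ideal.map_isPrime_of_surjective Ideal.Quotient.mk_surjective
      (by simpa using le_sup_right.trans hle)
    have hle' : q' ≤ w' := Ideal.map_mono hqw
    have heq : q' = w' := by
      by_contra hne
      have h1 := Ideal.IsIntegral.comap_lt_comap (R := MvPolynomial (Fin D) k)
        (lt_of_le_of_ne hle' hne)
      refine h1.ne (comap_eq_of_variables_mem q' w' (fun i => ?_) hgw)
      change g (MvPolynomial.X i) ∈ q'
      rw [← hT₀, ← hT]
      exact Ideal.mem_map_of_mem _ (hle (Ideal.mem_sup_left (Ideal.subset_span ⟨i, i.2, rfl⟩)))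
    rw [← hq', heq, hw']
  -- A non-zero element of the polynomial ring in the image of `j`.
  obtain ⟨v, f, hf, hv⟩ : ∃ (v : c.N 0) (f : MvPolynomial (Fin D) k), f ≠ 0 ∧ j v = g f := by
    obtain ⟨x, hx⟩ : ∃ x, j x ≠ 0 := by
      by_contra! h
      exact hj (LinearMap.ext h)
    have halg : IsAlgebraic (MvPolynomial (Fin D) k) (j x) :=
      (Algebra.IsIntegral.isIntegral (j x)).isAlgebraic
    obtain ⟨f, hf, b, hb⟩ := halg.exists_nonzero_dvd (mem_nonZeroDivisors_of_ne_zero hx)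
    obtain ⟨a, rfl⟩ := Ideal.Quotient.mk_surjective b
    refine ⟨a • x, f, hf, ?_⟩
    rw [map_smul]
    exact (mul_comm _ _).trans hb.symm
  refine not_forall_exists_mul_mem_span_pow (A ⧸ P) hg w' hgw f hf fun M => ?_
  obtain ⟨x, hx⟩ := exists_represents (c := c) (f := T) M v D
  have hxT := hx.mem_torsionSections
  have hxP : x ∈ torsionSections P (c.N D) :=
    mem_torsionSections_of_map (c.inc D) (c.inc_injective D) (hcP D _)
  -- Near `w`, the class `x` of the fraction is supported in `w`, hence in `V(J)`, so that it
  -- vanishes after multiplication by some `b₁ * b₀ ^ l ∉ w`.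
  obtain ⟨b₀, hb₀, r, hr⟩ := exists_notMem_mul_pow_mem hmin
  obtain ⟨l, hl⟩ := exists_pow_smul_mem_torsionSections (IsNoetherian.noetherian _) hr
    (mem_torsionSections_sup.2 ⟨hxT, hxP⟩)
  have hwprime : w.IsPrime := inferInstance
  obtain ⟨b₁, hb₁, hbd⟩ := (hvan _ (torsionSections_anti (hJ.1.2.trans Ideal.le_radical)
    hl)).exists_smul hJ hTw
  rw [smul_smul] at hbd
  obtain ⟨s, hs⟩ := (hx.smul (b₁ * b₀ ^ l)).exists_mem_of_isBoundary hbd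
  refine ⟨s, Ideal.Quotient.mk P (b₁ * b₀ ^ l), fun h => ?_, ?_⟩
  · rw [← Ideal.mem_comap, hw'] at h
    exact (hwprime.mem_or_mem h).elim hb₁ fun h => hb₀ (hwprime.mem_of_pow_mem l h)
  · have h1 : j ((∏ i ∈ Finset.range D, T i) ^ s • (b₁ * b₀ ^ l) • v) =
        Ideal.Quotient.mk P (b₁ * b₀ ^ l) * g ((∏ i, MvPolynomial.X i) ^ s * f) := by
      rw [map_smul, map_smul, hv, Finset.prod_range]
      simp only [hT, Algebra.smul_def, Ideal.Quotient.algebraMap_eq, map_pow, map_prod, hT₀,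
        map_mul]
      ring
    rw [show algebraMap (MvPolynomial (Fin D) k) (A ⧸ P) = g.toRingHom from rfl]
    refine h1 ▸ ?_
    refine Submodule.smul_induction_on hs (fun a ha y _ => ?_) fun y z hy hz => ?_
    · rw [map_smul, Algebra.smul_def, Ideal.Quotient.algebraMap_eq]
      refine Ideal.mul_mem_right _ _ ?_
      have h2 := Ideal.mem_map_of_mem (Ideal.Quotient.mk P) ha
      rw [Ideal.map_span] at h2
      refine Ideal.span_mono ?_ h2
      rintro _ ⟨_, ⟨i, hi, rfl⟩, rfl⟩
      refine ⟨⟨i, hi⟩, ?_⟩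
      exact ((congrArg (Ideal.Quotient.mk P) (congrArg (· ^ (s + M)) (hT ⟨i, hi⟩))).trans
        ((map_pow _ _ _).trans (congrArg (· ^ (s + M)) (hT₀ ⟨i, hi⟩)))).symm
    · rw [map_add]
      exact add_mem hy hz

end NonVanishing

/-! ### Sections of sheaves of modules -/

section Sections

variable {X : Scheme.{u}}

/-- Restriction of sections of a sheaf of modules. -/
noncomputable def res (M : X.Modules) {U V : X.Opens} (h : V ≤ U) : Γ(M, U) →+ Γ(M, V) :=
  (M.presheaf.map (homOfLE h).op).hom

lemma res_res (M : X.Modules) {U V W : X.Opens} (h : V ≤ U) (h' : W ≤ V) (x : Γ(M, U)) :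
    res M h' (res M h x) = res M (h'.trans h) x := by
  change (M.presheaf.map (homOfLE h').op) ((M.presheaf.map (homOfLE h).op) x) = _
  rw [← ConcreteCategory.comp_apply, ← Functor.map_comp]
  rfl

@[simp]
lemma res_self (M : X.Modules) {U : X.Opens} (x : Γ(M, U)) : res M le_rfl x = x := by
  change (M.presheaf.map (𝟙 _)) x = x
  simp

lemma app_res {M N : X.Modules} (f : M ⟶ N) {U V : X.Opens} (h : V ≤ U) (x : Γ(M, U)) :
    f.app V (res M h x) = res N h (f.app U x) :=
  (congrArg (fun φ => φ.hom x) (f.mapPresheaf.naturality (homOfLE h).op) :)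

lemma eq_of_res_eq (M : X.Modules) {U : X.Opens} {x y : Γ(M, U)}
    (h : ∀ p ∈ U, ∃ (V : X.Opens) (hV : V ≤ U), p ∈ V ∧ res M hV x = res M hV y) : x = y := by
  choose V hV hp hxy using h
  refine TopCat.Sheaf.eq_of_locally_eq' ⟨M.presheaf, M.isSheaf⟩ (fun p : U => V p p.2) U
    (fun p => homOfLE (hV p p.2)) (fun p hp' => Opens.mem_iSup.2 ⟨⟨p, hp'⟩, hp p hp'⟩) x y
    fun p => hxy p p.2

lemma app_injective_of_mono {M N : X.Modules} (f : M ⟶ N) [Mono f] (U : X.Opens) :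
    Function.Injective (f.app U) := by
  have h : Mono ((Scheme.Modules.toPresheaf X).map f) := inferInstance
  rw [NatTrans.mono_iff_mono_app] at h
  exact (AddCommGrpCat.mono_iff_injective _).1 (h (.op U))

lemma mono_of_app_injective {M N : X.Modules} (f : M ⟶ N)
    (h : ∀ U, Function.Injective (f.app U)) : Mono f := by
  refine ⟨fun {K} a b hab => Scheme.Modules.hom_ext _ _ fun U => ?_⟩
  ext x
  apply h U
  exact congrArg (fun φ => (Scheme.Modules.Hom.app φ U).hom x) hab

/-- The morphism of sheaves of modules `f` is surjective on sections, locally. -/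
def LocallySurjective {M N : X.Modules} (f : M ⟶ N) : Prop :=
  ∀ (U : X.Opens) (t : Γ(N, U)), ∀ p ∈ U, ∃ (V : X.Opens) (hV : V ≤ U), p ∈ V ∧
    ∃ s : Γ(M, V), f.app V s = res N hV t

lemma epi_of_locallySurjective {M N : X.Modules} (f : M ⟶ N) (h : LocallySurjective f) : Epi f := by
  refine ⟨fun {K} a b hab => Scheme.Modules.hom_ext _ _ fun U => ?_⟩
  ext t
  refine eq_of_res_eq K fun p hp => ?_
  obtain ⟨V, hV, hpV, s, hs⟩ := h U t p hp
  refine ⟨V, hV, hpV, ?_⟩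
  rw [← app_res, ← app_res, ← hs]
  exact congrArg (fun φ => (Scheme.Modules.Hom.app φ V).hom s) hab

/-- The forgetful functor to sheaves of abelian groups preserves epimorphisms: it is, after
composition with sheafification, exact on presheaves of modules, and every sheaf of modules is the
sheafification of its underlying presheaf. -/
lemma epi_toSheaf_map {M N : SheafOfModules.{u} X.ringCatSheaf} (f : M ⟶ N) [hf : Epi f] :
    Epi ((SheafOfModules.toSheaf.{u} X.ringCatSheaf).map f) := by
  let R := X.ringCatSheaf
  let sh := PresheafOfModules.sheafification.{u} (𝟙 R.obj)
  let adj : sh ⊣ _ := PresheafOfModules.sheafificationAdjunction.{u} (𝟙 R.obj)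
  have hc : IsIso adj.counit :=
    inferInstanceAs (IsIso (PresheafOfModules.sheafificationAdjunction.{u} (𝟙 R.obj)).counit)
  have hc' (K : SheafOfModules.{u} R) : IsIso (adj.counit.app K) := NatIso.isIso_app_of_isIso _ K
  let f' := (SheafOfModules.forget.{u} R ⋙ PresheafOfModules.restrictScalars (𝟙 R.obj)).map f
  have hcM := hc' M
  have hcN := hc' N
  have hnat : sh.map f' ≫ adj.counit.app N = adj.counit.app M ≫ f := adj.counit.naturality f
  have hepi : Epi (sh.map f') := by
    have h4 : sh.map f' = (adj.counit.app M ≫ f) ≫ inv (adj.counit.app N) := by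
      rw [IsIso.eq_comp_inv]; exact hnat
    rw [h4]
    exact epi_comp _ _
  have hmono : Mono (sh.map (image.ι f')) := inferInstance
  have hepi' : Epi (sh.map (image.ι f')) := by
    have h5 : sh.map (factorThruImage f') ≫ sh.map (image.ι f') = sh.map f' := by
      rw [← Functor.map_comp, image.fac]
    have : Epi (sh.map (factorThruImage f') ≫ sh.map (image.ι f')) := by rw [h5]; exact hepi
    exact epi_of_epi (sh.map (factorThruImage f')) _
  have hiso : IsIso (sh.map (image.ι f')) := isIso_of_mono_of_epi _
  have h6 : Epi ((SheafOfModules.toSheaf.{u} R).map (sh.map (factorThruImage f'))) :=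
    inferInstanceAs (Epi ((PresheafOfModules.toPresheaf.{u} R.obj ⋙
      presheafToSheaf _ AddCommGrpCat.{u}).map (factorThruImage f')))
  have h7 : f = inv (adj.counit.app M) ≫ (sh.map (factorThruImage f') ≫ sh.map (image.ι f')) ≫
      adj.counit.app N := by
    rw [← Functor.map_comp, image.fac, hnat, IsIso.inv_hom_id_assoc]
  rw [h7, Functor.map_comp, Functor.map_comp, Functor.map_comp]
  have h8 := epi_comp ((SheafOfModules.toSheaf.{u} R).map (sh.map (factorThruImage f')))
    ((SheafOfModules.toSheaf.{u} R).map (sh.map (image.ι f')))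
  have h9 := epi_comp ((SheafOfModules.toSheaf.{u} R).map (sh.map (factorThruImage f')) ≫
    (SheafOfModules.toSheaf.{u} R).map (sh.map (image.ι f')))
    ((SheafOfModules.toSheaf.{u} R).map (adj.counit.app N))
  exact epi_comp _ _

variable (X) in
/-- The sheaf of abelian groups underlying a sheaf of modules. -/
noncomputable def toAbSheaf : X.Modules ⥤ TopCat.Sheaf AddCommGrpCat.{u} X :=
  SheafOfModules.toSheaf.{u} X.ringCatSheaf

instance : PreservesFiniteLimits (toAbSheaf X) :=
  inferInstanceAs (PreservesFiniteLimits (SheafOfModules.toSheaf.{u} X.ringCatSheaf))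

instance : (toAbSheaf X).Additive :=
  inferInstanceAs (SheafOfModules.toSheaf.{u} X.ringCatSheaf).Additive

instance : (toAbSheaf X).PreservesEpimorphisms where
  preserves {M N} f hf := epi_toSheaf_map (M := M) (N := N) f (hf := hf)

lemma shortExact_map_toAbSheaf {S : ShortComplex X.Modules} (hS : S.ShortExact) :
    (S.map (toAbSheaf X)).ShortExact := by
  have := hS.mono_f
  have := hS.epi_g
  exact
    { exact := hS.exact.map_of_mono_of_preservesKernel _ inferInstance inferInstance
      mono_f := inferInstanceAs (Mono ((toAbSheaf X).map S.f))
      epi_g := inferInstanceAs (Epi ((toAbSheaf X).map S.g)) }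

lemma locallySurjective_of_epi {M N : X.Modules} (f : M ⟶ N) [hf : Epi f] :
    LocallySurjective f := by
  have h : Epi ((toAbSheaf X).map f) := inferInstance
  have h' := (TopCat.Presheaf.isLocallySurjective_iff _).1
    ((TopCat.Sheaf.isLocallySurjective_iff_epi _).2 h)
  intro U t p hp
  obtain ⟨V, hV, ⟨s, hs⟩, hpV⟩ := h' U t p hp
  exact ⟨V, hV, hpV, s, hs⟩

lemma exists_app_eq_of_exact {S : ShortComplex X.Modules} (hS : S.Exact) [Mono S.f]
    {U : X.Opens} (x : Γ(S.X₂, U)) (hx : S.g.app U x = 0) : ∃ y, S.f.app U y = x :=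
  TopCat.Sheaf.sections_exact_of_left_exact
    (hS.map_of_mono_of_preservesKernel (toAbSheaf X) inferInstance inferInstance)
    (inferInstanceAs (Mono ((toAbSheaf X).map S.f))) x hx

lemma exact_of_sections (S : ShortComplex X.Modules)
    (h : ∀ (U : X.Opens) (x : Γ(S.X₂, U)), S.g.app U x = 0 → ∀ p ∈ U, ∃ (V : X.Opens) (hV : V ≤ U),
      p ∈ V ∧ ∃ y, S.f.app V y = res S.X₂ hV x) : S.Exact := by
  rw [ShortComplex.exact_iff_epi_kernel_lift]
  apply epi_of_locallySurjective
  intro U t p hp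
  obtain ⟨V, hV, hpV, y, hy⟩ := h U ((kernel.ι S.g).app U t)
    (congrArg (fun φ => (Scheme.Modules.Hom.app φ U).hom t) (kernel.condition S.g)) p hp
  refine ⟨V, hV, hpV, y, app_injective_of_mono (kernel.ι S.g) V ?_⟩
  rw [app_res, ← hy]
  exact congrArg (fun φ => (Scheme.Modules.Hom.app φ V).hom y) (kernel.lift_ι S.g S.f S.zero)

end Sections

/-! ### Sections with support -/

section Support

variable {X : Scheme.{u}} (Z : Closeds X)

/-- The section `x` of `M` over `U` restricts to zero on `U ∖ Z`. -/
def IsSupportedIn (M : X.Modules) {U : X.Opens} (x : Γ(M, U)) : Prop :=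
  res M (inf_le_left : U ⊓ openCompl Z ≤ U) x = 0

/-- The inclusion of the sections supported in `Z`. -/
noncomputable def supportedInclusion (M : X.Modules) : (sectionsSupportedIn Z).obj M ⟶ M :=
  kernel.ι _

instance (M : X.Modules) : Mono (supportedInclusion Z M) :=
  inferInstanceAs (Mono (kernel.ι _))

lemma supportedInclusion_naturality {M N : X.Modules} (f : M ⟶ N) :
    (sectionsSupportedIn Z).map f ≫ supportedInclusion Z N = supportedInclusion Z M ≫ f :=
  kernel.lift_ι _ _ _

lemma supportedInclusion_app_map {M N : X.Modules} (f : M ⟶ N) {U : X.Opens}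
    (x : Γ((sectionsSupportedIn Z).obj M, U)) :
    (supportedInclusion Z N).app U (((sectionsSupportedIn Z).map f).app U x) =
      f.app U ((supportedInclusion Z M).app U x) :=
  congrArg (fun φ => (Scheme.Modules.Hom.app φ U).hom x) (supportedInclusion_naturality Z f)

lemma res_eq_zero_of_le (M : X.Modules) {U V W : X.Opens} (hV : V ≤ U) (hW : W ≤ V) {x : Γ(M, U)}
    (h : res M hV x = 0) : res M (hW.trans hV) x = 0 := by
  rw [← res_res M hV hW, h, map_zero]

lemma unit_app_eq_zero_iff (M : X.Modules) {U : X.Opens} (x : Γ(M, U)) :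
    ((Scheme.Modules.restrictAdjunction (openCompl Z).ι).unit.app M).app U x = 0 ↔
      IsSupportedIn Z M x := by
  have h : (openCompl Z).ι ''ᵁ (openCompl Z).ι ⁻¹ᵁ U = U ⊓ openCompl Z := by
    rw [Scheme.Hom.image_preimage_eq_opensRange_inf, Scheme.Opens.opensRange_ι, inf_comm]
  have h0 : ((Scheme.Modules.restrictAdjunction (openCompl Z).ι).unit.app M).app U x =
    res M ((openCompl Z).ι.image_preimage_le U) x :=
    congrArg (fun φ => φ.hom x)
      (Scheme.Modules.restrictAdjunction_unit_app_app (openCompl Z).ι M U)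
  rw [h0]
  exact ⟨fun hx => res_eq_zero_of_le M ((openCompl Z).ι.image_preimage_le U) h.ge hx,
    fun hx => res_eq_zero_of_le M inf_le_left h.le hx⟩

lemma isSupportedIn_supportedInclusion (M : X.Modules) {U : X.Opens}
    (x : Γ((sectionsSupportedIn Z).obj M, U)) :
    IsSupportedIn Z M ((supportedInclusion Z M).app U x) :=
  (unit_app_eq_zero_iff Z M _).1 (congrArg (fun φ => (Scheme.Modules.Hom.app φ U).hom x)
    (kernel.condition ((Scheme.Modules.restrictAdjunction (openCompl Z).ι).unit.app M)))

lemma exists_supportedInclusion_eq (M : X.Modules) {U : X.Opens} {x : Γ(M, U)}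
    (hx : IsSupportedIn Z M x) : ∃ y, (supportedInclusion Z M).app U y = x := by
  let g := (Scheme.Modules.restrictAdjunction (openCompl Z).ι).unit.app M
  let S := ShortComplex.mk (kernel.ι g) g (kernel.condition g)
  have hS : S.Exact := ShortComplex.exact_kernel g
  have : Mono S.f := inferInstanceAs (Mono (kernel.ι g))
  exact exists_app_eq_of_exact hS x ((unit_app_eq_zero_iff Z M x).2 hx)

/-- Epimorphisms between sheaves of sections with support are detected by local lifts of sections
with support. -/
lemma epi_sectionsSupportedIn_map_iff {M N : X.Modules} (f : M ⟶ N) :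
    Epi ((sectionsSupportedIn Z).map f) ↔ ∀ (U : X.Opens) (t : Γ(N, U)), IsSupportedIn Z N t →
      ∀ p ∈ U, ∃ (V : X.Opens) (hV : V ≤ U), p ∈ V ∧
        ∃ s : Γ(M, V), IsSupportedIn Z M s ∧ f.app V s = res N hV t := by
  refine ⟨fun h U t ht p hp => ?_, fun h => ?_⟩
  · obtain ⟨t, rfl⟩ := exists_supportedInclusion_eq Z N ht
    obtain ⟨V, hV, hpV, s, hs⟩ := locallySurjective_of_epi ((sectionsSupportedIn Z).map f) U t p hp
    refine ⟨V, hV, hpV, (supportedInclusion Z M).app V s,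
      isSupportedIn_supportedInclusion Z M s, ?_⟩
    rw [← supportedInclusion_app_map, hs, app_res]
  · apply epi_of_locallySurjective
    intro U t p hp
    obtain ⟨V, hV, hpV, s, hs, hst⟩ := h U _ (isSupportedIn_supportedInclusion Z N t) p hp
    obtain ⟨s, rfl⟩ := exists_supportedInclusion_eq Z M hs
    refine ⟨V, hV, hpV, s, app_injective_of_mono (supportedInclusion Z N) V ?_⟩
    rw [supportedInclusion_app_map, hst, app_res]

lemma IsSupportedIn.res {M : X.Modules} {U V : X.Opens} (hV : V ≤ U) {x : Γ(M, U)}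
    (h : IsSupportedIn Z M x) : IsSupportedIn Z M (res M hV x) := by
  have := res_eq_zero_of_le M inf_le_left (inf_le_inf_right (openCompl Z) hV) h
  rw [IsSupportedIn, res_res]
  exact this

instance : PreservesFiniteLimits (sectionsSupportedIn Z) := by
  refine ((Functor.preservesFiniteLimits_tfae (sectionsSupportedIn Z)).out 0 3).1 ?_
  intro S hS
  have := hS.mono_f
  refine ⟨exact_of_sections _ fun U (x : Γ((sectionsSupportedIn Z).obj S.X₂, U)) hx p hp =>
    ⟨U, le_rfl, hp, ?_⟩, ?_⟩
  · have h1 : S.g.app U ((supportedInclusion Z S.X₂).app U x) = 0 := by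
      rw [← supportedInclusion_app_map]
      exact (congrArg _ hx).trans (map_zero _)
    obtain ⟨y, hy⟩ := exists_app_eq_of_exact hS.exact _ h1
    have h2 : IsSupportedIn Z S.X₁ y := by
      apply app_injective_of_mono S.f
      rw [app_res, hy, map_zero]
      exact isSupportedIn_supportedInclusion Z S.X₂ x
    obtain ⟨y, rfl⟩ := exists_supportedInclusion_eq Z S.X₁ h2
    refine ⟨y, app_injective_of_mono (supportedInclusion Z S.X₂) U ?_⟩
    refine (supportedInclusion_app_map Z S.f y).trans (hy.trans ?_)
    exact congrArg _ (res_self _ _).symm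
  · refine mono_of_app_injective _
      fun U (x y : Γ((sectionsSupportedIn Z).obj S.X₁, U)) hxy => ?_
    apply app_injective_of_mono (supportedInclusion Z S.X₁) U
    apply app_injective_of_mono S.f U
    rw [← supportedInclusion_app_map, ← supportedInclusion_app_map]
    exact congrArg _ hxy

end Support

/-! ### Flasque sheaves of modules -/

section Flasque

variable {X : Scheme.{u}}

/-- A sheaf of modules is flasque if its restriction maps are surjective. -/
def IsFlasque (M : X.Modules) : Prop :=
  ∀ ⦃U V : X.Opens⦄ (h : V ≤ U), Function.Surjective (res M h)

lemma IsFlasque.toAbSheaf {M : X.Modules} (h : IsFlasque M) :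
    TopCat.Sheaf.IsFlasque ((toAbSheaf X).obj M) :=
  ⟨fun i => (AddCommGrpCat.epi_iff_surjective _).2 (h (leOfHom i.unop))⟩

lemma IsFlasque.app_surjective {S : ShortComplex X.Modules} (hS : S.ShortExact)
    (h : IsFlasque S.X₁) (U : X.Opens) : Function.Surjective (S.g.app U) := by
  have := h.toAbSheaf
  have : TopCat.Sheaf.IsFlasque (S.map (PerverseCoherent.toAbSheaf X)).X₁ := this
  exact (AddCommGrpCat.epi_iff_surjective _).1
    (TopCat.Sheaf.IsFlasque.epi_of_shortExact (U := U) (shortExact_map_toAbSheaf hS))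

lemma IsFlasque.quotient {S : ShortComplex X.Modules} (hS : S.ShortExact)
    (h₁ : IsFlasque S.X₁) (h₂ : IsFlasque S.X₂) : IsFlasque S.X₃ := by
  intro U V h x
  obtain ⟨y, rfl⟩ := h₁.app_surjective hS V x
  obtain ⟨z, rfl⟩ := h₂ h y
  exact ⟨S.g.app U z, (app_res _ _ _).symm⟩

lemma isFlasque_of_injective (M : X.Modules) [hM : Injective M] : IsFlasque M := by
  intro U V h x
  let R := X.ringCatSheaf
  let adj := PresheafOfModules.sheafificationAdjunction.{u} (𝟙 R.obj)
  have hfree : (PresheafOfModules.free R.obj).PreservesMonomorphisms := by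
    refine ⟨fun {A B} f hf => PresheafOfModules.mono_of_injective fun W => ?_⟩
    rw [NatTrans.mono_iff_mono_app] at hf
    have := (mono_iff_injective _).1 (hf W)
    exact Finsupp.mapDomain_injective this
  have hM' : Injective (show SheafOfModules.{u} R from M) := hM
  have h1 := adj.map_injective _ hM'
  have h2 := (PresheafOfModules.freeAdjunction R.obj).map_injective _ h1
  have hmono : Mono (yoneda.map (homOfLE h)) := inferInstance
  let T : X.Opensᵒᵖ ⥤ Type u := M.presheaf ⋙ forget Ab
  have h3 : Injective T := h2
  let x' : yoneda.obj V ⟶ T := yonedaEquiv.symm x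
  refine ⟨yonedaEquiv (Injective.factorThru x' (yoneda.map (homOfLE h))), ?_⟩
  have h4 := Injective.comp_factorThru x' (yoneda.map (homOfLE h))
  have h5 := congrArg yonedaEquiv h4
  rw [← yonedaEquiv_naturality, Equiv.apply_symm_apply] at h5
  exact h5

lemma epi_sectionsSupportedIn_map_of_isFlasque (Z : Closeds X) {S : ShortComplex X.Modules}
    (hS : S.ShortExact) (h : IsFlasque S.X₁) : Epi ((sectionsSupportedIn Z).map S.g) := by
  have := hS.mono_f
  rw [epi_sectionsSupportedIn_map_iff]
  intro U t ht p hp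
  obtain ⟨s, rfl⟩ := h.app_surjective hS U t
  obtain ⟨y, hy⟩ := exists_app_eq_of_exact hS.exact
    (res S.X₂ (inf_le_left : U ⊓ openCompl Z ≤ U) s) (by rw [app_res]; exact ht)
  obtain ⟨y, rfl⟩ := h inf_le_left y
  refine ⟨U, le_rfl, hp, s - S.f.app U y, ?_, ?_⟩
  · rw [IsSupportedIn, map_sub, ← app_res, hy, sub_self]
  · rw [map_sub, res_self, sub_eq_self]
    exact congrArg (fun φ => (Scheme.Modules.Hom.app φ U).hom y) S.zero

/-- Flasque sheaves have no higher local cohomology. -/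
lemma IsFlasque.derivedVanish (Z : Closeds X) {M : X.Modules} (hM : IsFlasque M) (n : ℕ) :
    DerivedVanish (sectionsSupportedIn Z) (n + 1) M :=
  DerivedVanish.of_acyclicClass IsFlasque (fun A _ => isFlasque_of_injective A)
    (fun _ hS h => epi_sectionsSupportedIn_map_of_isFlasque Z hS h)
    (fun _ hS h₁ h₂ => IsFlasque.quotient hS h₁ h₂) n hM

end Flasque

/-! ### Restriction to open subschemes -/

section Restriction

variable {X Y : Scheme.{u}} (f : X ⟶ Y) [IsOpenImmersion f]

instance : (Scheme.Modules.restrictFunctor f).Additive where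
  map_add := rfl

instance : PreservesFiniteLimits (Scheme.Modules.restrictFunctor f) := by
  refine ((Functor.preservesFiniteLimits_tfae (Scheme.Modules.restrictFunctor f)).out 0 3).1 ?_
  intro S hS
  have := hS.mono_f
  refine ⟨exact_of_sections _ fun U (x : Γ(S.X₂, f ''ᵁ U)) hx p hp => ⟨U, le_rfl, hp, ?_⟩, ?_⟩
  · obtain ⟨y, hy⟩ := exists_app_eq_of_exact hS.exact x hx
    exact ⟨y, hy.trans (res_self _ _).symm⟩
  · exact mono_of_app_injective _ fun U => app_injective_of_mono S.f (f ''ᵁ U)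

instance : PreservesFiniteColimits (Scheme.Modules.restrictFunctor f) :=
  have := (Scheme.Modules.restrictAdjunction f).leftAdjoint_preservesColimits
  inferInstance

lemma IsFlasque.restrict {M : Y.Modules} (hM : IsFlasque M) : IsFlasque (M.restrict f) :=
  fun _ _ h => hM (f.image_mono h)

variable {f} {Z : Closeds Y} {Z' : Closeds X}

lemma isSupportedIn_restrict_iff (hZ : (Z' : Set X) = f ⁻¹' Z) (M : Y.Modules) {U : X.Opens}
    (x : Γ(M, f ''ᵁ U)) :
    IsSupportedIn Z' (M.restrict f) (U := U) x ↔ IsSupportedIn Z M x := by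
  have h : f ''ᵁ (U ⊓ openCompl Z') = f ''ᵁ U ⊓ openCompl Z := by
    ext y
    constructor
    · rintro ⟨p, ⟨hp, hpZ⟩, rfl⟩
      exact ⟨⟨p, hp, rfl⟩, fun hy => hpZ (hZ.ge hy)⟩
    · rintro ⟨⟨p, hp, rfl⟩, hpZ⟩
      exact ⟨p, ⟨hp, fun hy => hpZ (hZ.le hy)⟩, rfl⟩
  exact ⟨fun hx => res_eq_zero_of_le M (f.image_mono inf_le_left) h.ge hx,
    fun hx => res_eq_zero_of_le M inf_le_left h.le hx⟩

lemma isZero_iff_sections (M : X.Modules) : IsZero M ↔ ∀ (U : X.Opens) (x : Γ(M, U)), x = 0 := by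
  rw [IsZero.iff_id_eq_zero]
  refine ⟨fun h U x => congrArg (fun φ => (Scheme.Modules.Hom.app φ U).hom x) h, fun h => ?_⟩
  refine Scheme.Modules.hom_ext _ _ fun U => ?_
  ext x
  exact h U x

lemma isZero_sectionsSupportedIn_iff (Z : Closeds X) (M : X.Modules) :
    IsZero ((sectionsSupportedIn Z).obj M) ↔
      ∀ (U : X.Opens) (x : Γ(M, U)), IsSupportedIn Z M x → x = 0 := by
  rw [isZero_iff_sections]
  refine ⟨fun h U x hx => ?_, fun h U x => ?_⟩
  · obtain ⟨y, rfl⟩ := exists_supportedInclusion_eq Z M hx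
    rw [h U y, map_zero]
  · apply app_injective_of_mono (supportedInclusion Z M) U
    rw [map_zero]
    exact h U _ (isSupportedIn_supportedInclusion Z M x)

/-- The image of the preimage of an open subset of the range of an open immersion. -/
lemma image_preimage_of_le {U : X.Opens} {V : Y.Opens} (h : V ≤ f ''ᵁ U) :
    f ''ᵁ f ⁻¹ᵁ V = V := by
  rw [Scheme.Hom.image_preimage_eq_opensRange_inf]
  exact inf_eq_right.2 (h.trans (f.image_le_opensRange U))

lemma epi_restrict_of_epi (hZ : (Z' : Set X) = f ⁻¹' Z) {M N : Y.Modules} (φ : M ⟶ N)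
    (h : Epi ((sectionsSupportedIn Z).map φ)) :
    Epi ((sectionsSupportedIn Z').map ((Scheme.Modules.restrictFunctor f).map φ)) := by
  rw [epi_sectionsSupportedIn_map_iff] at h ⊢
  intro U (t : Γ(N, f ''ᵁ U)) ht p hp
  obtain ⟨V, hV, hpV, s, hs, hst⟩ :=
    h (f ''ᵁ U) t ((isSupportedIn_restrict_iff hZ N t).1 ht) (f p) ⟨p, hp, rfl⟩
  have hV' : f ''ᵁ f ⁻¹ᵁ V = V := image_preimage_of_le hV
  have hVU : f ⁻¹ᵁ V ≤ U := by
    intro q hq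
    obtain ⟨q', hq', hqq⟩ := hV hq
    rwa [← f.isOpenEmbedding.injective hqq]
  refine ⟨f ⁻¹ᵁ V, hVU, hpV, res M hV'.le s,
    (isSupportedIn_restrict_iff hZ M _).2 (hs.res Z hV'.le), ?_⟩
  refine (app_res φ hV'.le s).trans ?_
  rw [hst, res_res]
  rfl

lemma epi_of_epi_restrict {J : Type*} {U : J → Scheme.{u}} (f : ∀ i, U i ⟶ Y)
    [∀ i, IsOpenImmersion (f i)] (hf : ∀ y, ∃ i x, f i x = y) {Z : Closeds Y}
    {Z' : ∀ i, Closeds (U i)} (hZ : ∀ i, (Z' i : Set (U i)) = f i ⁻¹' Z)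
    {M N : Y.Modules} (φ : M ⟶ N)
    (h : ∀ i, Epi ((sectionsSupportedIn (Z' i)).map
      ((Scheme.Modules.restrictFunctor (f i)).map φ))) :
    Epi ((sectionsSupportedIn Z).map φ) := by
  rw [epi_sectionsSupportedIn_map_iff]
  intro W t ht p hp
  obtain ⟨i, q, rfl⟩ := hf p
  have h' := (epi_sectionsSupportedIn_map_iff _ _).1 (h i)
  have hW : f i ''ᵁ f i ⁻¹ᵁ W ≤ W := (f i).image_preimage_le W
  obtain ⟨V, hV, hqV, s, hs, hst⟩ := h' (f i ⁻¹ᵁ W) (res N hW t)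
    ((isSupportedIn_restrict_iff (hZ i) N _).2 (ht.res Z hW)) q hp
  refine ⟨f i ''ᵁ V, ((f i).image_mono hV).trans hW, ⟨q, hqV, rfl⟩, s,
    (isSupportedIn_restrict_iff (hZ i) M _).1 hs, ?_⟩
  refine Eq.trans hst ?_
  exact res_res N hW ((f i).image_mono hV) t

/-- The restriction of an injective resolution consists of flasque sheaves, hence it computes local
cohomology. -/
lemma derivedVanish_succ_restrict_iff (c : SyzygyChain Y.Modules)
    (hc : ∀ n, Injective (c.S n).X₂) (n : ℕ) :
    DerivedVanish (sectionsSupportedIn Z') (n + 1) ((c.S 0).X₁.restrict f) ↔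
      Epi ((sectionsSupportedIn Z').map ((Scheme.Modules.restrictFunctor f).map (c.S n).g)) :=
  (c.map (Scheme.Modules.restrictFunctor f)).derivedVanish_succ_iff_of_acyclic n fun n i =>
    ((isFlasque_of_injective (c.S n).X₂).restrict f).derivedVanish Z' i

/-- The vanishing of local cohomology sheaves restricts to open subschemes. -/
theorem derivedVanish_restrict (hZ : (Z' : Set X) = f ⁻¹' Z) (n : ℕ) {M : Y.Modules}
    (h : DerivedVanish (sectionsSupportedIn Z) n M) :
    DerivedVanish (sectionsSupportedIn Z') n (M.restrict f) := by
  cases n with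
  | zero =>
    rw [derivedVanish_zero_iff, isZero_sectionsSupportedIn_iff] at h ⊢
    exact fun U x hx => h _ _ ((isSupportedIn_restrict_iff hZ M x).1 hx)
  | succ n =>
    let c := SyzygyChain.ofEnoughInjectives M
    refine (derivedVanish_succ_restrict_iff c (fun _ => inferInstance) n).2 ?_
    exact epi_restrict_of_epi hZ _ ((c.derivedVanish_succ_iff (fun _ => inferInstance) n).1 h)

/-- The vanishing of local cohomology sheaves can be checked on an open cover. -/
theorem derivedVanish_of_restrict {J : Type*} {U : J → Scheme.{u}} (f : ∀ i, U i ⟶ Y)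
    [∀ i, IsOpenImmersion (f i)] (hf : ∀ y, ∃ i x, f i x = y) {Z : Closeds Y}
    {Z' : ∀ i, Closeds (U i)} (hZ : ∀ i, (Z' i : Set (U i)) = f i ⁻¹' Z) (n : ℕ) {M : Y.Modules}
    (h : ∀ i, DerivedVanish (sectionsSupportedIn (Z' i)) n (M.restrict (f i))) :
    DerivedVanish (sectionsSupportedIn Z) n M := by
  cases n with
  | zero =>
    rw [derivedVanish_zero_iff, isZero_sectionsSupportedIn_iff]
    intro W x hx
    refine eq_of_res_eq M fun p hp => ?_
    obtain ⟨i, q, rfl⟩ := hf p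
    have h' := h i
    rw [derivedVanish_zero_iff, isZero_sectionsSupportedIn_iff] at h'
    have hW : f i ''ᵁ f i ⁻¹ᵁ W ≤ W := (f i).image_preimage_le W
    refine ⟨_, hW, ⟨q, hp, rfl⟩, ?_⟩
    rw [map_zero]
    exact h' _ _ ((isSupportedIn_restrict_iff (hZ i) M (res M hW x)).2 (hx.res Z hW))
  | succ n =>
    let c := SyzygyChain.ofEnoughInjectives M
    refine (c.derivedVanish_succ_iff (fun _ => inferInstance) n).2 ?_
    refine epi_of_epi_restrict f hf hZ _ fun i => ?_
    exact (derivedVanish_succ_restrict_iff c (fun _ => inferInstance) n).1 (h i)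

end Restriction

/-! ### Quasi-coherent sheaves on affine schemes -/

section Tilde

variable {R : CommRingCat.{u}} {M N : ModuleCat.{u} R}

/-- The basic open subset `D(f)` of an affine scheme. -/
def specBasicOpen (f : R) : (Spec R).Opens := PrimeSpectrum.basicOpen f

/-- A basic open neighbourhood inside an open neighbourhood. -/
lemma exists_specBasicOpen_le {U : (Spec R).Opens} {p : Spec R} (hp : p ∈ U) :
    ∃ f : R, p ∈ specBasicOpen f ∧ specBasicOpen f ≤ U := by
  obtain ⟨_, ⟨_, ⟨f, rfl⟩, rfl⟩, hpf, hf⟩ :=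
    PrimeSpectrum.isBasis_basic_opens.exists_subset_of_mem_open hp U.2
  exact ⟨f, hpf, hf⟩

/-- The section of `M^~` over `U` defined by an element of `M`. -/
noncomputable def tsec (M : ModuleCat.{u} R) (U : (Spec R).Opens) : M →ₗ[R] Γ(tilde M, U) :=
  (tilde.toOpen M U).hom

lemma res_tsec {U V : (Spec R).Opens} (h : V ≤ U) (x : M) :
    res (tilde M) h (tsec M U x) = tsec M V x := rfl

lemma res_smul (F : (Spec R).Modules) {U V : (Spec R).Opens} (h : V ≤ U) (a : R) (x : Γ(F, U)) :
    res F h (a • x) = a • res F h x :=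
  Scheme.Modules.map_smul_Spec (homOfLE h).op a x

lemma app_smul {F F' : (Spec R).Modules} (φ : F ⟶ F') {U : (Spec R).Opens} (a : R) (x : Γ(F, U)) :
    φ.app U (a • x) = a • φ.app U x :=
  Scheme.Modules.Hom.app_smul φ _ x

lemma map_app_tsec (φ : M ⟶ N) (U : (Spec R).Opens) (x : M) :
    (tilde.map φ).app U (tsec M U x) = tsec N U (φ x) :=
  congrArg (fun ψ => ψ.hom x) (tilde.toOpen_map_app φ U)

lemma tsec_top_bijective : Function.Bijective (tsec M ⊤) :=
  ConcreteCategory.bijective_of_isIso (tilde.toOpen M ⊤)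

instance (f : R) : IsLocalizedModule.Away f (tsec M (specBasicOpen f)) :=
  inferInstanceAs (IsLocalizedModule.Away f (tilde.toOpen M (PrimeSpectrum.basicOpen f)).hom)

lemma exists_pow_smul_eq_tsec (f : R) (s : Γ(tilde M, specBasicOpen f)) :
    ∃ (n : ℕ) (x : M), f ^ n • s = tsec M _ x := by
  obtain ⟨⟨x, ⟨_, n, rfl⟩⟩, h⟩ :=
    IsLocalizedModule.surj (.powers f) (tsec M (specBasicOpen f)) s
  exact ⟨n, x, h⟩

lemma exists_pow_smul_eq_zero (f : R) {x : M} (h : tsec M (specBasicOpen f) x = 0) :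
    ∃ n : ℕ, f ^ n • x = 0 := by
  obtain ⟨⟨_, n, rfl⟩, h⟩ := (IsLocalizedModule.eq_zero_iff (.powers f)
    (tsec M (specBasicOpen f))).1 h
  exact ⟨n, h⟩

lemma pow_smul_injective (F : (Spec R).Modules) {f : R} {U : (Spec R).Opens}
    (hU : U ≤ specBasicOpen f) (n : ℕ) {x y : Γ(F, U)} (h : f ^ n • x = f ^ n • y) :
    x = y :=
  (Scheme.Modules.isSMulRegular_of_le_basicOpen hU).pow n h

lemma exists_pow_smul_eq_section (F : (Spec R).Modules) {f : R} {U : (Spec R).Opens}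
    (hU : U ≤ specBasicOpen f) (n : ℕ) (x : Γ(F, U)) : ∃ y : Γ(F, U), f ^ n • y = x := by
  have h := (Module.End.isUnit_iff _).1 ((F.isUnit_algebraMap_end_of_le_basicOpen f hU).pow n)
  obtain ⟨y, hy⟩ := h.2 x
  refine ⟨y, ?_⟩
  rw [← map_pow] at hy
  exact hy

lemma tsec_eq_zero_of_pow_smul {U : (Spec R).Opens} {f : R} {n : ℕ} {x : M}
    (hU : U ≤ specBasicOpen f) (h : f ^ n • x = 0) : tsec M U x = 0 := by
  refine pow_smul_injective (tilde M) hU n ?_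
  rw [← map_smul, h, map_zero, smul_zero]

lemma exists_res_eq_tilde_map {K : ModuleCat.{u} R} (φ : M ⟶ N) (ψ : N ⟶ K)
    (hex : Function.Exact φ ψ) {U : (Spec R).Opens} (x : Γ(tilde N, U))
    (hx : (tilde.map ψ).app U x = 0) {p : Spec R} (hp : p ∈ U) :
    ∃ (V : (Spec R).Opens) (hV : V ≤ U), p ∈ V ∧
      ∃ y, (tilde.map φ).app V y = res (tilde N) hV x := by
  obtain ⟨f, hpf, hf⟩ := exists_specBasicOpen_le hp
  obtain ⟨n, y, hy⟩ := exists_pow_smul_eq_tsec f (res _ hf x)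
  have h1 : tsec K (specBasicOpen f) (ψ y) = 0 := by
    rw [← map_app_tsec, ← hy, app_smul, app_res, hx, map_zero, smul_zero]
  obtain ⟨m, hm⟩ := exists_pow_smul_eq_zero f h1
  obtain ⟨z, hz⟩ := (hex (f ^ m • y)).1 (by rw [map_smul, hm])
  obtain ⟨s, hs⟩ := exists_pow_smul_eq_section (tilde M) le_rfl (m + n)
    (tsec M (specBasicOpen f) z)
  refine ⟨specBasicOpen f, hf, hpf, s, pow_smul_injective (tilde N) le_rfl (m + n) ?_⟩
  rw [← app_smul, hs, map_app_tsec, hz, map_smul, ← hy, smul_smul, pow_add]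

lemma tilde_map_app_injective (φ : M ⟶ N) (hφ : Function.Injective φ) (U : (Spec R).Opens) :
    Function.Injective ((tilde.map φ).app U) := by
  refine (injective_iff_map_eq_zero _).2 fun x hx => eq_of_res_eq _ fun p hp => ?_
  obtain ⟨f, hpf, hf⟩ := exists_specBasicOpen_le hp
  obtain ⟨n, y, hy⟩ := exists_pow_smul_eq_tsec f (res _ hf x)
  have h1 : tsec N (specBasicOpen f) (φ y) = 0 := by
    rw [← map_app_tsec, ← hy, app_smul, app_res, hx, map_zero, smul_zero]
  obtain ⟨m, hm⟩ := exists_pow_smul_eq_zero f h1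
  refine ⟨specBasicOpen f, hf, hpf, pow_smul_injective (tilde M) le_rfl n ?_⟩
  rw [map_zero, smul_zero, hy]
  refine tsec_eq_zero_of_pow_smul le_rfl (hφ ?_ : f ^ m • y = 0)
  rw [map_smul, hm, map_zero]

instance : PreservesFiniteLimits (tilde.functor R) := by
  refine ((Functor.preservesFiniteLimits_tfae (tilde.functor R)).out 0 3).1 ?_
  intro S hS
  refine ⟨?_, ?_⟩
  · exact exact_of_sections _ fun U x hx p hp => exists_res_eq_tilde_map S.f S.g
      ((ShortComplex.ShortExact.moduleCat_exact_iff_function_exact S).1 hS.exact) x hx hp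
  · exact mono_of_app_injective _ fun U =>
      tilde_map_app_injective S.f ((ModuleCat.mono_iff_injective _).1 hS.mono_f) U

instance : PreservesFiniteColimits (tilde.functor R) :=
  have := (tilde.adjunction (R := R)).leftAdjoint_preservesColimits
  inferInstance

/-! ### Sections with support of quasi-coherent sheaves -/

variable {I : Ideal R} {Z : Closeds (Spec R)}

lemma isSupportedIn_smul (F : (Spec R).Modules) {U : (Spec R).Opens} {x : Γ(F, U)} (a : R)
    (hx : IsSupportedIn Z F x) : IsSupportedIn Z F (a • x) := by
  rw [IsSupportedIn, res_smul, hx, smul_zero]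

lemma isSupportedIn_tsec (hZ : (Z : Set (Spec R)) = PrimeSpectrum.zeroLocus I)
    {x : M} (hx : x ∈ torsionSections I M) (U : (Spec R).Opens) :
    IsSupportedIn Z (tilde M) (tsec M U x) := by
  refine eq_of_res_eq _ fun p hp => ?_
  have hpZ : p ∉ PrimeSpectrum.zeroLocus (I : Set R) := fun h => hp.2 (hZ.ge h)
  obtain ⟨a, ha, hap⟩ := Set.not_subset.1 hpZ
  obtain ⟨n, hn⟩ := hx ha
  refine ⟨_ ⊓ specBasicOpen a, inf_le_left, ⟨hp, hap⟩, ?_⟩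
  rw [map_zero, res_tsec, res_tsec]
  exact tsec_eq_zero_of_pow_smul inf_le_right hn

lemma exists_pow_smul_eq_tsec_of_isSupportedIn [IsNoetherianRing R]
    (hZ : (Z : Set (Spec R)) = PrimeSpectrum.zeroLocus I) (f : R)
    (s : Γ(tilde M, specBasicOpen f)) (hs : IsSupportedIn Z (tilde M) s) :
    ∃ (n : ℕ) (x : M), x ∈ torsionSections I M ∧ f ^ n • s = tsec M _ x := by
  obtain ⟨n, x, hx⟩ := exists_pow_smul_eq_tsec f s
  have key : ∀ a ∈ I, ∃ m : ℕ, (f * a) ^ m • x = 0 := by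
    intro a ha
    refine exists_pow_smul_eq_zero _ ?_
    have hle : specBasicOpen (f * a) ≤
        specBasicOpen f ⊓ openCompl Z := by
      intro p hp
      exact ⟨fun h => hp (p.asIdeal.mul_mem_right a h),
        fun h => hp (p.asIdeal.mul_mem_left f (hZ.le h ha))⟩
    have h1 : IsSupportedIn Z (tilde M) (tsec M (specBasicOpen f) x) := by
      rw [← hx]; exact isSupportedIn_smul _ _ hs
    exact res_eq_zero_of_le _ inf_le_left hle h1
  obtain ⟨S, hS⟩ := (isNoetherianRing_iff_ideal_fg R).1 inferInstance I
  choose! m hm using key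
  refine ⟨S.sup m + n, f ^ S.sup m • x, ?_, ?_⟩
  · rw [← hS]
    refine mem_torsionSections_span.2 fun a ha => ⟨m a, ?_⟩
    obtain ⟨t, ht⟩ := Nat.exists_eq_add_of_le (Finset.le_sup (f := m) ha)
    have h2 := hm a (hS ▸ Ideal.subset_span ha)
    rw [mul_pow, mul_comm, mul_smul] at h2
    rw [ht, pow_add, mul_comm, mul_smul, smul_comm, h2, smul_zero]
  · rw [map_smul, ← hx, smul_smul, pow_add]

/-! ### Injective modules and flasque sheaves -/

/-- For an injective module `E`, every section of `E^~` over a finite union of basic open subsets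
comes from an element of `E`. -/
lemma tsec_surjective_of_eq_iSup [IsNoetherianRing R] (s : Finset R) :
    ∀ (E : ModuleCat.{u} R) [Module.Injective R E] (U : (Spec R).Opens),
      (∀ p : Spec R, p ∈ U ↔ ∃ f ∈ s, p ∈ specBasicOpen f) → Function.Surjective (tsec E U) := by
  classical
  induction s using Finset.induction_on with
  | empty =>
    intro E _ U hU t
    refine ⟨0, eq_of_res_eq _ fun p hp => ?_⟩
    simpa using (hU p).1 hp
  | insert a s ha ih =>
    intro E _ U hU t
    have haU : specBasicOpen a ≤ U := fun p hp => (hU p).2 ⟨a, Finset.mem_insert_self _ _, hp⟩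
    have hsU : ∀ f ∈ s, specBasicOpen f ≤ U :=
      fun f hf p hp => (hU p).2 ⟨f, Finset.mem_insert_of_mem hf, hp⟩
    -- On the union of the `D(f)` with `f ∈ s` the section `t` comes from an element `e`.
    let W : (Spec R).Opens := s.sup specBasicOpen
    have hW : ∀ p : Spec R, p ∈ W ↔ ∃ f ∈ s, p ∈ specBasicOpen f := by
      intro p
      simp only [W]
      clear_value W
      clear ih ha hU haU hsU W
      induction s using Finset.induction_on with
      | empty => simp
      | insert b s hb ih => rw [Finset.sup_insert]; simp [ih]
    have hWU : W ≤ U := fun p hp => by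
      obtain ⟨f, hf, hpf⟩ := (hW p).1 hp
      exact hsU f hf hpf
    obtain ⟨e, he⟩ := ih E W hW (res _ hWU t)
    have hdiff : ∀ f (hf : f ∈ s), res (tilde E) (hsU f hf) (t - tsec E U e) = 0 := by
      intro f hf
      have hfW : specBasicOpen f ≤ W := fun p hp => (hW p).2 ⟨f, hf, hp⟩
      rw [map_sub, res_tsec, ← res_tsec hfW, he, res_res, sub_self]
    -- The difference is, on `D(a)`, given by an element that is killed by powers of the `f ∈ s`.
    obtain ⟨n, y, hy⟩ := exists_pow_smul_eq_tsec a (res _ haU (t - tsec E U e))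
    have key : ∀ f ∈ s, ∃ m : ℕ, (a * f) ^ m • y = 0 := by
      intro f hf
      have h1 : specBasicOpen (a * f) ≤ specBasicOpen a :=
        fun p hp h => hp (p.asIdeal.mul_mem_right f h)
      have h2 : specBasicOpen (a * f) ≤ specBasicOpen f :=
        fun p hp h => hp (p.asIdeal.mul_mem_left a h)
      refine exists_pow_smul_eq_zero _ ?_
      rw [← res_tsec h1, ← hy, res_smul, res_res, ← res_res _ (hsU f hf) h2, hdiff f hf, map_zero,
        smul_zero]
    choose! m hm using key
    have hy' : a ^ s.sup m • y ∈ torsionSections (Ideal.span (s : Set R)) E := by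
      refine mem_torsionSections_span.2 fun f hf => ⟨m f, ?_⟩
      obtain ⟨r, hr⟩ := Nat.exists_eq_add_of_le (Finset.le_sup (f := m) hf)
      have h2 := hm f hf
      rw [mul_pow, mul_comm, mul_smul] at h2
      rw [hr, pow_add, mul_comm, mul_smul, smul_comm, h2, smul_zero]
    obtain ⟨z, hz, r, hr⟩ :=
      exists_pow_smul_eq_torsionSections (Ideal.span (s : Set R)) E a (s.sup m + n) hy'
    refine ⟨e + z, ?_⟩
    refine eq_of_res_eq _ fun p hp => ?_
    obtain ⟨f, hf, hpf⟩ := (hU p).1 hp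
    rw [Finset.mem_insert] at hf
    obtain rfl | hf := hf
    · refine ⟨_, haU, hpf, pow_smul_injective (tilde E) le_rfl (s.sup m + n + r) ?_⟩
      rw [map_add, map_add, res_tsec, res_tsec, smul_add, ← map_smul _ (_ ^ _) z, hr, map_smul,
        map_smul, ← hy, map_sub, res_tsec, smul_smul, smul_smul, ← pow_add, ← pow_add, smul_sub,
        show r + s.sup m + n = s.sup m + n + r by omega, add_sub_cancel]
    · refine ⟨_, hsU f hf, hpf, ?_⟩
      obtain ⟨l, hl⟩ := mem_torsionSections_span.1 hz f hf
      have h0 := hdiff f hf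
      rw [map_sub, sub_eq_zero] at h0
      rw [h0, map_add, map_add, res_tsec, res_tsec, tsec_eq_zero_of_pow_smul le_rfl hl, add_zero]

/-- The sheaf associated with an injective module over a noetherian ring is flasque. -/
lemma isFlasque_tilde [IsNoetherianRing R] (E : ModuleCat.{u} R) [Module.Injective R E] :
    IsFlasque (tilde E) := by
  intro U V h t
  obtain ⟨s, hs⟩ : ∃ s : Finset R, ∀ p : Spec R, p ∈ V ↔ ∃ f ∈ s, p ∈ specBasicOpen f := by
    let V' : Set (PrimeSpectrum R) := V.1
    obtain ⟨s, hs⟩ := (PrimeSpectrum.isCompact_isOpen_iff (s := V')).1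
      ⟨NoetherianSpace.isCompact _, V.2⟩
    refine ⟨s, fun p => ?_⟩
    have h1 : ∀ q : PrimeSpectrum R, q ∈ V' ↔ ∃ f ∈ s, f ∉ q.asIdeal := by
      intro q
      rw [← hs, Set.mem_compl_iff, PrimeSpectrum.mem_zeroLocus, Set.not_subset]
      rfl
    exact h1 p
  obtain ⟨e, rfl⟩ := tsec_surjective_of_eq_iSup s E V hs t
  exact ⟨tsec E U e, rfl⟩

/-! ### Local cohomology of quasi-coherent sheaves on affine schemes -/

/-- The short exact sequences of modules underlying a `ModuleChain`. -/
noncomputable def ModuleChain.toSyzygyChain {A : Type u} [CommRing A] (c : ModuleChain A) :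
    SyzygyChain (ModuleCat.{u} A) where
  S n := ShortComplex.mk (ModuleCat.ofHom (c.inc n)) (ModuleCat.ofHom (c.proj n))
    (by ext x; exact c.proj_inc n x)
  shortExact n :=
    { exact := (ShortComplex.ShortExact.moduleCat_exact_iff_function_exact _).2 (c.exact n)
      mono_f := (ModuleCat.mono_iff_injective _).2 (c.inc_injective n)
      epi_g := (ModuleCat.epi_iff_surjective _).2 (c.proj_surjective n) }
  e _ := Iso.refl _

lemma derivedVanish_zero_tilde_iff [IsNoetherianRing R]
    (hZ : (Z : Set (Spec R)) = PrimeSpectrum.zeroLocus I) :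
    DerivedVanish (sectionsSupportedIn Z) 0 (tilde M) ↔ ∀ x ∈ torsionSections I M, x = 0 := by
  rw [derivedVanish_zero_iff, isZero_sectionsSupportedIn_iff]
  refine ⟨fun h x hx => ?_, fun h U t ht => eq_of_res_eq _ fun p hp => ?_⟩
  · apply tsec_top_bijective.1
    rw [h ⊤ _ (isSupportedIn_tsec hZ hx ⊤), map_zero]
  · obtain ⟨f, hpf, hf⟩ := exists_specBasicOpen_le hp
    obtain ⟨n, x, hx, hn⟩ :=
      exists_pow_smul_eq_tsec_of_isSupportedIn hZ f (res _ hf t) (ht.res Z hf)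
    refine ⟨_, hf, hpf, pow_smul_injective (tilde M) le_rfl n ?_⟩
    rw [hn, h x hx, map_zero, map_zero, smul_zero]

lemma epi_sectionsSupportedIn_tilde_iff [IsNoetherianRing R]
    (hZ : (Z : Set (Spec R)) = PrimeSpectrum.zeroLocus I) (φ : M ⟶ N) :
    Epi ((sectionsSupportedIn Z).map (tilde.map φ)) ↔
      ∀ x ∈ torsionSections I N, ∃ y ∈ torsionSections I M, φ y = x := by
  rw [epi_sectionsSupportedIn_map_iff]
  refine ⟨fun h x hx => ?_, fun h U t ht p hp => ?_⟩
  · let 𝔞 : Ideal R := ((torsionSections I M).map φ.hom).comap (LinearMap.toSpanSingleton R N x)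
    have h𝔞 : 𝔞 = ⊤ := by
      by_contra hne
      obtain ⟨𝔪, h𝔪, hle⟩ := Ideal.exists_le_maximal 𝔞 hne
      let p : Spec R := ⟨𝔪, h𝔪.isPrime⟩
      obtain ⟨V, hV, hpV, s, hs, hst⟩ :=
        h ⊤ (tsec N ⊤ x) (isSupportedIn_tsec hZ hx ⊤) p trivial
      obtain ⟨f, hpf, hf⟩ := exists_specBasicOpen_le hpV
      obtain ⟨n, y, hy, hn⟩ :=
        exists_pow_smul_eq_tsec_of_isSupportedIn hZ f (res _ hf s) (hs.res Z hf)
      have h1 : tsec N (specBasicOpen f) (φ y - f ^ n • x) = 0 := by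
        rw [map_sub, ← map_app_tsec, ← hn, app_smul, app_res, hst, res_res, res_tsec, map_smul,
          sub_self]
      obtain ⟨m, hm⟩ := exists_pow_smul_eq_zero f h1
      have h2 : f ^ (m + n) ∈ 𝔞 := by
        refine ⟨f ^ m • y, Submodule.smul_mem _ _ hy, ?_⟩
        rw [smul_sub, sub_eq_zero, smul_smul, ← pow_add] at hm
        rw [map_smul]
        exact hm
      exact hpf (h𝔪.isPrime.mem_of_pow_mem _ (hle h2))
    have h1 : (1 : R) ∈ 𝔞 := h𝔞 ▸ trivial
    obtain ⟨y, hy, hyx⟩ := h1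
    exact ⟨y, hy, hyx.trans (one_smul R x)⟩
  · obtain ⟨f, hpf, hf⟩ := exists_specBasicOpen_le hp
    obtain ⟨n, x, hx, hn⟩ :=
      exists_pow_smul_eq_tsec_of_isSupportedIn hZ f (res _ hf t) (ht.res Z hf)
    obtain ⟨y, hy, rfl⟩ := h x hx
    obtain ⟨s, hs⟩ := exists_pow_smul_eq_section (tilde M) le_rfl n (tsec M (specBasicOpen f) y)
    refine ⟨_, hf, hpf, s, ?_, ?_⟩
    · refine pow_smul_injective (tilde M) (f := f) inf_le_left n ?_
      rw [← res_smul, hs, smul_zero]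
      exact isSupportedIn_tsec hZ hy _
    · refine pow_smul_injective (tilde N) le_rfl n ?_
      rw [← app_smul, hs, map_app_tsec, hn]

/-- On an affine noetherian scheme the local cohomology sheaves of a quasi-coherent sheaf vanish
if and only if the local cohomology of the module does. -/
theorem derivedVanish_tilde_iff [IsNoetherianRing R]
    (hZ : (Z : Set (Spec R)) = PrimeSpectrum.zeroLocus I) (c : ModuleChain R) (n : ℕ) :
    DerivedVanish (sectionsSupportedIn Z) n (tilde (c.N 0)) ↔ c.Vanish I n := by
  cases n with
  | zero => exact derivedVanish_zero_tilde_iff hZ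
  | succ n =>
    refine ((c.toSyzygyChain.map (tilde.functor R)).derivedVanish_succ_iff_of_acyclic n
      fun n i => ?_).trans (epi_sectionsSupportedIn_tilde_iff hZ (ModuleCat.ofHom (c.proj n)))
    have := c.injective n
    exact (isFlasque_tilde (c.E n)).derivedVanish Z i

end Tilde

/-! ### Coherent sheaves on affine charts -/

section Coherent

open scoped TensorProduct

variable {X : Scheme.{u}}

lemma generatingSections_restrict {Y : Scheme.{u}} (f : Y ⟶ X)
    [IsOpenImmersion f] {M : X.Modules}
    (G : SheafOfModules.GeneratingSections (R := X.ringCatSheaf) M) [hG : Finite G.I] :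
    ∃ G' : SheafOfModules.GeneratingSections (R := Y.ringCatSheaf) (M.restrict f),
      Finite G'.I := by
  have h : PreservesColimitsOfSize.{u, u} (Scheme.Modules.restrictFunctor f) :=
    (Scheme.Modules.restrictAdjunction f).leftAdjoint_preservesColimits
  let F : SheafOfModules.{u} X.ringCatSheaf ⥤ SheafOfModules.{u} Y.ringCatSheaf :=
    Scheme.Modules.restrictFunctor f
  have hF : PreservesColimitsOfSize.{u, u} F := h
  exact ⟨G.map F (Scheme.Modules.restrictUnitIso f).symm, hG⟩

lemma exists_generatingSections (M : X.Modules)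
    (hM : SheafOfModules.IsFiniteType.{u} (R := X.ringCatSheaf) M) {x : X} {V : X.Opens}
    (hx : x ∈ V) :
    ∃ (U : X.Opens) (_ : x ∈ U), IsAffineOpen U ∧ U ≤ V ∧
      ∃ G : SheafOfModules.GeneratingSections (R := (U : Scheme.{u}).ringCatSheaf) (M.restrict U.ι),
        Finite G.I := by
  obtain ⟨σ, hσ⟩ := hM.exists_localGeneratorsData
  have hcov := σ.coversTop
  rw [Opens.coversTop_iff, IsOpenCover] at hcov
  obtain ⟨i, hi⟩ := Opens.mem_iSup.1 (hcov.ge (trivial : x ∈ (⊤ : X.Opens)))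
  obtain ⟨U, hU, hxU, hUW⟩ : ∃ U : X.Opens, IsAffineOpen U ∧ x ∈ U ∧ U ≤ σ.X i ⊓ V :=
    Opens.isBasis_iff_nbhd.1 X.isBasis_affineOpens ⟨hi, hx⟩
  refine ⟨U, hxU, hU, hUW.trans inf_le_right, ?_⟩
  replace hUW := hUW.trans inf_le_left
  let W := σ.X i
  let u : (U : Scheme.{u}) ⟶ (W : Scheme.{u}) := X.homOfLE hUW
  have h : PreservesColimitsOfSize.{u, u} (Scheme.Modules.restrictFunctor u) :=
    (Scheme.Modules.restrictAdjunction u).leftAdjoint_preservesColimits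
  let F : SheafOfModules.{u} (X.ringCatSheaf.over W) ⥤
      SheafOfModules.{u} (U : Scheme.{u}).ringCatSheaf :=
    (Scheme.Modules.overEquiv W).functor ⋙ Scheme.Modules.restrictFunctor u
  have hF : PreservesColimitsOfSize.{u, u} F :=
    @comp_preservesColimits _ _ _ _ _ _ (Scheme.Modules.overEquiv W).functor
      (Scheme.Modules.restrictFunctor u) inferInstance h
  let iso : SheafOfModules.overFunctor X.ringCatSheaf W ⋙ F ≅ Scheme.Modules.restrictFunctor U.ι :=
    (Functor.associator _ _ _).symm ≪≫
        Functor.isoWhiskerRight (Scheme.Modules.overFunctorEquiv W) _ ≪≫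
        (Scheme.Modules.restrictFunctorComp _ _).symm ≪≫
        (Scheme.Modules.restrictFunctorCongr (X.homOfLE_ι hUW))
  let G' := (σ.generators i).map F (Scheme.Modules.restrictUnitIso _).symm
  have hiso : IsIso (iso.app M).hom := (iso.app M).isIso_hom
  let p : F.obj (SheafOfModules.over M W) ⟶
      (show SheafOfModules.{u} (U : Scheme.{u}).ringCatSheaf from M.restrict U.ι) := (iso.app M).hom
  have hp : Epi p := @IsIso.epi_of_iso _ _ _ _ _ hiso
  exact ⟨G'.ofEpi p, (hσ.isFiniteType i).finite⟩

lemma module_finite_of_generatingSections {R : CommRingCat.{u}} (N : ModuleCat.{u} R)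
    (G : SheafOfModules.GeneratingSections (R := (Spec R).ringCatSheaf) (tilde N))
    [hG : Finite G.I] : Module.Finite R N := by
  let π : tilde (ModuleCat.of R (G.I →₀ R)) ⟶ tilde N := (tildeFinsupp G.I).hom ≫ G.π
  have hπ : Epi π := @epi_comp _ _ _ _ _ _
    (@IsIso.epi_of_iso _ _ _ _ _ (tildeFinsupp G.I).isIso_hom) _ G.epi
  obtain ⟨φ, hφ⟩ := (tilde.functor R).map_surjective π
  have h1 : Epi ((tilde.functor R).map φ) := hφ ▸ hπ
  have h2 : Epi φ := (tilde.functor R).epi_of_epi_map h1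
  exact Module.Finite.of_surjective φ.hom ((ModuleCat.epi_iff_surjective φ).1 h2)

/-- A coherent sheaf is given, near each point, by a finitely generated module over an arbitrarily
small affine chart. -/
lemma IsCoherent.exists_chart {M : X.Modules} (hM : IsCoherent M) {x : X} {V : X.Opens}
    (hx : x ∈ V) :
    ∃ (R : CommRingCat.{u}) (f : Spec R ⟶ X) (_ : IsOpenImmersion f) (p : Spec R)
      (N : ModuleCat.{u} R) (_ : Module.Finite R N), f p = x ∧ (∀ q, f q ∈ V) ∧
      Nonempty (tilde N ≅ M.restrict f) := by
  obtain ⟨U, hxU, hU, hUV, G, hG⟩ := exists_generatingSections M hM.isFiniteType hx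
  let f : Spec Γ(X, U) ⟶ X := hU.isoSpec.inv ≫ U.ι
  have hqc := hM.isQuasicoherent
  have hqc' : SheafOfModules.IsQuasicoherent.{u} (R := (Spec Γ(X, U)).ringCatSheaf)
    (M.restrict f) := Scheme.Modules.isQuasicoherent_restrictFunctor f M
  have hiso := Scheme.Modules.isIso_fromTildeΓ_of_isQuasicoherent (M.restrict f)
  let N : ModuleCat.{u} Γ(X, U) :=
    (modulesSpecToSheaf.obj (M.restrict f)).presheaf.obj (.op ⊤)
  let e : tilde N ≅ M.restrict f := asIso (M.restrict f).fromTildeΓ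
  obtain ⟨G₁, hG₁⟩ := generatingSections_restrict hU.isoSpec.inv G
  let e' : (M.restrict U.ι).restrict hU.isoSpec.inv ≅ tilde N :=
    ((Scheme.Modules.restrictFunctorComp hU.isoSpec.inv U.ι).app M).symm ≪≫ e.symm
  have hN : Module.Finite Γ(X, U) N :=
    @module_finite_of_generatingSections _ N
      (@SheafOfModules.GeneratingSections.ofEpi _ _ _ _ _ _ _ _ G₁ e'.hom
        (@IsIso.epi_of_iso _ _ _ _ _ e'.isIso_hom)) hG₁
  refine ⟨Γ(X, U), f, inferInstance, hU.isoSpec.hom ⟨x, hxU⟩, N, hN, ?_,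
    fun q => hUV (hU.isoSpec.inv q).2, ⟨e⟩⟩
  have : (hU.isoSpec.hom ≫ f) ⟨x, hxU⟩ = x := by
    simp [f]
  exact this

/-! ### The support of a coherent sheaf -/

lemma support_eq_of_iso {M N : X.Modules} (e : M ≅ N) : support M = support N := by
  ext x
  have e' : TopCat.Presheaf.stalk (C := Ab.{u}) M.presheaf x ≅
      TopCat.Presheaf.stalk (C := Ab.{u}) N.presheaf x :=
    (TopCat.Presheaf.stalkFunctor Ab.{u} x).mapIso ((Scheme.Modules.toPresheaf X).mapIso e)
  exact e'.addCommGroupIsoToAddEquiv.toEquiv.nontrivial_congr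

lemma mem_support_restrict {Y : Scheme.{u}} (f : Y ⟶ X) [IsOpenImmersion f] (M : X.Modules)
    (y : Y) : y ∈ support (M.restrict f) ↔ f y ∈ support M :=
  ((Scheme.Modules.restrictStalkNatIso f y).app
    M).addCommGroupIsoToAddEquiv.toEquiv.nontrivial_congr

lemma nontrivial_iff_of_isLocalizedModule {R : Type*} [CommRing R] {S : Submonoid R} {M M' : Type*}
    [AddCommGroup M] [Module R M] {_ : AddCommGroup M'} {_ : Module R M'} {f : M →ₗ[R] M'}
    (_ : IsLocalizedModule S f) : Nontrivial M' ↔ Nontrivial (LocalizedModule S M) :=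
  (IsLocalizedModule.iso S f).symm.toEquiv.nontrivial_congr

lemma mem_support_tilde {R : CommRingCat.{u}} (N : ModuleCat.{u} R) [Module.Finite R N]
    (p : Spec R) : p ∈ support (tilde N) ↔ Module.annihilator R N ≤ p.asIdeal := by
  let q : PrimeSpectrum R := p
  have h : q ∈ Module.support R N ↔ _ := Module.mem_support_iff
  have h' : q ∈ Module.support R N ↔ _ := Module.mem_support_iff_of_finite
  refine Iff.trans ?_ (h.symm.trans h')
  have hloc :=
    tilde.instIsLocalizedModuleCarrierCarrierOfCarrierStalkAbPresheafPrimeComplAsIdealHomToStalk N q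
  exact nontrivial_iff_of_isLocalizedModule hloc

lemma nonempty_pushforward_sections_iso {R S : CommRingCat.{u}} (φ : R ⟶ S) (T : (Spec S).Modules) :
    Nonempty (moduleSpecΓFunctor.obj ((Scheme.Modules.pushforward (Spec.map φ)).obj T) ≅
      (ModuleCat.restrictScalars φ.hom).obj (moduleSpecΓFunctor.obj T)) :=
  ⟨((sheafToPresheaf _ _ ⋙ (evaluation _ _).obj (.op ⊤)).mapIso
    ((pushforwardCompModulesSpecToSheafIso φ).app T) :)⟩

/-- A finitely generated module has a non-zero linear map to every field through which its
annihilator is killed. -/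
lemma exists_linearMap_ne_zero {R : Type u} [CommRing R] {N : Type u} [AddCommGroup N] [Module R N]
    [Module.Finite R N] {K : Type u} [Field K] [Algebra R K]
    (h : Module.annihilator R N ≤ RingHom.ker (algebraMap R K)) : ∃ f : N →ₗ[R] K, f ≠ 0 := by
  let p : Ideal R := RingHom.ker (algebraMap R K)
  have hp : p.IsPrime := RingHom.ker_isPrime _
  let κ := p.ResidueField
  have h1 : Nontrivial (TensorProduct R κ N) :=
    (Module.mem_support_iff_nontrivial_residueField_tensorProduct ⟨p, hp⟩).1
      (Module.mem_support_iff_of_finite.2 h)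
  obtain ⟨z, hz⟩ := exists_ne (0 : TensorProduct R κ N)
  obtain ⟨ℓ, hℓ⟩ : ∃ ℓ : Module.Dual κ (TensorProduct R κ N), ℓ z ≠ 0 := by
    by_contra! hzero
    exact hz ((Module.forall_dual_apply_eq_zero_iff κ z).1 hzero)
  let θ : κ →ₐ[R] K := Ideal.ResidueField.liftₐ p (Algebra.ofId R K) le_rfl
    fun a ha => IsUnit.mk0 _ ha
  refine ⟨θ.toLinearMap ∘ₗ ℓ.restrictScalars R ∘ₗ TensorProduct.mk R κ N 1, fun h0 => hℓ ?_⟩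
  have h2 : ∀ n : N, ℓ ((1 : κ) ⊗ₜ[R] n) = 0 := fun n => by
    have := LinearMap.congr_fun h0 n
    exact (map_eq_zero θ).1 this
  clear hz hℓ
  induction z using TensorProduct.induction_on with
  | zero => exact map_zero ℓ
  | tmul a n =>
    have h3 : a ⊗ₜ[R] n = a • ((1 : κ) ⊗ₜ[R] n) := by
      rw [TensorProduct.smul_tmul', smul_eq_mul, _root_.mul_one]
    rw [h3, map_smul, h2, smul_zero]
  | add x y hx hy => rw [map_add, hx, hy, add_zero]

lemma isZero_pullback_tilde_iff {R : CommRingCat.{u}} {K : Type u} [Field K]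
    (φ : R ⟶ CommRingCat.of K) (N : ModuleCat.{u} R) [Module.Finite R N] :
    IsZero ((Scheme.Modules.pullback (Spec.map φ)).obj (tilde N)) ↔
      ¬ Module.annihilator R N ≤ RingHom.ker φ.hom := by
  let adj := (tilde.adjunction (R := R)).comp
    (Scheme.Modules.pullbackPushforwardAdjunction (Spec.map φ))
  constructor
  · intro h hle
    let T : (Spec (CommRingCat.of K)).Modules := tilde (ModuleCat.of K K)
    obtain ⟨e⟩ := nonempty_pushforward_sections_iso φ T
    let e' : ModuleCat.of K K ≅ (moduleSpecΓFunctor (R := CommRingCat.of K)).obj T :=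
      tilde.isoTop (R := CommRingCat.of K) (ModuleCat.of K K)
    algebraize [φ.hom]
    obtain ⟨f, hf⟩ := exists_linearMap_ne_zero (N := N) (K := K) hle
    let f' : N ⟶ (ModuleCat.restrictScalars φ.hom).obj (ModuleCat.of K K) := ModuleCat.ofHom f
    have hsrc : Subsingleton
        ((tilde.functor R ⋙ Scheme.Modules.pullback (Spec.map φ)).obj N ⟶ T) :=
      ⟨fun a b => h.eq_of_src a b⟩
    have hsub : Subsingleton
        (N ⟶ (Scheme.Modules.pushforward (Spec.map φ) ⋙ moduleSpecΓFunctor).obj T) :=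
      (adj.homEquiv N T).symm.injective.subsingleton
    let m := (ModuleCat.restrictScalars φ.hom).map e'.hom ≫ e.inv
    have h1 : f' ≫ m = 0 := hsub.elim _ _
    have h2 : f' = 0 := by rw [← cancel_mono m, h1, zero_comp]
    exact hf (congrArg ModuleCat.Hom.hom h2)
  · intro h
    obtain ⟨a, ha, hna⟩ := Set.not_subset.1 h
    let T := (Scheme.Modules.pullback (Spec.map φ)).obj (tilde N)
    obtain ⟨e⟩ := nonempty_pushforward_sections_iso φ T
    have hsub : Subsingleton
        (N ⟶ (Scheme.Modules.pushforward (Spec.map φ) ⋙ moduleSpecΓFunctor).obj T) := by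
      refine subsingleton_of_forall_eq 0 fun ψ => ?_
      rw [← cancel_mono e.hom, zero_comp]
      ext n
      let y : (moduleSpecΓFunctor (R := CommRingCat.of K)).obj T := (ψ ≫ e.hom).hom n
      have h1 : φ.hom a • y = 0 := by
        have h2 : (ψ ≫ e.hom).hom (a • n) = a • (ψ ≫ e.hom).hom n := map_smul _ _ _
        rw [Module.mem_annihilator.1 ha n, map_zero] at h2
        exact h2.symm
      have h3 : IsUnit (φ.hom a) := IsUnit.mk0 (G₀ := K) _ hna
      exact (h3.smul_eq_zero).1 h1
    have hend : Subsingleton (T ⟶ T) := (adj.homEquiv N T).injective.subsingleton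
    rw [IsZero.iff_id_eq_zero]
    exact Subsingleton.elim _ _

/-- The fibre of a coherent sheaf at a geometric point vanishes if and only if the point does not
lie in the support. -/
lemma isZero_pullback_iff {M : X.Modules} (hM : IsCoherent M) {K : Type u} [Field K]
    (g : Spec (CommRingCat.of K) ⟶ X) (z : Spec (CommRingCat.of K)) :
    IsZero ((Scheme.Modules.pullback g).obj M) ↔ g z ∉ support M := by
  obtain ⟨R, f, hf, p, N, hN, hp, -, ⟨e⟩⟩ := hM.exists_chart (Opens.mem_top (g z))
  have hsub : Subsingleton (Spec (CommRingCat.of K)) :=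
    inferInstanceAs (Subsingleton (PrimeSpectrum K))
  have hrange : Set.range g ⊆ Set.range f := by
    rintro _ ⟨y, rfl⟩
    exact ⟨p, by rw [hp, Subsingleton.elim z y]⟩
  obtain ⟨φ, hφ⟩ : ∃ φ : R ⟶ CommRingCat.of K, Spec.map φ = IsOpenImmersion.lift f g hrange :=
    ⟨_, Spec.map_preimage _⟩
  have hfac : Spec.map φ ≫ f = g := by rw [hφ, IsOpenImmersion.lift_fac]
  have hpz : Spec.map φ z = p := by
    apply f.isOpenEmbedding.injective
    rw [hp, ← hfac]
    rfl
  have hker : p.asIdeal = RingHom.ker φ.hom := by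
    rw [← hpz]
    let z' : PrimeSpectrum K := z
    have hz' : z'.asIdeal = ⊥ := Ideal.eq_bot_of_prime z'.asIdeal
    change z'.asIdeal.comap φ.hom = _
    rw [hz']
    rfl
  let e' : (Scheme.Modules.pullback g).obj M ≅
      (Scheme.Modules.pullback (Spec.map φ)).obj (tilde N) :=
    (Scheme.Modules.pullbackCongr hfac.symm).app M ≪≫
      ((Scheme.Modules.pullbackComp (Spec.map φ) f).app M).symm ≪≫
      (Scheme.Modules.pullback (Spec.map φ)).mapIso
        (((Scheme.Modules.restrictFunctorIsoPullback f).app M).symm ≪≫ e.symm)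
  rw [e'.isZero_iff, isZero_pullback_tilde_iff, ← hp, ← mem_support_restrict,
    ← support_eq_of_iso e, mem_support_tilde, hker]

lemma IsCoherent.isClosed_support {M : X.Modules} (hM : IsCoherent M) : IsClosed (support M) := by
  rw [← isOpen_compl_iff, isOpen_iff_forall_mem_open]
  intro x hx
  obtain ⟨R, f, hf, p, N, hN, rfl, -, ⟨e⟩⟩ := hM.exists_chart (Opens.mem_top x)
  have key : ∀ q : Spec R, f q ∈ support M ↔ Module.annihilator R N ≤ q.asIdeal := by
    intro q
    rw [← mem_support_restrict, ← support_eq_of_iso e, mem_support_tilde]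
  rw [Set.mem_compl_iff, key] at hx
  obtain ⟨a, ha, hna⟩ := Set.not_subset.1 hx
  refine ⟨f ''ᵁ specBasicOpen a, ?_, (f ''ᵁ specBasicOpen a).2, ⟨p, hna, rfl⟩⟩
  rintro _ ⟨q, hq, rfl⟩ hqs
  exact hq ((key q).1 hqs ha)

section Equivariant

variable {S : Scheme.{u}} {G X : Over S} [GrpObj G] [ModObj G X]

/-- The support of an equivariant coherent sheaf. -/
def EquivariantCoherentSheaf.closedSupport (F : EquivariantCoherentSheaf G X) : Closeds X.left :=
  ⟨support F.sheaf, F.isCoherent.isClosed_support⟩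

/-- The support of an equivariant coherent sheaf is invariant: the fibres of the sheaf at `g x` and
at `x` are isomorphic. -/
lemma EquivariantCoherentSheaf.isInvariant_support (F : EquivariantCoherentSheaf G X) :
    IsInvariant G X F.closedSupport := by
  ext b
  let g : Spec (CommRingCat.of ((G ⊗ X).left.residueField b)) ⟶ (G ⊗ X).left :=
    (G ⊗ X).left.fromSpecResidueField b
  obtain ⟨z⟩ : Nonempty (Spec (CommRingCat.of ((G ⊗ X).left.residueField b))) :=
    inferInstanceAs (Nonempty (PrimeSpectrum ((G ⊗ X).left.residueField b)))
  have hz : g z = b := (G ⊗ X).left.fromSpecResidueField_apply b z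
  have e : (Scheme.Modules.pullback (g ≫ act G X)).obj F.sheaf ≅
      (Scheme.Modules.pullback (g ≫ pr G X)).obj F.sheaf :=
    ((Scheme.Modules.pullbackComp g (act G X)).app F.sheaf).symm ≪≫
      (Scheme.Modules.pullback g).mapIso F.iso ≪≫
      (Scheme.Modules.pullbackComp g (pr G X)).app F.sheaf
  have h1 := isZero_pullback_iff F.isCoherent (g ≫ act G X) z
  have h2 := isZero_pullback_iff F.isCoherent (g ≫ pr G X) z
  have h3 : (g ≫ act G X) z = act G X b := by rw [Scheme.Hom.comp_apply, hz]
  have h4 : (g ≫ pr G X) z = pr G X b := by rw [Scheme.Hom.comp_apply, hz]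
  rw [h3, e.isZero_iff, h2, h4, not_iff_not] at h1
  exact h1.symm

end Equivariant

end Coherent

/-! ### Dimension and generic points of closed subsets of sober spaces -/

section Dimension

variable {X : Type*} [TopologicalSpace X]

section

attribute [local instance] specializationOrder

/-- The dimension of a sober space is measured by chains of its points, ordered by
specialization. -/
lemma le_topologicalKrullDim_iff_exists_specializes [QuasiSober X] [T0Space X] (n : ℕ) :
    (n : WithBot ℕ∞) ≤ topologicalKrullDim X ↔
      ∃ y : Fin (n + 1) → X, ∀ i j, i < j → y j ⤳ y i ∧ y j ≠ y i := by
  rw [topologicalKrullDim, Order.krullDim_eq_of_orderIso irreducibleSetEquivPoints,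
    Order.le_krullDim_iff]
  constructor
  · rintro ⟨l, rfl⟩
    exact ⟨l, fun i j hij => ⟨(l.strictMono hij).le, (l.strictMono hij).ne'⟩⟩
  · rintro ⟨y, hlt⟩
    exact ⟨LTSeries.mk n y fun i j hij => lt_of_le_of_ne (hlt i j hij).1 (hlt i j hij).2.symm, rfl⟩

end

lemma le_topologicalKrullDim_iff_of_isClosed [QuasiSober X] [T0Space X] {C : Set X}
    (hC : IsClosed C) (n : ℕ) :
    (n : WithBot ℕ∞) ≤ topologicalKrullDim C ↔
      ∃ y : Fin (n + 1) → X, (∀ i, y i ∈ C) ∧ ∀ i j, i < j → y j ⤳ y i ∧ y j ≠ y i := by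
  have hs : QuasiSober C := hC.isClosedEmbedding_subtypeVal.quasiSober
  rw [le_topologicalKrullDim_iff_exists_specializes]
  constructor
  · rintro ⟨y, hlt⟩
    exact ⟨fun i => y i, fun i => (y i).2, fun i j hij =>
      ⟨(subtype_specializes_iff _ _).1 (hlt i j hij).1, fun h => (hlt i j hij).2 (Subtype.ext h)⟩⟩
  · rintro ⟨y, hy, hlt⟩
    exact ⟨fun i => ⟨y i, hy i⟩, fun i j hij =>
      ⟨(subtype_specializes_iff _ _).2 (hlt i j hij).1,
        fun h => (hlt i j hij).2 (congrArg Subtype.val h)⟩⟩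

/-- The dimension of the closure of `x` can be computed near a suitable point. -/
lemma exists_le_topologicalKrullDim_of_isOpenEmbedding [QuasiSober X] [T0Space X] {x : X} {d : ℕ}
    (hd : (d : WithBot ℕ∞) ≤ topologicalKrullDim (closure {x} : Set X)) :
    ∃ z, ∀ {Y : Type*} [TopologicalSpace Y] [QuasiSober Y] [T0Space Y] {f : Y → X},
      Topology.IsOpenEmbedding f → z ∈ Set.range f →
        ∃ q, f q = x ∧ (d : WithBot ℕ∞) ≤ topologicalKrullDim (closure {q} : Set Y) := by
  obtain ⟨y, hy, hlt⟩ := (le_topologicalKrullDim_iff_of_isClosed isClosed_closure d).1 hd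
  refine ⟨y 0, fun {Y} _ _ _ {f} hf hz => ?_⟩
  have hx : ∀ i, x ⤳ y i := fun i => specializes_iff_mem_closure.2 (hy i)
  have hr : ∀ i, y i ∈ Set.range f := fun i => by
    rcases (Fin.zero_le i).eq_or_lt with h | h
    · rwa [← h]
    · exact (hlt 0 i h).1.mem_open hf.isOpen_range hz
  obtain ⟨q, rfl⟩ := (hx 0).mem_open hf.isOpen_range hz
  choose w hw using hr
  refine ⟨q, rfl, (le_topologicalKrullDim_iff_of_isClosed isClosed_closure d).2
    ⟨w, fun i => ?_, fun i j hij => ⟨?_, fun h => ?_⟩⟩⟩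
  · rw [← specializes_iff_mem_closure, ← hf.isInducing.specializes_iff, hw]
    exact hx i
  · rw [← hf.isInducing.specializes_iff, hw, hw]
    exact (hlt i j hij).1
  · exact (hlt i j hij).2 (by rw [← hw, ← hw, h])

/-- The generic points of (the irreducible components of) a subset. -/
def genericPointsOf (S : Set X) : Set X := {x | x ∈ S ∧ ∀ y ∈ S, y ⤳ x → y = x}

variable {S : Set X}

lemma topologicalKrullDim_closure_le_of_mem (hS : IsClosed S) {x : X} (hx : x ∈ S) :
    topologicalKrullDim (closure {x} : Set X) ≤ topologicalKrullDim S :=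
  (Topology.IsEmbedding.inclusion
    (closure_minimal (Set.singleton_subset_iff.2 hx) hS)).isInducing.topologicalKrullDim_le

section

variable [NoetherianSpace X] [QuasiSober X]

lemma exists_finite_generic (hS : IsClosed S) :
    ∃ T : Set X, T.Finite ∧ T ⊆ S ∧ ∀ s ∈ S, ∃ x ∈ T, x ⤳ s := by
  obtain ⟨𝒮, hfin, hcl, hirr, rfl⟩ := NoetherianSpace.exists_finite_set_isClosed_irreducible hS
  choose g hg using fun t : 𝒮 => QuasiSober.sober (hirr t t.2) (hcl t t.2)
  have := hfin.to_subtype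
  refine ⟨Set.range g, Set.finite_range g, ?_, ?_⟩
  · rintro _ ⟨t, rfl⟩
    exact ⟨t, t.2, (hg t).mem⟩
  · rintro s ⟨t, ht, hst⟩
    exact ⟨g ⟨t, ht⟩, ⟨_, rfl⟩, (hg ⟨t, ht⟩).specializes hst⟩

lemma finite_genericPointsOf (hS : IsClosed S) : (genericPointsOf S).Finite := by
  obtain ⟨T, hfin, hTS, hT⟩ := exists_finite_generic hS
  refine hfin.subset fun x hx => ?_
  obtain ⟨t, ht, htx⟩ := hT x hx.1
  rwa [← hx.2 t (hTS ht) htx]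

variable [T0Space X]

attribute [local instance] specializationOrder in
lemma exists_genericPointsOf_specializes (hS : IsClosed S) {s : X} (hs : s ∈ S) :
    ∃ x ∈ genericPointsOf S, x ⤳ s := by
  obtain ⟨T, hfin, hTS, hT⟩ := exists_finite_generic hS
  obtain ⟨t, ht, hts⟩ := hT s hs
  obtain ⟨m, htm, hm⟩ := hfin.exists_le_maximal ht
  have htm' : m ⤳ t := htm
  refine ⟨m, ⟨hTS hm.prop, fun y hy hym => ?_⟩, htm'.trans hts⟩
  obtain ⟨t', ht', hty⟩ := hT y hy
  have h : t' ⤳ m := hty.trans hym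
  have h2 : m ⤳ t' := hm.le_of_ge ht' h
  exact (hym.antisymm (h2.trans hty)).eq

lemma exists_genericPointsOf_le_topologicalKrullDim (hS : IsClosed S) {d : ℕ}
    (hd : (d : WithBot ℕ∞) ≤ topologicalKrullDim S) :
    ∃ x ∈ genericPointsOf S, (d : WithBot ℕ∞) ≤ topologicalKrullDim (closure {x} : Set X) := by
  obtain ⟨y, hy, hlt⟩ := (le_topologicalKrullDim_iff_of_isClosed hS d).1 hd
  obtain ⟨x, hx, hxy⟩ := exists_genericPointsOf_specializes hS (hy (Fin.last d))
  refine ⟨x, hx, (le_topologicalKrullDim_iff_of_isClosed isClosed_closure d).2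
    ⟨y, fun i => specializes_iff_mem_closure.1 ?_, hlt⟩⟩
  rcases (Fin.le_last i).eq_or_lt with h | h
  · rwa [h]
  · exact hxy.trans (hlt i _ h).1

end

end Dimension

lemma topologicalKrullDim_closure_singleton_eq_ringKrullDim {R : Type*} [CommRing R]
    (q : PrimeSpectrum R) :
    topologicalKrullDim (closure {q} : Set (PrimeSpectrum R)) = ringKrullDim (R ⧸ q.asIdeal) := by
  have he := PrimeSpectrum.isClosedEmbedding_comap_of_surjective _
    (Ideal.Quotient.mk q.asIdeal) Ideal.Quotient.mk_surjective
  have hr : Set.range (PrimeSpectrum.comap (Ideal.Quotient.mk q.asIdeal)) = closure {q} := by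
    rw [range_comap_of_surjective _ _ Ideal.Quotient.mk_surjective,
      PrimeSpectrum.closure_singleton, Ideal.mk_ker]
  rw [← PrimeSpectrum.topologicalKrullDim_eq_ringKrullDim, ← hr]
  exact (IsHomeomorph.topologicalKrullDim_eq _ he.isEmbedding.toHomeomorph.isHomeomorph).symm

/-! ### Vanishing and non-vanishing of local cohomology on an affine scheme -/

section Affine

lemma ModuleChain.vanish_sup_iff_of_torsion {A : Type u} [CommRing A] {c : ModuleChain A}
    {P : Ideal A} (hc : ∀ n (x : c.E n), x ∈ torsionSections P (c.E n)) (I : Ideal A) (n : ℕ) :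
    c.Vanish (I ⊔ P) n ↔ c.Vanish I n := by
  have hE : ∀ n, torsionSections (I ⊔ P) (c.E n) = torsionSections I (c.E n) := fun n => by
    ext x
    rw [mem_torsionSections_sup]
    exact and_iff_left (hc n x)
  have hN : torsionSections (I ⊔ P) (c.N n) = torsionSections I (c.N n) := by
    ext x
    rw [mem_torsionSections_sup]
    exact and_iff_left (mem_torsionSections_of_map _ (c.inc_injective n) (hc n _))
  have hB : ∀ x, c.IsBoundary (I ⊔ P) n x ↔ c.IsBoundary I n x := fun x => by
    cases n with
    | zero => exact Iff.rfl
    | succ n =>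
      rw [IsBoundary, IsBoundary, hE]
  rw [Vanish, Vanish, hN]
  exact forall₂_congr fun x _ => hB x

variable {R : CommRingCat.{u}} {I : Ideal R} {Z : Closeds (Spec R)}

lemma shortExact_map {C D : Type*} [Category* C] [Category* D] [Abelian C] [Abelian D] (G : C ⥤ D)
    [G.Additive] [PreservesFiniteLimits G] [PreservesFiniteColimits G] {S : ShortComplex C}
    (hS : S.ShortExact) : (S.map G).ShortExact := by
  have := hS.mono_f
  have := hS.epi_g
  exact hS.map G

lemma isZero_map {C D : Type*} [Category* C] [Category* D] [Preadditive C] [Preadditive D]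
    (G : C ⥤ D) [G.Additive] {A : C} (hA : IsZero A) : IsZero (G.obj A) :=
  G.map_isZero hA

lemma DerivedVanish.of_isZero {C D : Type*} [Category* C] [Category* D] [Abelian C] [Abelian D]
    [EnoughInjectives C] {G : C ⥤ D} [G.Additive] [PreservesFiniteLimits G] {A : C}
    (hA : IsZero A) : ∀ n, DerivedVanish G n A
  | 0 => derivedVanish_zero_iff.2 (isZero_map G hA)
  | n + 1 =>
    have := hA.injective
    DerivedVanish.injective n A

lemma shortExact_tilde {N₁ N₂ N₃ : Type u} [AddCommGroup N₁] [Module R N₁] [AddCommGroup N₂]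
    [Module R N₂] [AddCommGroup N₃] [Module R N₃] (f : N₁ →ₗ[R] N₂) (g : N₂ →ₗ[R] N₃)
    (hf : Function.Injective f) (hg : Function.Surjective g) (hfg : Function.Exact f g) :
    ∃ S : ShortComplex (Spec R).Modules, S.ShortExact ∧ S.X₁ = tilde (ModuleCat.of R N₁) ∧
      S.X₂ = tilde (ModuleCat.of R N₂) ∧ S.X₃ = tilde (ModuleCat.of R N₃) := by
  let S : ShortComplex (ModuleCat.{u} R) :=
    ShortComplex.mk (ModuleCat.ofHom f) (ModuleCat.ofHom g) (by
      ext x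
      exact hfg.apply_apply_eq_zero x)
  have hS : S.ShortExact :=
    { exact := (ShortComplex.ShortExact.moduleCat_exact_iff_function_exact S).2 hfg
      mono_f := (ModuleCat.mono_iff_injective _).2 hf
      epi_g := (ModuleCat.epi_iff_surjective _).2 hg }
  exact ⟨_, shortExact_map (tilde.functor R) hS, rfl, rfl, rfl⟩

variable [IsNoetherianRing R]

/-- The case of a module that is killed by `P`: within `V(P)`, the closed subset `V(I)` is the zero
set of fewer than `i` functions. -/
lemma derivedVanish_tilde_of_torsion (hZ : (Z : Set (Spec R)) = PrimeSpectrum.zeroLocus I)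
    {P : Ideal R} {i : ℕ} (h : I ⊔ P = ⊤ ∨ ∃ s : Finset R, s.card < i ∧
      (I ⊔ P).radical = (P ⊔ Ideal.span s).radical)
    (N : ModuleCat.{u} R) (hN : ∀ x : N, x ∈ torsionSections P N) :
    DerivedVanish (sectionsSupportedIn Z) i (tilde N) := by
  obtain ⟨c, rfl, hc⟩ := ModuleChain.exists_torsion P N hN
  rw [derivedVanish_tilde_iff hZ, ← ModuleChain.vanish_sup_iff_of_torsion hc]
  obtain h | ⟨s, hs, h⟩ := h
  · intro x hx
    obtain ⟨n, hn⟩ := mem_torsionSections.1 hx 1 (h ▸ trivial)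
    rw [one_pow, one_smul] at hn
    exact hn ▸ ModuleChain.isBoundary_zero _ _
  · exact (ModuleChain.vanish_sup_span_of_torsion hc s i hs).of_radical_eq h.symm

/-- If every integral closed subset of the support of `N` lies in some `V(P)` within which `Z` is
the zero set of fewer than `i` functions, then the `i`-th local cohomology of `N` vanishes. -/
theorem derivedVanish_tilde_of_forall_prime
    (hZ : (Z : Set (Spec R)) = PrimeSpectrum.zeroLocus I) {i : ℕ}
    (N : Type u) [AddCommGroup N] [Module R N] [Module.Finite R N]
    (h : ∀ q : Ideal R, q.IsPrime → Module.annihilator R N ≤ q → ∃ P ≤ q, I ⊔ P = ⊤ ∨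
      ∃ s : Finset R, s.card < i ∧ (I ⊔ P).radical = (P ⊔ Ideal.span s).radical) :
    DerivedVanish (sectionsSupportedIn Z) i (tilde (ModuleCat.of R N)) := by
  revert h
  induction ‹Module.Finite R N› using
    IsNoetherianRing.induction_on_isQuotientEquivQuotientPrime R with
  | subsingleton N =>
    intro _
    have h0 : IsZero (ModuleCat.of R N) := ModuleCat.isZero_of_subsingleton _
    have h1 : IsZero (tilde (ModuleCat.of R N)) := isZero_map (tilde.functor R) h0
    exact DerivedVanish.of_isZero h1 i
  | quotient N p e =>
    intro h
    obtain ⟨P, hP, hPI⟩ := h p.1 p.2 (by rw [e.annihilator_eq, Ideal.annihilator_quotient])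
    refine derivedVanish_tilde_of_torsion hZ hPI _ fun x => mem_torsionSections.2 fun a ha =>
      ⟨1, e.injective ?_⟩
    have h1 : a ∈ Module.annihilator R (R ⧸ p.1) := by
      rw [Ideal.annihilator_quotient]
      exact hP ha
    rw [pow_one, map_smul, map_zero]
    exact Module.mem_annihilator.1 h1 _
  | exact N₁ N₂ N₃ f g hf hg hfg h₁ h₃ =>
    intro h
    obtain ⟨S, hS, e₁, e₂, e₃⟩ := shortExact_tilde f g hf hg hfg
    rw [← e₂]
    refine DerivedVanish.of_shortExact hS ?_ ?_
    · rw [e₁]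
      exact h₁ fun q hq hle => h q hq ((f.annihilator_le_of_injective hf).trans hle)
    · rw [e₃]
      exact h₃ fun q hq hle => h q hq ((g.annihilator_le_of_surjective hg).trans hle)

/-- A closed point of `V(K)` is an isolated point of the zero set in `V(K)` of at most `dim V(K)`
functions. -/
lemma exists_finset_mem_minimalPrimes {A : Type*} [CommRing A] [IsNoetherianRing A]
    {K w : Ideal A} [w.IsPrime] (hKw : K ≤ w) {e : ℕ} (he : ringKrullDim (A ⧸ K) ≤ e) :
    ∃ s : Finset A, s.card ≤ e ∧ w ∈ (K ⊔ Ideal.span s).minimalPrimes := by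
  classical
  let π := Ideal.Quotient.mk K
  have hπ : Function.Surjective π := Ideal.Quotient.mk_surjective
  have hker : RingHom.ker π ≤ w := (Ideal.mk_ker (I := K)).le.trans hKw
  have hprime : (w.map π).IsPrime := Ideal.map_isPrime_of_surjective hπ hker
  obtain ⟨s, hs, hcard⟩ := Ideal.exists_finset_card_eq_height_of_isNoetherianRing (w.map π)
  choose σ hσ using id hπ
  refine ⟨s.image σ, Finset.card_image_le.trans ?_, ?_⟩
  · have h1 := (Ideal.height_le_ringKrullDim_of_ne_top hprime.ne_top).trans he
    rw [← hcard] at h1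
    exact_mod_cast h1
  · have h1 := Ideal.minimalPrimes_comap_of_surjective hπ hs
    have h2 : (w.map π).comap π = w := by
      rw [Ideal.comap_map_of_surjective π hπ, ← RingHom.ker_eq_comap_bot, sup_eq_left]
      exact hker
    have h3 : (Ideal.span (s.image σ : Set A)).map π = Ideal.span s := by
      rw [Ideal.map_span, Finset.coe_image, Set.image_image]
      simp [π, hσ]
    rw [h2, ← h3, Ideal.comap_map_of_surjective π hπ, ← RingHom.ker_eq_comap_bot, Ideal.mk_ker,
      sup_comm] at h1
    exact h1

lemma exists_linearMap_quotient_ne_zero {A : Type*} [CommRing A] {P : Ideal A} [P.IsPrime]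
    {N : Type*} [AddCommGroup N] [Module A N] [Module.Finite A N]
    (f : N →ₗ[A] FractionRing (A ⧸ P)) (hf : f ≠ 0) : ∃ φ : N →ₗ[A] A ⧸ P, φ ≠ 0 := by
  classical
  let B := A ⧸ P
  let K := FractionRing B
  obtain ⟨s, hs⟩ := Module.Finite.fg_top (R := A) (M := N)
  obtain ⟨b, hb⟩ := IsLocalization.exist_integer_multiples_of_finset (nonZeroDivisors B) (s.image f)
  let emb : B →ₗ[A] K := (IsScalarTower.toAlgHom A B K).toLinearMap
  have hemb : Function.Injective emb := IsFractionRing.injective B K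
  obtain ⟨β, hβ⟩ := Ideal.Quotient.mk_surjective (b : B)
  have hsmul : ∀ y : K, β • y = (b : B) • y := fun y => by
    rw [← hβ]
    exact (algebraMap_smul B β y).symm
  have hr : ∀ x, (β • f) x ∈ LinearMap.range emb := by
    intro x
    have hx : x ∈ Submodule.span A (s : Set N) := hs ▸ trivial
    refine (Submodule.span_le (p := (LinearMap.range emb).comap (β • f))).2 ?_ hx
    intro y hy
    obtain ⟨z, hz⟩ := hb (f y) (Finset.mem_image_of_mem f hy)
    exact ⟨z, hz.trans (hsmul _).symm⟩
  refine ⟨(LinearEquiv.ofInjective emb hemb).symm.toLinearMap ∘ₗ (β • f).codRestrict _ hr,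
    fun h0 => hf (LinearMap.ext fun x => ?_)⟩
  have h1 := LinearMap.congr_fun h0 x
  have h2 : (β • f).codRestrict _ hr x = 0 := 
    (LinearEquiv.ofInjective emb hemb).symm.map_eq_zero_iff.1 h1
  have h3 : (b : B) • f x = 0 := (hsmul _).symm.trans (congrArg Subtype.val h2)
  exact (smul_eq_zero.1 h3).resolve_left (nonZeroDivisors.coe_ne_zero b)

/-- Let `N` be a module on an affine variety that does not vanish at the generic point of `V(P)`.
If the local cohomology of `N` with supports in `V(I)` vanished in all degrees at least `m`, then so
would that of a non-zero ideal of `R ⧸ P`, and the dimension of `V(I) ∩ V(P)` would be greater than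
`dim V(P) - m`. -/
theorem false_of_derivedVanish_tilde (k : Type u) [Field k] [IsAlgClosed k] [Algebra k R]
    [Algebra.FiniteType k R] (hZ : (Z : Set (Spec R)) = PrimeSpectrum.zeroLocus I)
    {P w : Ideal R} [P.IsPrime] [w.IsMaximal] (hIP : I ⊔ P ≤ w)
    (N : Type u) [AddCommGroup N] [Module R N] [Module.Finite R N]
    (hNP : Module.annihilator R N ≤ P) {m e D : ℕ}
    (hD : Algebra.trdeg k (R ⧸ P) = D) (hmD : m + e ≤ D) (he : ringKrullDim (R ⧸ I ⊔ P) ≤ e)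
    (h : ∀ i ≥ m, DerivedVanish (sectionsSupportedIn Z) i (tilde (ModuleCat.of R N)))
    (h' : ∀ i > m, ∀ N' : Submodule R N,
      DerivedVanish (sectionsSupportedIn Z) i (tilde (ModuleCat.of R N'))) : False := by
  obtain ⟨φ, hφ⟩ : ∃ φ : N →ₗ[R] R ⧸ P, φ ≠ 0 := by
    have hK : Module.annihilator R N ≤ RingHom.ker (algebraMap R (FractionRing (R ⧸ P))) := by
      intro a ha
      have h1 : algebraMap R (R ⧸ P) a = 0 := Ideal.Quotient.eq_zero_iff_mem.2 (hNP ha)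
      rw [RingHom.mem_ker, IsScalarTower.algebraMap_apply R (R ⧸ P), h1, map_zero]
    obtain ⟨f, hf⟩ := exists_linearMap_ne_zero hK
    exact exists_linearMap_quotient_ne_zero f hf
  obtain ⟨S, hS, e₁, e₂, e₃⟩ := shortExact_tilde (LinearMap.ker φ).subtype φ.rangeRestrict
    Subtype.val_injective φ.surjective_rangeRestrict
    (by rw [LinearMap.exact_iff, LinearMap.ker_rangeRestrict, Submodule.range_subtype])
  have hS' : ∀ i ≥ m, DerivedVanish (sectionsSupportedIn Z) i
      (tilde (ModuleCat.of R (LinearMap.range φ))) := by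
    intro i hi
    rw [← e₃]
    refine DerivedVanish.quotient hS ?_ ?_
    · rw [e₂]
      exact h i hi
    · rw [e₁]
      exact h' _ (Nat.lt_succ_of_le hi) _
  obtain ⟨c, hc₀, hc⟩ := ModuleChain.exists_torsion P (ModuleCat.of R (LinearMap.range φ))
    fun x => mem_torsionSections_of_map (LinearMap.range φ).subtype Subtype.val_injective
      (mem_torsionSections.2 fun a ha => ⟨1, by
        obtain ⟨b, hb⟩ := Ideal.Quotient.mk_surjective ((LinearMap.range φ).subtype x)
        rw [← hb, pow_one, Algebra.smul_def]
        exact mul_eq_zero_of_left (Ideal.Quotient.eq_zero_iff_mem.2 ha) _⟩)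
  obtain ⟨s, hs, hw⟩ := exists_finset_mem_minimalPrimes hIP he
  have hvan : ∀ i ≥ m + s.card, c.Vanish (I ⊔ P ⊔ Ideal.span s) i :=
    ModuleChain.Vanish.sup_span_finset (fun i hi => by
      rw [ModuleChain.vanish_sup_iff_of_torsion hc, ← derivedVanish_tilde_iff hZ, hc₀]
      exact hS' i hi) s
  obtain ⟨ψ, hψ⟩ : ∃ ψ : c.N 0 →ₗ[R] R ⧸ P, ψ ≠ 0 := by
    rw [hc₀]
    refine ⟨(LinearMap.range φ).subtype, fun h0 => hφ (LinearMap.ext fun x => ?_)⟩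
    exact LinearMap.congr_fun h0 (φ.rangeRestrict x)
  exact c.not_vanish_of_isolated_point k P w _ (le_sup_right.trans hIP) hw D hD hc ψ hψ
    (hvan D (by omega))

end Affine

/-! ### Residue fields and dimension -/

lemma trdeg_eq_of_isFractionRing (k B K : Type u) [Field k] [CommRing B] [IsDomain B] [Field K]
    [Algebra k B] [Algebra B K] [Algebra k K] [IsScalarTower k B K] [IsFractionRing B K] :
    Algebra.trdeg k B = Algebra.trdeg k K := by
  have h : Algebra.IsAlgebraic B K := 
    (IsFractionRing.comap_isAlgebraic_iff (K := K)).2 inferInstance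
  have : FaithfulSMul B K := (faithfulSMul_iff_algebraMap_injective B K).2
    (IsFractionRing.injective B K)
  rw [← trdeg_add_eq k B (A := K), trdeg_eq_zero_iff.2 h, add_zero]

/-- The transcendence degree of the residue field of a point can be computed in every affine
chart. -/
lemma exists_trdeg_quotient_eq {k : Type u} [Field k] {X : Scheme.{u}}
    (g : X ⟶ Spec (CommRingCat.of k)) (x : X) :
    ∃ c : Cardinal.{u}, ∀ (R : CommRingCat.{u}) (f : Spec R ⟶ X) [IsOpenImmersion f]
      [Algebra k R] (q : Spec R), f q = x →
      algebraMap k R = (Spec.preimage (f ≫ g)).hom → Algebra.trdeg k (R ⧸ q.asIdeal) = c := by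
  let : Algebra k (X.residueField x) :=
    (Spec.preimage (X.fromSpecResidueField x ≫ g)).hom.toAlgebra
  refine ⟨Algebra.trdeg k (X.residueField x), fun R f _ _ q hq hk => ?_⟩
  subst hq
  have hprime : q.asIdeal.IsPrime := PrimeSpectrum.isPrime q
  rw [trdeg_eq_of_isFractionRing k (R ⧸ q.asIdeal) q.asIdeal.ResidueField]
  let e : X.residueField (f q) ≅ CommRingCat.of q.asIdeal.ResidueField :=
    asIso (f.residueFieldMap q) ≪≫ Scheme.Spec.residueFieldIso R q
  have he : CommRingCat.ofHom (algebraMap k R) ≫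
      CommRingCat.ofHom (algebraMap R q.asIdeal.ResidueField) =
      Spec.preimage (X.fromSpecResidueField (f q) ≫ g) ≫ e.hom := by
    apply Spec.map_injective
    rw [Spec.map_comp, Spec.map_comp, Spec.map_preimage, hk]
    have h1 : Spec.map e.hom = Spec.map (Scheme.Spec.residueFieldIso R q).hom ≫
        Spec.map (f.residueFieldMap q) := Spec.map_comp _ _
    have h2 : Spec.map (Scheme.Spec.residueFieldIso R q).hom ≫ (Spec R).fromSpecResidueField q =
        Spec.map (CommRingCat.ofHom (algebraMap R q.asIdeal.ResidueField)) := by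
      rw [← Scheme.Spec.map_residueFieldIso_inv_eq_fromSpecResidueField, ← Spec.map_comp_assoc]
      simp
    rw [h1, Category.assoc, f.SpecMap_residueFieldMap_fromSpecResidueField_assoc,
      reassoc_of% h2]
    exact congrArg _ (Spec.map_preimage _)
  let e' : X.residueField (f q) ≃ₐ[k] q.asIdeal.ResidueField :=
    { e.commRingCatIsoToRingEquiv with
      commutes' := fun a => by
        have := congrArg (fun φ => φ.hom a) he
        refine this.symm.trans ?_
        exact (IsScalarTower.algebraMap_apply k R q.asIdeal.ResidueField a).symm }
  exact e'.symm.trdeg_eq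

/-! ### Local equations on affine charts -/

section Charts

variable {X : Scheme.{u}} {R : CommRingCat.{u}} (f : Spec R ⟶ X)

/-- Sections over an open neighbourhood of the image of a chart are given by elements of the
ring. -/
lemma exists_mem_basicOpen_iff {U : X.Opens} (hU : ∀ q, f q ∈ U) (a : Γ(X, U)) :
    ∃ b : R, ∀ q : Spec R, f q ∈ X.basicOpen a ↔ b ∉ q.asIdeal := by
  have hle : ⊤ ≤ f ⁻¹ᵁ U := fun q _ => hU q
  let a' : Γ(Spec R, ⊤) := (f.appLE U ⊤ hle).hom a
  refine ⟨(Scheme.ΓSpecIso R).hom.hom a', fun q => ?_⟩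
  have h1 : f ⁻¹ᵁ X.basicOpen a = (Spec R).basicOpen a' := by
    rw [Scheme.preimage_basicOpen]
    have : a' = (Spec R).presheaf.map (homOfLE hle).op (f.app U a) := rfl
    rw [this, Scheme.basicOpen_res]
    exact (inf_eq_right.2 le_top).symm
  have h2 : (Spec R).basicOpen a' = PrimeSpectrum.basicOpen ((Scheme.ΓSpecIso R).hom.hom a') :=
    basicOpen_eq_of_affine' a'
  change q ∈ f ⁻¹ᵁ X.basicOpen a ↔ _
  rw [h1, h2]
  rfl

variable [IsOpenImmersion f]

lemma mem_closure_iff_le {x : X} {p : Spec R} (hp : f p = x) (q : Spec R) :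
    f q ∈ closure {x} ↔ p.asIdeal ≤ q.asIdeal := by
  rw [← hp, ← specializes_iff_mem_closure, f.isOpenEmbedding.isInducing.specializes_iff]
  exact (PrimeSpectrum.le_iff_specializes (p : PrimeSpectrum R) q).symm

omit [IsOpenImmersion f] in
lemma exists_ideal_of_isClosed {Z : Set X} (hZ : IsClosed Z) :
    ∃ I : Ideal R, f ⁻¹' Z = PrimeSpectrum.zeroLocus (I : Set R) :=
  (PrimeSpectrum.isClosed_iff_zeroLocus_ideal _).1 (hZ.preimage f.continuous)

/-- Near a point, the local equations of `x̄ ∩ Z` within `x̄` yield equations in every affine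
chart. -/
lemma exists_local_equations (x z : X) (Z : Closeds X) (i : ℕ)
    (h : (closure {x} ∩ (Z : Set X)).Nonempty → ∃ m < i, IsLocallyCutOutBy x Z m) :
    ∃ W : X.Opens, z ∈ W ∧ ∀ {R : CommRingCat.{u}} (f : Spec R ⟶ X) [IsOpenImmersion f],
      (∀ q, f q ∈ W) → ∀ (p : Spec R), f p = x → ∀ I : Ideal R,
      f ⁻¹' Z = PrimeSpectrum.zeroLocus (I : Set R) → I ⊔ p.asIdeal = ⊤ ∨
        ∃ s : Finset R, s.card < i ∧
          (I ⊔ p.asIdeal).radical = (p.asIdeal ⊔ Ideal.span s).radical := by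
  classical
  have hempty : ∀ W : X.Opens, (∀ y ∈ W, y ∈ closure {x} → y ∉ Z) →
      ∀ {R : CommRingCat.{u}} (f : Spec R ⟶ X) [IsOpenImmersion f],
      (∀ q, f q ∈ W) → ∀ (p : Spec R), f p = x → ∀ I : Ideal R,
      f ⁻¹' Z = PrimeSpectrum.zeroLocus (I : Set R) → I ⊔ p.asIdeal = ⊤ := by
    intro W hW R f _ hf p hp I hI
    by_contra hne
    obtain ⟨w, hw, hle⟩ := Ideal.exists_le_maximal _ hne
    let q : PrimeSpectrum R := ⟨w, hw.isPrime⟩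
    refine hW (f q) (hf q) ((mem_closure_iff_le f hp q).2 (le_sup_right.trans hle)) ?_
    have hq : q ∈ PrimeSpectrum.zeroLocus (I : Set R) := le_sup_left.trans hle
    rw [← hI] at hq
    exact hq
  by_cases hz : z ∈ closure {x}
  · by_cases hne : (closure {x} ∩ (Z : Set X)).Nonempty
    · obtain ⟨m, hm, hcut⟩ := h hne
      obtain ⟨U, hzU, a, ha⟩ := hcut z hz
      refine ⟨U, hzU, fun {R} f _ hf p hp I hI => Or.inr ?_⟩
      choose b hb using fun j => exists_mem_basicOpen_iff f hf (a j)
      refine ⟨Finset.univ.image b, (Finset.card_image_le.trans (by simp)).trans_lt hm, ?_⟩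
      rw [← PrimeSpectrum.zeroLocus_eq_iff]
      ext q
      simp only [PrimeSpectrum.mem_zeroLocus, SetLike.coe_subset_coe, sup_le_iff]
      rw [and_comm]
      refine and_congr_right fun hpq => ?_
      have h1 : f q ∈ Z ↔ I ≤ q.asIdeal := Set.ext_iff.1 hI q
      rw [← h1, ha (f q) (hf q) ((mem_closure_iff_le f hp q).2 hpq), Ideal.span_le]
      simp only [Finset.coe_image, Finset.coe_univ, Set.image_univ, Set.range_subset_iff]
      exact forall_congr' fun j => (not_congr (hb j q)).trans not_not
    · refine ⟨⊤, trivial, fun {R} f _ hf p hp I hI => Or.inl (hempty ⊤ ?_ f hf p hp I hI)⟩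
      exact fun y _ hy hyZ => hne ⟨y, hy, hyZ⟩
  · let W : X.Opens := ⟨(closure {x})ᶜ, isClosed_closure.isOpen_compl⟩
    exact ⟨W, hz, fun {R} f _ hf p hp I hI => Or.inl (hempty W (fun y hyW hy => (hyW hy).elim)
      f hf p hp I hI)⟩

/-- If, within each component of `S` that it meets, `Z` is locally cut out by fewer than `i`
functions, then the local cohomology of coherent sheaves supported in `S` vanishes from degree `i`
on, in sufficiently small affine charts. -/
lemma exists_opens_derivedVanish [IsLocallyNoetherian X] [NoetherianSpace X] {S : Set X}
    (hS : IsClosed S) (z : X) (Z : Closeds X) (i : ℕ)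
    (h : ∀ x ∈ genericPointsOf S, (closure {x} ∩ (Z : Set X)).Nonempty →
      ∃ m < i, IsLocallyCutOutBy x Z m) :
    ∃ W : X.Opens, z ∈ W ∧ ∀ {R : CommRingCat.{u}} (f : Spec R ⟶ X) [IsOpenImmersion f],
      (∀ q, f q ∈ W) → ∀ (N : Type u) [AddCommGroup N] [Module R N] [Module.Finite R N],
      (∀ q : Spec R, Module.annihilator R N ≤ q.asIdeal → f q ∈ S) →
      ∀ j ≥ i, DerivedVanish (sectionsSupportedIn (Z.preimage f.continuous)) j
        (tilde (ModuleCat.of R N)) := by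
  choose W hzW hW using fun x : genericPointsOf S => exists_local_equations x.1 z Z i (h x x.2)
  have := (finite_genericPointsOf hS).to_subtype
  let W' : X.Opens := ⟨⋂ x, W x, isOpen_iInter_of_finite fun x => (W x).2⟩
  refine ⟨W', Set.mem_iInter.2 hzW, fun {R} f _ hf N _ _ _ hN j hj => ?_⟩
  have : IsLocallyNoetherian (Spec R) := isLocallyNoetherian_of_isOpenImmersion f
  have : IsNoetherianRing R := isLocallyNoetherian_Spec.1 this
  obtain ⟨I, hI⟩ := exists_ideal_of_isClosed f Z.isClosed
  refine derivedVanish_tilde_of_forall_prime hI N fun q hq hle => ?_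
  let q' : PrimeSpectrum R := ⟨q, hq⟩
  obtain ⟨x, hx, hxq⟩ := exists_genericPointsOf_specializes hS (hN q' hle)
  obtain ⟨p, hp⟩ := hxq.mem_open f.isOpenEmbedding.isOpen_range ⟨_, rfl⟩
  refine ⟨p.asIdeal,
    (mem_closure_iff_le f hp q').1 (specializes_iff_mem_closure.1 hxq), ?_⟩
  refine (hW ⟨x, hx⟩ f (fun q => Set.mem_iInter.1 (hf q) _) p hp I hI).imp_right ?_
  rintro ⟨s, hs, h'⟩
  exact ⟨s, hs.trans_le hj, h'⟩

/-- The vanishing of local cohomology in degrees at least the number of local equations of `Z`. -/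
theorem derivedVanish_of_isLocallyCutOutBy [IsLocallyNoetherian X] [NoetherianSpace X]
    {M : X.Modules} (hM : IsCoherent M) (Z : Closeds X) (i : ℕ)
    (h : ∀ x ∈ genericPointsOf (support M), (closure {x} ∩ (Z : Set X)).Nonempty →
      ∃ m < i, IsLocallyCutOutBy x Z m) :
    DerivedVanish (sectionsSupportedIn Z) i M := by
  choose W hzW hW using fun z => exists_opens_derivedVanish hM.isClosed_support z Z i h
  choose R f hf p N hN hp hfW e using fun z => hM.exists_chart (hzW z)
  refine derivedVanish_of_restrict f (fun z => ⟨z, p z, hp z⟩)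
    (Z' := fun z => Z.preimage (f z).continuous) (fun z => rfl) i fun z => ?_
  obtain ⟨e⟩ := e z
  refine DerivedVanish.of_iso (hW z (f z) (hfW z) (N z) (fun q hq => ?_) i le_rfl) e
  rw [← mem_support_restrict, ← support_eq_of_iso e]
  exact (mem_support_tilde (N z) q).2 hq

end Charts

/-! ### Non-vanishing of local cohomology -/

section NonVanishing

variable {X : Scheme.{u}}

lemma finiteType_of_algebraMap_eq {k : Type u} [Field k] (g : X ⟶ Spec (CommRingCat.of k))
    [LocallyOfFiniteType g] {R : CommRingCat.{u}} (f : Spec R ⟶ X) [IsOpenImmersion f]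
    [Algebra k R] (h : algebraMap k R = (Spec.preimage (f ≫ g)).hom) : Algebra.FiniteType k R := by
  have h1 : LocallyOfFiniteType (Spec.map (Spec.preimage (f ≫ g))) := by
    rw [Spec.map_preimage]
    infer_instance
  have h2 : (Spec.preimage (f ≫ g)).hom.FiniteType := HasRingHomProperty.Spec_iff.1 h1
  rw [← h] at h2
  exact (RingHom.finiteType_algebraMap (A := k) (B := R)).1 h2

lemma ringKrullDim_quotient_sup_le {R : CommRingCat.{u}} (f : Spec R ⟶ X) [IsOpenImmersion f]
    (x : X) (Z : Closeds X) {p : Spec R} (hp : f p = x) {I : Ideal R}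
    (hI : f ⁻¹' Z = PrimeSpectrum.zeroLocus (I : Set R)) :
    ringKrullDim (R ⧸ I ⊔ p.asIdeal) ≤ topologicalKrullDim (closure {x} ∩ Z : Set X) := by
  let K : Ideal R := I ⊔ p.asIdeal
  have he := PrimeSpectrum.isClosedEmbedding_comap_of_surjective _
    (Ideal.Quotient.mk K) Ideal.Quotient.mk_surjective
  have hmem : ∀ y : PrimeSpectrum (R ⧸ K),
      f (PrimeSpectrum.comap (Ideal.Quotient.mk K) y) ∈ (closure {x} ∩ Z : Set X) := by
    intro y
    let q : PrimeSpectrum R := PrimeSpectrum.comap (Ideal.Quotient.mk K) y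
    have hle : K ≤ q.asIdeal := fun a ha => by
      change Ideal.Quotient.mk K a ∈ y.asIdeal
      rw [Ideal.Quotient.eq_zero_iff_mem.2 ha]
      exact zero_mem _
    have hq : q ∈ PrimeSpectrum.zeroLocus (I : Set R) := le_sup_left.trans hle
    rw [← hI] at hq
    exact ⟨(mem_closure_iff_le f hp q).2 (le_sup_right.trans hle), hq⟩
  rw [← PrimeSpectrum.topologicalKrullDim_eq_ringKrullDim]
  have hind : Topology.IsInducing (fun y => f (PrimeSpectrum.comap (Ideal.Quotient.mk K) y)) :=
    f.isOpenEmbedding.isInducing.comp he.isInducing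
  exact (hind.codRestrict hmem).topologicalKrullDim_le

/-- The dimension of a variety is at most the transcendence degree of its function field. -/
lemma le_of_trdeg_quotient_eq {k : Type u} [Field k] (g : X ⟶ Spec (CommRingCat.of k))
    [LocallyOfFiniteType g] {R : CommRingCat.{u}} (f : Spec R ⟶ X) [IsOpenImmersion f]
    [Algebra k R] (h : algebraMap k R = (Spec.preimage (f ≫ g)).hom) {p : Spec R} {D d : ℕ}
    (hD : Algebra.trdeg k (R ⧸ p.asIdeal) = D)
    (hd : (d : WithBot ℕ∞) ≤ topologicalKrullDim (closure {f p} : Set X)) : d ≤ D := by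
  obtain ⟨c, hc⟩ := exists_trdeg_quotient_eq g (f p)
  obtain ⟨z, hz⟩ := exists_le_topologicalKrullDim_of_isOpenEmbedding hd
  obtain ⟨R', f', hf', hy⟩ : ∃ (R' : CommRingCat.{u}) (f' : Spec R' ⟶ X)
      (_ : IsOpenImmersion f'), z ∈ Set.range f' := by
    obtain ⟨U, hU, hzU, -⟩ := exists_isAffineOpen_mem_and_subset (U := ⊤) (Opens.mem_top z)
    exact ⟨_, hU.fromSpec, inferInstance, hU.range_fromSpec ▸ hzU⟩
  obtain ⟨q, hq, hdq⟩ := hz f'.isOpenEmbedding hy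
  let : Algebra k R' := (Spec.preimage (f' ≫ g)).hom.toAlgebra
  have : Algebra.FiniteType k R' := finiteType_of_algebraMap_eq g f' rfl
  have hD' : Algebra.trdeg k (R' ⧸ q.asIdeal) = D :=
    (hc R' f' q hq rfl).trans ((hc R f p rfl h).symm.trans hD)
  have hprime : q.asIdeal.IsPrime := PrimeSpectrum.isPrime q
  have h1 : topologicalKrullDim (closure {q} : Set (Spec R')) = ringKrullDim (R' ⧸ q.asIdeal) :=
    topologicalKrullDim_closure_singleton_eq_ringKrullDim (q : PrimeSpectrum R')
  have h2 := (hdq.trans_eq h1).trans (ringKrullDim_le_of_trdeg_eq k (R' ⧸ q.asIdeal) D hD')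
  exact_mod_cast h2

/-- If `x̄` is a component of the support of `M` within which `Z` has the expected dimension, and no
component needs more than `m` equations for `Z`, then the local cohomology of `M` does not vanish
from degree `m` on. -/
theorem not_derivedVanish_of_isLocallyCutOutBy {k : Type u} [Field k] [IsAlgClosed k]
    (g : X ⟶ Spec (CommRingCat.of k)) [LocallyOfFiniteType g] [CompactSpace X]
    {M : X.Modules} (hM : IsCoherent M) (Z : Closeds X) {m e d : ℕ}
    (h : ∀ x ∈ genericPointsOf (support M), (closure {x} ∩ (Z : Set X)).Nonempty →
      ∃ m' < m + 1, IsLocallyCutOutBy x Z m')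
    {x : X} (hx : x ∈ genericPointsOf (support M)) (hne : (closure {x} ∩ (Z : Set X)).Nonempty)
    (hd : (d : WithBot ℕ∞) ≤ topologicalKrullDim (closure {x} : Set X))
    (he : topologicalKrullDim (closure {x} ∩ Z : Set X) = (e : WithBot ℕ∞)) (hme : m + e ≤ d) :
    ∃ i ≥ m, ¬ DerivedVanish (sectionsSupportedIn Z) i M := by
  by_contra! hvan
  have hX : IsLocallyNoetherian X := LocallyOfFiniteType.isLocallyNoetherian g
  have hX' : IsNoetherian X := {}
  obtain ⟨z, hz, hzcl⟩ := (isClosed_closure.inter Z.isClosed).exists_closed_singleton hne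
  obtain ⟨W, hzW, hW⟩ := exists_opens_derivedVanish hM.isClosed_support z Z (m + 1) h
  obtain ⟨R, f, hf, w, N, hN, rfl, hfW, ⟨ε⟩⟩ := hM.exists_chart hzW
  have hsupp : ∀ q : Spec R, f q ∈ support M ↔ Module.annihilator R N ≤ q.asIdeal := by
    intro q
    rw [← mem_support_restrict, ← support_eq_of_iso ε, mem_support_tilde]
  obtain ⟨p, rfl⟩ :=
    (specializes_iff_mem_closure.2 hz.1).mem_open f.isOpenEmbedding.isOpen_range ⟨w, rfl⟩
  let : Algebra k R := (Spec.preimage (f ≫ g)).hom.toAlgebra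
  have hft : Algebra.FiniteType k R := finiteType_of_algebraMap_eq g f rfl
  have hR : IsNoetherianRing R := Algebra.FiniteType.isNoetherianRing k R
  have hprime : p.asIdeal.IsPrime := PrimeSpectrum.isPrime p
  have hmax : w.asIdeal.IsMaximal := by
    refine (PrimeSpectrum.isClosed_singleton_iff_isMaximal (w : PrimeSpectrum R)).1 ?_
    have h1 : f ⁻¹' {f w} = {w} := by
      ext q
      exact f.isOpenEmbedding.injective.eq_iff
    exact h1 ▸ hzcl.preimage f.continuous
  obtain ⟨I, hI⟩ := exists_ideal_of_isClosed f Z.isClosed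
  obtain ⟨D, hD⟩ := exists_trdeg_eq k (R ⧸ p.asIdeal)
  have hdD : d ≤ D := le_of_trdeg_quotient_eq g f rfl hD hd
  have hIw : I ≤ w.asIdeal := (Set.ext_iff.1 hI w).1 hz.2
  refine false_of_derivedVanish_tilde (Z := Z.preimage f.continuous) k hI
    (sup_le hIw ((mem_closure_iff_le f rfl w).1 hz.1)) N ((hsupp p).1 hx.1) hD
    (hme.trans hdD) ((ringKrullDim_quotient_sup_le f _ Z rfl hI).trans_eq he) (fun i hi => ?_)
    fun i hi N' => ?_
  · exact (derivedVanish_restrict (f := f) rfl i (hvan i hi)).of_iso ε.symm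
  · refine hW f hfW N' (fun q hq => (hsupp q).2 ?_) i hi
    exact (N'.subtype.annihilator_le_of_injective Subtype.val_injective).trans hq

end NonVanishing

/-! ### Measuring families -/

section Measuring

lemma exists_topologicalKrullDim_eq {X : Type*} [TopologicalSpace X] [NoetherianSpace X]
    [QuasiSober X] [T0Space X] {S : Set X} (hS : IsClosed S) (hne : S.Nonempty)
    (h : ∀ x ∈ genericPointsOf S, ∃ d : ℕ,
      topologicalKrullDim (closure {x} : Set X) = (d : WithBot ℕ∞)) :
    ∃ d : ℕ, topologicalKrullDim S = (d : WithBot ℕ∞) := by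
  choose d hd using fun x : genericPointsOf S => h x x.2
  have := (finite_genericPointsOf hS).to_subtype
  obtain ⟨B, hB⟩ := Set.finite_range d |>.bddAbove
  have hlt : ¬ ((B + 1 : ℕ) : WithBot ℕ∞) ≤ topologicalKrullDim S := fun hle => by
    obtain ⟨x, hx, hxd⟩ := exists_genericPointsOf_le_topologicalKrullDim hS hle
    rw [hd ⟨x, hx⟩] at hxd
    have h1 : B + 1 ≤ d ⟨x, hx⟩ := by exact_mod_cast hxd
    have h2 : d ⟨x, hx⟩ ≤ B := hB ⟨_, rfl⟩
    omega
  have hge : ((0 : ℕ) : WithBot ℕ∞) ≤ topologicalKrullDim S := by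
    obtain ⟨s, hs⟩ := hne
    refine (le_topologicalKrullDim_iff_of_isClosed hS 0).2 ⟨fun _ => s, fun _ => hs, ?_⟩
    intro i j hij
    omega
  generalize topologicalKrullDim S = D at hlt hge
  induction D using WithBot.recBotCoe with
  | bot => simp at hge
  | coe D =>
    induction D using WithTop.recTopCoe with
    | top => exact (hlt le_top).elim
    | coe n => exact ⟨n, rfl⟩

variable {S : Scheme.{u}} {G X : Over S} [GrpObj G] [ModObj G X]

lemma EquivariantCoherentSheaf.genericPointsOf_subset_topPoints (F : EquivariantCoherentSheaf G X) :
    genericPointsOf (support F.sheaf) ⊆ topPoints G X :=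
  fun _ hx => ⟨F.closedSupport, F.isInvariant_support, hx.1, hx.2⟩

lemma IsMeasuringFamily.exists_topologicalKrullDim_closure_eq {p : Perversity X.left}
    {M : Set (Closeds X.left)} (hM : IsMeasuringFamily G X p M) {x : X.left}
    (hx : x ∈ topPoints G X) :
    ∃ d : ℕ, topologicalKrullDim (closure {x} : Set X.left) = (d : WithBot ℕ∞) := by
  obtain ⟨Z, hZ, hne⟩ := hM.meets x hx
  obtain ⟨d, hd, -⟩ := hM.isMeasuring Z hZ x hx (Set.inter_comm _ _ ▸ hne)
  exact ⟨d.1, hd⟩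

end Measuring

end PerverseCoherent
open PerverseCoherent in
theorem mainTheorem5 {k : Type u} [Field k] [IsAlgClosed k]
    (X : Over (Spec (.of k))) [LocallyOfFiniteType X.hom] [QuasiCompact X.hom] [IsSeparated X.hom]
    (G : Over (Spec (.of k))) [GrpObj G] [LocallyOfFiniteType G.hom] [QuasiCompact G.hom]
    [ModObj G X] (hG : HasFinitelyManyOrbits G X)
    (F : EquivariantCoherentSheaf G X)
    (p : Perversity X.left) (hp : Antitone p) (n : ℤ)
    (M : Set (Closeds X.left)) (hM : IsMeasuringFamily G X p M) :
    (∀ d, topologicalKrullDim (support F.sheaf) = (d.1 : WithBot ℕ∞) → n ≤ p d) ↔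
      ∀ i : ℕ, -n + 1 ≤ (i : ℤ) → ∀ Z ∈ M, IsZero ((localCohomologySheaf Z i).obj F.sheaf) := by
  have hcompact : CompactSpace X.left := QuasiCompact.compactSpace_of_compactSpace X.hom
  have hln : IsLocallyNoetherian X.left := LocallyOfFiniteType.isLocallyNoetherian X.hom
  have hnoeth : IsNoetherian X.left := {}
  have hcl := F.isCoherent.isClosed_support
  have hT := F.genericPointsOf_subset_topPoints
  constructor
  · intro h i hi Z hZ
    refine derivedVanish_of_isLocallyCutOutBy F.isCoherent Z i fun x hx hne => ?_
    obtain ⟨d, hd, -, m, hm, hcut⟩ := hM.isMeasuring Z hZ x (hT hx) hne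
    obtain ⟨D, hD⟩ := exists_topologicalKrullDim_eq hcl ⟨x, hx.1⟩
      fun y hy => hM.exists_topologicalKrullDim_closure_eq (hT hy)
    let D' : {d : ℕ // (d : WithBot ℕ∞) ≤ topologicalKrullDim X.left} :=
      ⟨D, hD ▸ topologicalKrullDim_subspace_le X.left _⟩
    have hdD : d ≤ D' := by
      have h1 := topologicalKrullDim_closure_le_of_mem hcl hx.1
      rw [hd, hD] at h1
      exact Subtype.coe_le_coe.1 (by exact_mod_cast h1)
    have h1 := h D' hD
    have h2 := hp hdD
    exact ⟨m, by omega, hcut⟩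
  · intro h d hd
    obtain ⟨x, hx, hxd⟩ := exists_genericPointsOf_le_topologicalKrullDim hcl hd.ge
    obtain ⟨Z, hZ, hne⟩ := hM.meets x (hT hx)
    rw [Set.inter_comm] at hne
    obtain ⟨d', hd', ⟨e, he, hed⟩, m, hm, -⟩ := hM.isMeasuring Z hZ x (hT hx) hne
    -- The component `x̄` has maximal dimension, so that its number of equations is the largest.
    obtain rfl : d' = d := by
      have h1 := topologicalKrullDim_closure_le_of_mem hcl hx.1
      rw [hd', hd] at h1
      rw [hd'] at hxd
      exact Subtype.ext (le_antisymm (by exact_mod_cast h1) (by exact_mod_cast hxd))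
    by_contra hlt
    have hcut : ∀ y ∈ genericPointsOf (support F.sheaf), (closure {y} ∩ (Z : Set X.left)).Nonempty →
        ∃ m' < m + 1, IsLocallyCutOutBy y Z m' := by
      intro y hy hny
      obtain ⟨d₁, hd₁, -, m₁, hm₁, hcut⟩ := hM.isMeasuring Z hZ y (hT hy) hny
      have hle : d₁ ≤ d' := by
        have h1 := topologicalKrullDim_closure_le_of_mem hcl hy.1
        rw [hd₁, hd] at h1
        exact Subtype.coe_le_coe.1 (by exact_mod_cast h1)
      have h2 := hp hle
      exact ⟨m₁, by omega, hcut⟩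
    obtain ⟨i, hi, hi'⟩ := not_derivedVanish_of_isLocallyCutOutBy X.hom F.isCoherent Z hcut hx hne
      hxd he (d := d'.1) (e := e) (by omega)
    exact hi' (h i (by omega) Z hZ)
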